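/- Let $k$ be a commutative ring, $A$ a (unital, associative) $k$-algebra, and let $(U,A)$ be a left bialgebroid with source $s\colon A\to U$, target $t\colon A^{\mathrm{op}}\to U$, coproduct $\Delta(u)=u_{(1)}\otimes_A u_{(2)}$ and counit $\varepsilon$. Write $a\triangleright u\triangleleft b=s(a)t(b)u$ and $a\blacktriangleright u\blacktriangleleft b=u\,t(a)s(b)$; so $\Delta$ takes values in the Takeuchi product inside $U_{\triangleleft}\otimes_A{}_{\triangleright}U$. Let $U_*=\{\psi\colon U\to A\ k\text{-linear} : \psi(s(a)u)=a\psi(u)\}$ be the left dual and $U^*=\{\phi\colon U\to A\ k\text{-linear} : \phi(t(a)u)=\phi(u)a\}$ the right dual. They are $A^e$-rings with augmentation, with products $$(\psi\psi')(u)=\psi'\big(t(\psi(u_{(2)}))u_{(1)}\big),\qquad (\phi\phi')(u)=\phi'\big(s(\phi(u_{(1)}))u_{(2)}\big),$$ both with unit $\varepsilon$; source and target of $U_*$ are $a\mapsto\varepsilon(-)a$ and $a\mapsto\varepsilon(-\,t(a))$, source and target of $U^*$ are $a\mapsto\varepsilon(-\,s(a))$ and $a\mapsto a\,\varepsilon(-)$;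 in both cases the augmentation (counit) is evaluation at $1_U$. If ${}_{\triangleright}U$ is a finitely generated projective left $A$-module, $U_*$ is a right bialgebroid with the coproduct $\psi\mapsto\psi^{(1)}\otimes_A\psi^{(2)}$ determined by $\psi(uv)=\psi^{(2)}\big(u\,s(\psi^{(1)}(v))\big)$; if $U_{\triangleleft}$ is a finitely generated projective right $A$-module, $U^*$ is a right bialgebroid with the coproduct determined by $\phi(uv)=\phi^{(1)}\big(u\,t(\phi^{(2)}(v))\big)$. (i) Assume that $U$ is a left Hopf algebroid, i.e. the map $\alpha_\ell\colon {}_{\blacktriangleright}U\otimes_{A^{\mathrm{op}}}U_{\triangleleft}\to U_{\triangleleft}\otimes_A{}_{\triangleright}U$, $u\otimes v\mapsto u_{(1)}\otimes u_{(2)}v$, is bijective, and put $u_+\otimes u_-=\alpha_\ell^{-1}(u\otimes 1)$. Then $$S^*(\phi)(u)=\varepsilon\big(u_+\,t(\phi(u_-))\big)\qquad(\phi\in U^*,\ u\in U)$$ defines a morphism $S^*\colon U^*\to U_*$ of $A^e$-rings with augmentation (a unital $k$-algebra map that commutes with sources, targets and augmentations). If in addition both ${}_{\triangleright}U$ and $U_{\triangleleft}$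 are finitely generated projective over $A$, then $(S^*,\mathrm{id}_A)$ is a morphism of right bialgebroids. In any case (without finiteness assumptions), $S^*$ is a morphism of left $U$-modules for the action $(u\phi)(m)=\varepsilon\big(u_+\,t(\phi(u_-m))\big)$ on $U^*$ and the action $(u\psi)(m)=\psi(mu)$ on $U_*$. (ii) Assume that $U$ is a right Hopf algebroid, i.e. the map $\alpha_r\colon U_{\blacktriangleleft}\otimes^{A}{}_{\triangleright}U\to U_{\triangleleft}\otimes_A{}_{\triangleright}U$, $u\otimes v\mapsto u_{(1)}v\otimes u_{(2)}$ (where the source is $U\otimes_k U$ modulo $u\,s(a)\otimes v=u\otimes s(a)v$), is bijective, and put $u_{[+]}\otimes u_{[-]}=\alpha_r^{-1}(1\otimes u)$. Then $$S_*(\psi)(u)=\varepsilon\big(u_{[+]}\,s(\psi(u_{[-]}))\big)\qquad(\psi\in U_*,\ u\in U)$$ defines a morphism $S_*\colon U_*\to U^*$ of $A^e$-rings with augmentation. If in addition both ${}_{\triangleright}U$ and $U_{\triangleleft}$ are finitely generated projective over $A$, then $(S_*,\mathrm{id}_A)$ is a morphism of right bialgebroids. In any case, $S_*$ is a morphism of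 left $U$-modules for the action $(u\psi)(m)=\varepsilon\big(u_{[+]}\,s(\psi(u_{[-]}m))\big)$ on $U_*$ and the action $(u\phi)(m)=\phi(mu)$ on $U^*$. -/

import Mathlib

open scoped TensorProduct
open MulOpposite

namespace HopfAlgd

/-! Balanced tensor products over a noncommutative base. -/

section Balanced

variable {k ι κ M N P M' N' : Type*} [CommRing k] [AddCommGroup M] [Module k M]
  [AddCommGroup N] [Module k N] [AddCommGroup P] [Module k P]
  [AddCommGroup M'] [Module k M'] [AddCommGroup N'] [Module k N']

/-- The `k`-submodule of `M ⊗[k] N` spanned by all `ρ i m ⊗ n - m ⊗ l i n`. -/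
def balRel (ρ : ι → Module.End k M) (l : ι → Module.End k N) : Submodule k (M ⊗[k] N) :=
  Submodule.span k {x | ∃ i m n, x = ρ i m ⊗ₜ[k] n - m ⊗ₜ[k] l i n}

/-- The balanced tensor product `M ⊗ N` modulo `ρ i m ⊗ n = m ⊗ l i n`. If `ρ` is a right action of
a ring `A` on `M` and `l` a left action of `A` on `N`, then this is `M ⊗_A N`. -/
def BalTensor (ρ : ι → Module.End k M) (l : ι → Module.End k N) : Type _ :=
  (M ⊗[k] N) ⧸ balRel ρ l

namespace BalTensor

instance (ρ : ι → Module.End k M) (l : ι → Module.End k N) : AddCommGroup (BalTensor ρ l) :=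
  inferInstanceAs (AddCommGroup ((M ⊗[k] N) ⧸ balRel ρ l))

instance (ρ : ι → Module.End k M) (l : ι → Module.End k N) : Module k (BalTensor ρ l) :=
  inferInstanceAs (Module k ((M ⊗[k] N) ⧸ balRel ρ l))

/-- The projection from `M ⊗[k] N`. -/
def proj (ρ : ι → Module.End k M) (l : ι → Module.End k N) : M ⊗[k] N →ₗ[k] BalTensor ρ l :=
  (balRel ρ l).mkQ

/-- The class of the elementary tensor `m ⊗ n`. -/
def tmul (ρ : ι → Module.End k M) (l : ι → Module.End k N) (m : M) (n : N) : BalTensor ρ l :=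
  proj ρ l (m ⊗ₜ[k] n)

variable {ρ : ι → Module.End k M} {l : ι → Module.End k N}
  {ρ' : κ → Module.End k M'} {l' : κ → Module.End k N'}

theorem tmul_add (m : M) (n n' : N) : tmul ρ l m (n + n') = tmul ρ l m n + tmul ρ l m n' := by
  rw [tmul, TensorProduct.tmul_add, map_add]; rfl

theorem add_tmul (m m' : M) (n : N) : tmul ρ l (m + m') n = tmul ρ l m n + tmul ρ l m' n := by
  rw [tmul, TensorProduct.add_tmul, map_add]; rfl

theorem smul_tmul (c : k) (m : M) (n : N) : tmul ρ l (c • m) n = c • tmul ρ l m n := by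
  rw [tmul, tmul, ← map_smul, TensorProduct.smul_tmul']

theorem tmul_smul (c : k) (m : M) (n : N) : tmul ρ l m (c • n) = c • tmul ρ l m n := by
  rw [tmul, tmul, ← map_smul, TensorProduct.tmul_smul]

@[simp]
theorem tmul_zero (m : M) : tmul ρ l m 0 = 0 := by rw [tmul, TensorProduct.tmul_zero, map_zero]

@[simp]
theorem zero_tmul (n : N) : tmul ρ l 0 n = 0 := by rw [tmul, TensorProduct.zero_tmul, map_zero]

theorem tmul_balanced (i : ι) (m : M) (n : N) : tmul ρ l (ρ i m) n = tmul ρ l m (l i n) :=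
  (Submodule.Quotient.eq (balRel ρ l)).2 (Submodule.subset_span ⟨i, m, n, rfl⟩)

/-- Elementary tensors as a bilinear map. -/
def mk (ρ : ι → Module.End k M) (l : ι → Module.End k N) : M →ₗ[k] N →ₗ[k] BalTensor ρ l :=
  LinearMap.mk₂ k (tmul ρ l) add_tmul smul_tmul tmul_add tmul_smul

@[simp]
theorem mk_apply (m : M) (n : N) : mk ρ l m n = tmul ρ l m n := rfl

theorem tmul_sum {γ : Type*} (s : Finset γ) (m : M) (f : γ → N) :
    tmul ρ l m (∑ i ∈ s, f i) = ∑ i ∈ s, tmul ρ l m (f i) := map_sum (mk ρ l m) f s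

theorem sum_tmul {γ : Type*} (s : Finset γ) (f : γ → M) (n : N) :
    tmul ρ l (∑ i ∈ s, f i) n = ∑ i ∈ s, tmul ρ l (f i) n := map_sum ((mk ρ l).flip n) f s

theorem induction {p : BalTensor ρ l → Prop} (x : BalTensor ρ l) (h0 : p 0)
    (ht : ∀ m n, p (tmul ρ l m n)) (ha : ∀ x y, p x → p y → p (x + y)) : p x := by
  obtain ⟨y, rfl⟩ := (balRel ρ l).mkQ_surjective x
  induction y with
  | zero => rw [map_zero]; exact h0
  | tmul m n => exact ht m n
  | add a b h1 h2 => rw [map_add]; exact ha _ _ h1 h2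

/-- The linear map out of a balanced tensor product given by a balanced bilinear map. -/
def lift (f : M →ₗ[k] N →ₗ[k] P) (h : ∀ i m n, f (ρ i m) n = f m (l i n)) :
    BalTensor ρ l →ₗ[k] P :=
  (balRel ρ l).liftQ (TensorProduct.lift f) (by
    rw [balRel, Submodule.span_le]
    rintro x ⟨i, m, n, rfl⟩
    simp [h])

@[simp]
theorem lift_tmul (f : M →ₗ[k] N →ₗ[k] P) (h : ∀ i m n, f (ρ i m) n = f m (l i n)) (m : M) (n : N) :
    lift f h (tmul ρ l m n) = f m n := rfl

theorem hom_ext {f g : BalTensor ρ l →ₗ[k] P} (h : ∀ m n, f (tmul ρ l m n) = g (tmul ρ l m n)) :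
    f = g := by
  ext x
  induction x using induction with
  | h0 => simp
  | ht m n => exact h m n
  | ha x y h1 h2 => simp [h1, h2]

/-- The map `f ⊗ g` between balanced tensor products, over a map `e` of the index sets. -/
def map (e : ι → κ) (f : M →ₗ[k] M') (g : N →ₗ[k] N') (hf : ∀ i m, f (ρ i m) = ρ' (e i) (f m))
    (hg : ∀ i n, g (l i n) = l' (e i) (g n)) : BalTensor ρ l →ₗ[k] BalTensor ρ' l' :=
  lift ((mk ρ' l').compl₁₂ f g) (by intro i m n; simp [hf, hg, tmul_balanced])

@[simp]
theorem map_tmul (e : ι → κ) (f : M →ₗ[k] M') (g : N →ₗ[k] N')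
    (hf : ∀ i m, f (ρ i m) = ρ' (e i) (f m)) (hg : ∀ i n, g (l i n) = l' (e i) (g n)) (m : M)
    (n : N) : map e f g hf hg (tmul ρ l m n) = tmul ρ' l' (f m) (g n) := rfl

end BalTensor

end Balanced

/-! Bimodules and corings. -/

section Bimodules

/-- An `(A, A)`-bimodule structure on the `k`-module `M`, with `k` acting centrally: a left action
`l` and a right action `r` that commute. -/
structure Bimod (k A M : Type*) [CommRing k] [Ring A] [Algebra k A] [AddCommGroup M]
    [Module k M] where
  l : A →ₐ[k] Module.End k M
  r : Aᵐᵒᵖ →ₐ[k] Module.End k M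
  comm : ∀ a b m, l a (r b m) = r b (l a m)

namespace Bimod

variable {k A M N P : Type*} [CommRing k] [Ring A] [Algebra k A] [AddCommGroup M]
  [Module k M] [AddCommGroup N] [Module k N] [AddCommGroup P] [Module k P]

/-- The tensor product `M ⊗_A N` of two bimodules. -/
abbrev Tensor (B : Bimod k A M) (C : Bimod k A N) : Type _ :=
  BalTensor (fun a : A => B.r (op a)) (fun a : A => C.l a)

/-- The elementary tensor `m ⊗_A n`. -/
abbrev tmul (B : Bimod k A M) (C : Bimod k A N) (m : M) (n : N) : B.Tensor C :=
  BalTensor.tmul (fun a : A => B.r (op a)) (fun a : A => C.l a) m n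

/-- The bimodule structure `a (m ⊗ n) b = a m ⊗ n b` on `M ⊗_A N`. -/
def tensor (B : Bimod k A M) (C : Bimod k A N) : Bimod k A (B.Tensor C) where
  l := AlgHom.ofLinearMap
    { toFun := fun a => BalTensor.map id (B.l a) LinearMap.id (fun _ _ => B.comm _ _ _)
        (fun _ _ => rfl)
      map_add' := fun a b => BalTensor.hom_ext fun m n => by simp [BalTensor.add_tmul]
      map_smul' := fun a b => BalTensor.hom_ext fun m n => by simp [BalTensor.smul_tmul] }
    (BalTensor.hom_ext fun m n => by simp)
    (fun a b => BalTensor.hom_ext fun m n => by simp)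
  r := AlgHom.ofLinearMap
    { toFun := fun b => BalTensor.map id LinearMap.id (C.r b) (fun _ _ => rfl)
        (fun _ _ => (C.comm _ _ _).symm)
      map_add' := fun a b => BalTensor.hom_ext fun m n => by simp [BalTensor.tmul_add]
      map_smul' := fun a b => BalTensor.hom_ext fun m n => by simp [BalTensor.tmul_smul] }
    (BalTensor.hom_ext fun m n => by simp)
    (fun a b => BalTensor.hom_ext fun m n => by simp)
  comm := fun a b x => by
    induction x using BalTensor.induction with
    | h0 => simp
    | ht m n => simp
    | ha x y h1 h2 => simp only [map_add, h1, h2]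

@[simp]
theorem tensor_l_tmul (B : Bimod k A M) (C : Bimod k A N) (a : A) (m : M) (n : N) :
    (B.tensor C).l a (B.tmul C m n) = B.tmul C (B.l a m) n := rfl

@[simp]
theorem tensor_r_tmul (B : Bimod k A M) (C : Bimod k A N) (b : Aᵐᵒᵖ) (m : M) (n : N) :
    (B.tensor C).r b (B.tmul C m n) = B.tmul C m (C.r b n) := rfl

/-- For fixed `p`, the map `m ⊗ n ↦ m ⊗ (n ⊗ p)`. -/
def assocAux (B : Bimod k A M) (C : Bimod k A N) (D : Bimod k A P) (p : P) :
    B.Tensor C →ₗ[k] B.Tensor (C.tensor D) :=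
  BalTensor.map id LinearMap.id ((BalTensor.mk _ _).flip p) (fun _ _ => rfl) (fun _ _ => rfl)

@[simp]
theorem assocAux_tmul (B : Bimod k A M) (C : Bimod k A N) (D : Bimod k A P) (m : M) (n : N)
    (p : P) : assocAux B C D p (B.tmul C m n) = B.tmul (C.tensor D) m (C.tmul D n p) := rfl

/-- The associativity constraint `(m ⊗ n) ⊗ p ↦ m ⊗ (n ⊗ p)`. -/
def assoc (B : Bimod k A M) (C : Bimod k A N) (D : Bimod k A P) :
    (B.tensor C).Tensor D →ₗ[k] B.Tensor (C.tensor D) :=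
  BalTensor.lift
    (LinearMap.flip
      { toFun := assocAux B C D
        map_add' := fun p q => BalTensor.hom_ext fun m n => by
          simp [BalTensor.tmul_add]
        map_smul' := fun c p => BalTensor.hom_ext fun m n => by
          simp [BalTensor.tmul_smul] })
    (fun a x p => by
      induction x using BalTensor.induction with
      | h0 => simp
      | ht m n =>
        change B.tmul _ m (C.tmul D (C.r (op a) n) p) = B.tmul _ m (C.tmul D n (D.l a p))
        rw [tmul, tmul, tmul, BalTensor.tmul_balanced (ρ := fun a : A => C.r (op a))]
      | ha x y h1 h2 => simp only [map_add, h1, h2, LinearMap.add_apply])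

@[simp]
theorem assoc_tmul (B : Bimod k A M) (C : Bimod k A N) (D : Bimod k A P) (m : M) (n : N) (p : P) :
    assoc B C D ((B.tensor C).tmul D (B.tmul C m n) p) = B.tmul (C.tensor D) m (C.tmul D n p) :=
  rfl

end Bimod

/-- An `A`-coring structure on the bimodule `B`: a coassociative counital comonoid in the monoidal
category of `(A, A)`-bimodules. -/
structure Coring {k A C : Type*} [CommRing k] [Ring A] [Algebra k A] [AddCommGroup C]
    [Module k C] (B : Bimod k A C) where
  comul : C →ₗ[k] B.Tensor B
  counit : C →ₗ[k] A
  comul_l : ∀ a c, comul (B.l a c) = (B.tensor B).l a (comul c)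
  comul_r : ∀ a c, comul (B.r a c) = (B.tensor B).r a (comul c)
  counit_l : ∀ a c, counit (B.l a c) = a * counit c
  counit_r : ∀ a c, counit (B.r (op a) c) = counit c * a
  coassoc : ∀ c,
    Bimod.assoc B B B
        (BalTensor.map (ρ' := fun a => (B.tensor B).r (op a)) (l' := fun a => B.l a) id comul
          LinearMap.id (fun a c => comul_r (op a) c) (fun _ _ => rfl) (comul c)) =
      BalTensor.map (ρ' := fun a => B.r (op a)) (l' := fun a => (B.tensor B).l a) id LinearMap.id
          comul (fun _ _ => rfl) (fun a c => comul_l a c) (comul c)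
  /-- `ε(c₁) c₂ = c` -/
  counit_comul : ∀ c, BalTensor.lift (B.l.toLinearMap ∘ₗ counit)
    (fun a m n => by simp [counit_r]) (comul c) = c
  /-- `c₁ ε(c₂) = c` -/
  comul_counit : ∀ c, BalTensor.lift
    ((B.r.toLinearMap ∘ₗ (opLinearEquiv k).toLinearMap ∘ₗ counit).flip)
    (fun a m n => by simp [counit_l]) (comul c) = c

end Bimodules

/-! `Aᵉ`-rings and left and right bialgebroids. -/

section Bialgebroids

variable {k A U : Type*} [CommRing k] [Ring A] [Algebra k A] [Ring U] [Algebra k U]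

/-- An `Aᵉ`-ring structure on the `k`-algebra `U`, where `Aᵉ = A ⊗ Aᵒᵖ`, given by its source and
target maps, which are `k`-algebra maps on `A` and `Aᵒᵖ` with commuting images. -/
structure AeRing (k A U : Type*) [CommRing k] [Ring A] [Algebra k A] [Ring U] [Algebra k U] where
  s : A →ₐ[k] U
  t : Aᵐᵒᵖ →ₐ[k] U
  comm : ∀ a b, s a * t b = t b * s a

namespace AeRing

/-- The bimodule structure `a ▷ u ◁ b = s(a) t(b) u`. -/
def outer (R : AeRing k A U) : Bimod k A U where
  l := (Algebra.lmul k U).comp R.s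
  r := (Algebra.lmul k U).comp R.t
  comm := fun a b m => by simp [← mul_assoc, R.comm]

/-- The bimodule structure `a ▶ u ◀ b = u t(a) s(b)`. -/
def inner (R : AeRing k A U) : Bimod k A U where
  l := AlgHom.ofLinearMap
    ((LinearMap.mul k U).flip ∘ₗ R.t.toLinearMap ∘ₗ (opLinearEquiv k).toLinearMap)
    (by ext; simp) (fun a b => by ext; simp [mul_assoc])
  r := AlgHom.ofLinearMap
    ((LinearMap.mul k U).flip ∘ₗ R.s.toLinearMap ∘ₗ (opLinearEquiv k).symm.toLinearMap)
    (by ext; simp) (fun a b => by ext; simp [mul_assoc])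
  comm := fun a b m => by simp [mul_assoc, R.comm]

@[simp]
theorem outer_l (R : AeRing k A U) (a : A) (u : U) : R.outer.l a u = R.s a * u := rfl

@[simp]
theorem outer_r (R : AeRing k A U) (b : Aᵐᵒᵖ) (u : U) : R.outer.r b u = R.t b * u := rfl

@[simp]
theorem inner_l (R : AeRing k A U) (a : A) (u : U) : R.inner.l a u = u * R.t (op a) := rfl

@[simp]
theorem inner_r (R : AeRing k A U) (b : Aᵐᵒᵖ) (u : U) : R.inner.r b u = u * R.s (unop b) := rfl

/-- The map `u ⊗ v ↦ u x ⊗ v y` on `U_◁ ⊗_A ▷U`. -/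
def outerMulRightAux (R : AeRing k A U) (x y : U) : Module.End k (R.outer.Tensor R.outer) :=
  BalTensor.map id (LinearMap.mulRight k x) (LinearMap.mulRight k y)
    (fun _ _ => by simp [mul_assoc]) (fun _ _ => by simp [mul_assoc])

@[simp]
theorem outerMulRightAux_tmul (R : AeRing k A U) (x y u v : U) :
    R.outerMulRightAux x y (R.outer.tmul R.outer u v) = R.outer.tmul R.outer (u * x) (v * y) := rfl

/-- The map `u ⊗ v ↦ u x ⊗ v y` on `U_◁ ⊗_A ▷U`, bilinear in `x` and `y`. -/
def outerMulRight (R : AeRing k A U) :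
    U →ₗ[k] U →ₗ[k] Module.End k (R.outer.Tensor R.outer) :=
  LinearMap.mk₂ k R.outerMulRightAux
    (fun x x' y => BalTensor.hom_ext fun u v => by simp [mul_add, BalTensor.add_tmul])
    (fun c x y => BalTensor.hom_ext fun u v => by simp [BalTensor.smul_tmul])
    (fun x y y' => BalTensor.hom_ext fun u v => by simp [mul_add, BalTensor.tmul_add])
    (fun c x y => BalTensor.hom_ext fun u v => by simp [BalTensor.tmul_smul])

@[simp]
theorem outerMulRight_tmul (R : AeRing k A U) (x y u v : U) :
    R.outerMulRight x y (R.outer.tmul R.outer u v) = R.outer.tmul R.outer (u * x) (v * y) := rfl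

theorem outerMulRight_comp (R : AeRing k A U) (x y x' y' : U) (X : R.outer.Tensor R.outer) :
    R.outerMulRight x' y' (R.outerMulRight x y X) = R.outerMulRight (x * x') (y * y') X := by
  induction X using BalTensor.induction with
  | h0 => simp
  | ht m n => simp [mul_assoc]
  | ha X Y h1 h2 => simp only [map_add, h1, h2]

/-- The left Takeuchi product `U_◁ ×_A ▷U`: the elements `∑ u ⊗ v` of `U_◁ ⊗_A ▷U` with
`∑ u t(a) ⊗ v = ∑ u ⊗ v s(a)` for all `a`. -/
def leftTakeuchi (R : AeRing k A U) : Set (R.outer.Tensor R.outer) :=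
  {X | ∀ a, R.outerMulRight (R.t (op a)) 1 X = R.outerMulRight 1 (R.s a) X}

/-- The factorwise product `X Y` of `X` in the left Takeuchi product and `Y` in `U_◁ ⊗_A ▷U`, as
a linear map in `Y`. -/
def leftTakeuchiMul (R : AeRing k A U) (X : R.outer.Tensor R.outer) (hX : X ∈ R.leftTakeuchi) :
    R.outer.Tensor R.outer →ₗ[k] R.outer.Tensor R.outer :=
  BalTensor.lift (R.outerMulRight.compr₂ (LinearMap.applyₗ X)) (fun a y z => by
    have h := congrArg (R.outerMulRight y z) (hX a)
    simpa [outerMulRight_comp] using h)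

/-- The map `u ⊗ v ↦ x u ⊗ y v` on `U_◀ ⊗_A ▶U`. -/
def innerMulLeftAux (R : AeRing k A U) (x y : U) : Module.End k (R.inner.Tensor R.inner) :=
  BalTensor.map id (LinearMap.mulLeft k x) (LinearMap.mulLeft k y)
    (fun _ _ => by simp [mul_assoc]) (fun _ _ => by simp [mul_assoc])

@[simp]
theorem innerMulLeftAux_tmul (R : AeRing k A U) (x y u v : U) :
    R.innerMulLeftAux x y (R.inner.tmul R.inner u v) = R.inner.tmul R.inner (x * u) (y * v) := rfl

/-- The map `u ⊗ v ↦ x u ⊗ y v` on `U_◀ ⊗_A ▶U`, bilinear in `x` and `y`. -/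
def innerMulLeft (R : AeRing k A U) :
    U →ₗ[k] U →ₗ[k] Module.End k (R.inner.Tensor R.inner) :=
  LinearMap.mk₂ k R.innerMulLeftAux
    (fun x x' y => BalTensor.hom_ext fun u v => by simp [add_mul, BalTensor.add_tmul])
    (fun c x y => BalTensor.hom_ext fun u v => by simp [BalTensor.smul_tmul])
    (fun x y y' => BalTensor.hom_ext fun u v => by simp [add_mul, BalTensor.tmul_add])
    (fun c x y => BalTensor.hom_ext fun u v => by simp [BalTensor.tmul_smul])

@[simp]
theorem innerMulLeft_tmul (R : AeRing k A U) (x y u v : U) :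
    R.innerMulLeft x y (R.inner.tmul R.inner u v) = R.inner.tmul R.inner (x * u) (y * v) := rfl

theorem innerMulLeft_comp (R : AeRing k A U) (x y x' y' : U) (X : R.inner.Tensor R.inner) :
    R.innerMulLeft x y (R.innerMulLeft x' y' X) = R.innerMulLeft (x * x') (y * y') X := by
  induction X using BalTensor.induction with
  | h0 => simp
  | ht m n => simp [mul_assoc]
  | ha X Y h1 h2 => simp only [map_add, h1, h2]

/-- The right Takeuchi product `U_◀ ×_A ▶U`: the elements `∑ u ⊗ v` of `U_◀ ⊗_A ▶U` with
`∑ s(a) u ⊗ v = ∑ u ⊗ t(a) v` for all `a`. -/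
def rightTakeuchi (R : AeRing k A U) : Set (R.inner.Tensor R.inner) :=
  {X | ∀ a, R.innerMulLeft (R.s a) 1 X = R.innerMulLeft 1 (R.t (op a)) X}

/-- The factorwise product `X Y` of `X` in `U_◀ ⊗_A ▶U` and `Y` in the right Takeuchi product, as
a linear map in `X`. -/
def rightTakeuchiMul (R : AeRing k A U) (Y : R.inner.Tensor R.inner) (hY : Y ∈ R.rightTakeuchi) :
    R.inner.Tensor R.inner →ₗ[k] R.inner.Tensor R.inner :=
  BalTensor.lift (R.innerMulLeft.compr₂ (LinearMap.applyₗ Y)) (fun a y z => by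
    have h := congrArg (R.innerMulLeft y z) (hY a)
    simpa [innerMulLeft_comp] using h)

end AeRing

/-- A left bialgebroid structure on `U` over `A`. -/
structure LeftBialgebroid (k A U : Type*) [CommRing k] [Ring A] [Algebra k A] [Ring U]
    [Algebra k U] extends AeRing k A U where
  coring : Coring toAeRing.outer
  comul_takeuchi : ∀ u, coring.comul u ∈ toAeRing.leftTakeuchi
  comul_one : coring.comul 1 = toAeRing.outer.tmul toAeRing.outer 1 1
  comul_mul : ∀ u v, coring.comul (u * v) =
    toAeRing.leftTakeuchiMul (coring.comul u) (comul_takeuchi u) (coring.comul v)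
  counit_one : coring.counit 1 = 1
  counit_mul_s : ∀ u v, coring.counit (u * v) = coring.counit (u * s (coring.counit v))
  counit_mul_t : ∀ u v, coring.counit (u * v) = coring.counit (u * t (op (coring.counit v)))

/-- An `Aᵉ`-ring with a right augmentation: a counit `∂ : U → A` with `∂(a ▶ u ◀ b) = a ∂(u) b`,
`∂(1) = 1` and `∂(u v) = ∂(s(∂ u) v) = ∂(t(∂ u) v)`. -/
structure AugAeRing (k A U : Type*) [CommRing k] [Ring A] [Algebra k A] [Ring U]
    [Algebra k U] extends AeRing k A U where
  counit : U →ₗ[k] A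
  counit_l : ∀ a u, counit (toAeRing.inner.l a u) = a * counit u
  counit_r : ∀ b u, counit (toAeRing.inner.r (op b) u) = counit u * b
  counit_one : counit 1 = 1
  counit_s_mul : ∀ u v, counit (u * v) = counit (s (counit u) * v)
  counit_t_mul : ∀ u v, counit (u * v) = counit (t (op (counit u)) * v)

/-- A right bialgebroid structure on `U` over `A`. -/
structure RightBialgebroid (k A U : Type*) [CommRing k] [Ring A] [Algebra k A] [Ring U]
    [Algebra k U] extends AugAeRing k A U where
  coring : Coring toAeRing.inner
  coring_counit : coring.counit = counit
  comul_takeuchi : ∀ u, coring.comul u ∈ toAeRing.rightTakeuchi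
  comul_one : coring.comul 1 = toAeRing.inner.tmul toAeRing.inner 1 1
  comul_mul : ∀ u v, coring.comul (u * v) =
    toAeRing.rightTakeuchiMul (coring.comul v) (comul_takeuchi v) (coring.comul u)

variable {A' W W' : Type*} [Ring A'] [Algebra k A'] [Ring W] [Algebra k W] [Ring W'] [Algebra k W']

/-- Morphisms `(F, f)` of rings over enveloping algebras with augmentation: `F` and `f` are algebra
maps that commute with source, target and counit. For `f = id` these are the morphisms of
`Aᵉ`-rings with augmentation. -/
structure IsAugAeRingHom (R : AugAeRing k A W) (R' : AugAeRing k A' W') (F : W →ₐ[k] W')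
    (f : A →ₐ[k] A') : Prop where
  map_s : ∀ a, F (R.s a) = R'.s (f a)
  map_t : ∀ a, F (R.t (op a)) = R'.t (op (f a))
  map_counit : ∀ w, R'.counit (F w) = f (R.counit w)

/-- The map `F ⊗ F` induced by a morphism `(F, f)`. -/
def IsAugAeRingHom.tensorMap {R : AugAeRing k A W} {R' : AugAeRing k A' W'} {F : W →ₐ[k] W'}
    {f : A →ₐ[k] A'} (h : IsAugAeRingHom R R' F f) :
    R.inner.Tensor R.inner →ₗ[k] R'.inner.Tensor R'.inner :=
  BalTensor.map f F.toLinearMap F.toLinearMap (fun a w => by simp [h.map_s])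
    (fun a w => by simp [h.map_t])

/-- Morphisms `(F, f)` of right bialgebroids: they commute with all structure maps. -/
structure IsRightBialgebroidHom (R : RightBialgebroid k A W) (R' : RightBialgebroid k A' W')
    (F : W →ₐ[k] W') (f : A →ₐ[k] A') : Prop extends
    IsAugAeRingHom R.toAugAeRing R'.toAugAeRing F f where
  map_comul : ∀ w, R'.coring.comul (F w) = toIsAugAeRingHom.tensorMap (R.coring.comul w)

end Bialgebroids

/-! The left and the right dual of a left bialgebroid. -/

section Duals

namespace LeftBialgebroid

variable {k A U : Type*} [CommRing k] [Ring A] [Algebra k A] [Ring U] [Algebra k U]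
  (H : LeftBialgebroid k A U)

/-- The counit `ε : U → A`. -/
abbrev eps : U →ₗ[k] A := H.coring.counit

/-- The coproduct `Δ : U → U_◁ ⊗_A ▷U`. -/
abbrev comul : U →ₗ[k] H.outer.Tensor H.outer := H.coring.comul

/-- The left dual `U_* = Hom_A(▷U, A)`: the maps `ψ` with `ψ(s(a) u) = a ψ(u)`. -/
def leftDualSubmodule : Submodule k (U →ₗ[k] A) where
  carrier := {ψ | ∀ a u, ψ (H.s a * u) = a * ψ u}
  add_mem' := fun h h' a u => by simp [h a u, h' a u, mul_add]
  zero_mem' := fun a u => by simp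
  smul_mem' := fun c ψ h a u => by simp [h a u]

/-- The right dual `U^* = Hom_{Aᵒᵖ}(U_◁, A)`: the maps `φ` with `φ(t(a) u) = φ(u) a`. -/
def rightDualSubmodule : Submodule k (U →ₗ[k] A) where
  carrier := {φ | ∀ a u, φ (H.t (op a) * u) = φ u * a}
  add_mem' := fun h h' a u => by simp [h a u, h' a u, add_mul]
  zero_mem' := fun a u => by simp
  smul_mem' := fun c ψ h a u => by simp [h a u]

/-- The left dual `U_*` as a type. -/
def LeftDual : Type _ := H.leftDualSubmodule

/-- The right dual `U^*` as a type. -/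
def RightDual : Type _ := H.rightDualSubmodule

instance : AddCommGroup H.LeftDual := inferInstanceAs (AddCommGroup H.leftDualSubmodule)
instance : Module k H.LeftDual := inferInstanceAs (Module k H.leftDualSubmodule)
instance : AddCommGroup H.RightDual := inferInstanceAs (AddCommGroup H.rightDualSubmodule)
instance : Module k H.RightDual := inferInstanceAs (Module k H.rightDualSubmodule)

variable {H}

/-- The linear map underlying an element of the left dual. -/
def LeftDual.lin : H.LeftDual →ₗ[k] U →ₗ[k] A := H.leftDualSubmodule.subtype

/-- The linear map underlying an element of the right dual. -/
def RightDual.lin : H.RightDual →ₗ[k] U →ₗ[k] A := H.rightDualSubmodule.subtype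

instance : CoeFun H.LeftDual (fun _ => U → A) := ⟨fun ψ => LeftDual.lin ψ⟩
instance : CoeFun H.RightDual (fun _ => U → A) := ⟨fun φ => RightDual.lin φ⟩

/-- An element of the left dual from a linear map. -/
def LeftDual.mk (ψ : U →ₗ[k] A) (h : ∀ a u, ψ (H.s a * u) = a * ψ u) : H.LeftDual := ⟨ψ, h⟩

/-- An element of the right dual from a linear map. -/
def RightDual.mk (φ : U →ₗ[k] A) (h : ∀ a u, φ (H.t (op a) * u) = φ u * a) : H.RightDual := ⟨φ, h⟩

@[simp]
theorem LeftDual.lin_mk (ψ : U →ₗ[k] A) (h : ∀ a u, ψ (H.s a * u) = a * ψ u) :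
    LeftDual.lin (LeftDual.mk ψ h) = ψ := rfl

@[simp]
theorem RightDual.lin_mk (φ : U →ₗ[k] A) (h : ∀ a u, φ (H.t (op a) * u) = φ u * a) :
    RightDual.lin (RightDual.mk φ h) = φ := rfl

theorem LeftDual.ext {ψ ψ' : H.LeftDual} (h : ∀ u, ψ u = ψ' u) : ψ = ψ' :=
  Subtype.ext (LinearMap.ext h)

theorem RightDual.ext {φ φ' : H.RightDual} (h : ∀ u, φ u = φ' u) : φ = φ' :=
  Subtype.ext (LinearMap.ext h)

@[simp]
theorem LeftDual.map_s (ψ : H.LeftDual) (a : A) (u : U) : ψ (H.s a * u) = a * ψ u := ψ.2 a u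

@[simp]
theorem RightDual.map_t (φ : H.RightDual) (a : A) (u : U) : φ (H.t (op a) * u) = φ u * a :=
  φ.2 a u

variable (H)

theorem comul_s_mul (a : A) (u : U) :
    H.comul (H.s a * u) = (H.outer.tensor H.outer).l a (H.comul u) := H.coring.comul_l a u

theorem comul_t_mul (a : A) (u : U) :
    H.comul (H.t (op a) * u) = (H.outer.tensor H.outer).r (op a) (H.comul u) :=
  H.coring.comul_r (op a) u

theorem eps_s_mul (a : A) (u : U) : H.eps (H.s a * u) = a * H.eps u := H.coring.counit_l a u

theorem eps_t_mul (a : A) (u : U) : H.eps (H.t (op a) * u) = H.eps u * a := H.coring.counit_r a u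

theorem eps_mul_s (a : A) (u : U) : H.eps (u * H.s a) = H.eps (u * H.t (op a)) := by
  rw [H.counit_mul_t u (H.s a), ← mul_one (H.s a), eps_s_mul, H.counit_one, mul_one]

theorem comul_mul_s (a : A) (u : U) : H.comul (u * H.s a) = H.outerMulRight (H.s a) 1 (H.comul u) := by
  rw [H.comul_mul, ← mul_one (H.s a), comul_s_mul, H.comul_one]
  simp [AeRing.leftTakeuchiMul]

theorem comul_mul_t (a : A) (u : U) :
    H.comul (u * H.t (op a)) = H.outerMulRight 1 (H.t (op a)) (H.comul u) := by
  rw [H.comul_mul, ← mul_one (H.t (op a)), comul_t_mul, H.comul_one]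
  simp [AeRing.leftTakeuchiMul]

/-! The ring structure of the left dual: `(ψ ψ')(u) = ψ'(t(ψ(u₂)) u₁)`. -/

section LeftMul

variable {P : Type*} [AddCommGroup P] [Module k P]

/-- The map `u ⊗ p ↦ t(g(p)) u` given by a left `A`-linear map `g`. -/
def leftEv (C : Bimod k A P) (g : P →ₗ[k] A) (hg : ∀ a p, g (C.l a p) = a * g p) :
    H.outer.Tensor C →ₗ[k] U :=
  BalTensor.lift
    ((LinearMap.mul k U).flip.compl₂ (H.t.toLinearMap ∘ₗ (opLinearEquiv k).toLinearMap ∘ₗ g))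
    (fun a u v => by simp [hg, mul_assoc])

@[simp]
theorem leftEv_tmul (C : Bimod k A P) (g : P →ₗ[k] A) (hg : ∀ a p, g (C.l a p) = a * g p)
    (u : U) (p : P) : H.leftEv C g hg (H.outer.tmul C u p) = H.t (op (g p)) * u := rfl

theorem leftEv_l (C : Bimod k A P) (g : P →ₗ[k] A) (hg : ∀ a p, g (C.l a p) = a * g p)
    (a : A) (X : H.outer.Tensor C) :
    H.leftEv C g hg ((H.outer.tensor C).l a X) = H.s a * H.leftEv C g hg X := by
  induction X using BalTensor.induction with
  | h0 => simp
  | ht u p => simp [← mul_assoc, H.comm]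
  | ha X Y h1 h2 => simp only [map_add, h1, h2, mul_add]

theorem LeftDual.map_l {H : LeftBialgebroid k A U} (ψ : H.LeftDual) (a : A) (u : U) :
    LeftDual.lin ψ (H.outer.l a u) = a * LeftDual.lin ψ u := ψ.2 a u

/-- The map `u ⊗ v ↦ t(ψ(v)) u`. -/
abbrev leftEvD (ψ : H.LeftDual) : H.outer.Tensor H.outer →ₗ[k] U :=
  H.leftEv H.outer (LeftDual.lin ψ) ψ.map_l

/-- The map `u ↦ t(ψ(u₂)) u₁`. -/
def leftOp (ψ : H.LeftDual) : U →ₗ[k] U :=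
  H.leftEvD ψ ∘ₗ H.comul

theorem leftOp_apply (ψ : H.LeftDual) (u : U) :
    H.leftOp ψ u = H.leftEvD ψ (H.comul u) := rfl

theorem leftOp_s_mul (ψ : H.LeftDual) (a : A) (u : U) :
    H.leftOp ψ (H.s a * u) = H.s a * H.leftOp ψ u := by
  rw [leftOp_apply, comul_s_mul, leftEv_l]; rfl

instance : Mul H.LeftDual where
  mul ψ ψ' := LeftDual.mk (LeftDual.lin ψ' ∘ₗ H.leftOp ψ) (fun a u => by simp [leftOp_s_mul])

instance : One H.LeftDual where
  one := LeftDual.mk H.eps H.eps_s_mul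

variable {H}

theorem LeftDual.mul_apply (ψ ψ' : H.LeftDual) (u : U) : (ψ * ψ') u = ψ' (H.leftOp ψ u) := rfl

theorem LeftDual.one_apply (u : U) : (1 : H.LeftDual) u = H.eps u := rfl

theorem leftOp_one (u : U) : H.leftOp 1 u = u := by
  conv_rhs => rw [← H.coring.comul_counit u]
  rw [leftOp_apply]
  exact LinearMap.congr_fun (BalTensor.hom_ext fun m n => rfl) _

theorem leftOp_mul (ψ ψ' : H.LeftDual) (u : U) :
    H.leftOp (ψ * ψ') u = H.leftOp ψ' (H.leftOp ψ u) := by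
  have hg : ∀ (a : A) (X : H.outer.Tensor H.outer),
      (LeftDual.lin ψ' ∘ₗ H.leftEvD ψ)
        ((H.outer.tensor H.outer).l a X) =
      a * (LeftDual.lin ψ' ∘ₗ H.leftEvD ψ) X := by
    intro a X
    rw [LinearMap.comp_apply, leftEv_l, LeftDual.map_s]; rfl
  have key := congrArg (H.leftEv (H.outer.tensor H.outer) _ hg) (H.coring.coassoc u)
  have hR : ∀ X : H.outer.Tensor H.outer, H.leftEv (H.outer.tensor H.outer) _ hg
      (BalTensor.map (ρ' := fun a => H.outer.r (op a))
        (l' := fun a => (H.outer.tensor H.outer).l a) id LinearMap.id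
          H.coring.comul (fun _ _ => rfl) (fun a c => H.coring.comul_l a c) X) =
      H.leftEvD (ψ * ψ') X :=
    fun X => by
      induction X using BalTensor.induction with
      | h0 => simp
      | ht u v => rfl
      | ha X Y h1 h2 => simp only [map_add, h1, h2]
  have hL : ∀ X : H.outer.Tensor H.outer, H.leftEv (H.outer.tensor H.outer) _ hg
      (Bimod.assoc H.outer H.outer H.outer
        (BalTensor.map (ρ' := fun a => (H.outer.tensor H.outer).r (op a))
          (l' := fun a => H.outer.l a) id H.coring.comul
          LinearMap.id (fun a c => H.coring.comul_r (op a) c) (fun _ _ => rfl) X)) =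
      H.leftOp ψ' (H.leftEvD ψ X) := by
    intro X
    induction X using BalTensor.induction with
    | h0 => simp
    | ht u v =>
      rw [BalTensor.map_tmul]
      have h1 := H.leftEv_tmul H.outer (LeftDual.lin ψ) ψ.map_l u v
      rw [h1, leftOp_apply, comul_t_mul]
      change H.leftEv (H.outer.tensor H.outer) _ hg (Bimod.assoc H.outer H.outer H.outer
        ((H.outer.tensor H.outer).tmul H.outer (H.comul u) v)) = _
      generalize H.comul u = Y
      induction Y using BalTensor.induction with
      | h0 => simp
      | ht x y =>
        rw [Bimod.assoc_tmul]
        simp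
      | ha Y Z h1 h2 => 
        simp only [Bimod.tmul, BalTensor.add_tmul, map_add] at h1 h2 ⊢
        rw [h1, h2]
    | ha X Y h1 h2 => simp only [map_add, h1, h2]
  rw [hL, hR] at key
  exact key.symm

theorem leftOp_add (ψ ψ' : H.LeftDual) (u : U) :
    H.leftOp (ψ + ψ') u = H.leftOp ψ u + H.leftOp ψ' u := by
  have h : H.leftEvD (ψ + ψ') = H.leftEvD ψ + H.leftEvD ψ' := BalTensor.hom_ext fun m n => by
    rw [LinearMap.add_apply, leftEv_tmul, leftEv_tmul, leftEv_tmul]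
    simp [add_mul]
  simp only [leftOp_apply, h, LinearMap.add_apply]

theorem leftOp_smul (c : k) (ψ : H.LeftDual) (u : U) :
    H.leftOp (c • ψ) u = c • H.leftOp ψ u := by
  have h : H.leftEvD (c • ψ) = c • H.leftEvD ψ := BalTensor.hom_ext fun m n => by
    rw [LinearMap.smul_apply, leftEv_tmul, leftEv_tmul]
    simp
  simp only [leftOp_apply, h, LinearMap.smul_apply]

/-- `ε(t(ψ(u₂)) u₁) = ψ(u)`. -/
theorem eps_leftOp (ψ : H.LeftDual) (u : U) : H.eps (H.leftOp ψ u) = ψ u := by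
  have h : H.eps ∘ₗ H.leftEvD ψ =
      LeftDual.lin ψ ∘ₗ BalTensor.lift (H.outer.l.toLinearMap ∘ₗ H.eps)
        (fun a m n => by simp [eps_t_mul]) :=
    BalTensor.hom_ext fun m n => by
      rw [LinearMap.comp_apply, leftEv_tmul, eps_t_mul]
      exact (ψ.map_s _ _).symm
  conv_rhs => rw [← H.coring.counit_comul u]
  exact LinearMap.congr_fun h (H.comul u)

instance : Ring H.LeftDual :=
  { (inferInstance : AddCommGroup H.LeftDual) with
    mul := (· * ·)
    one := 1
    mul_assoc := fun a b c => LeftDual.ext fun u => by simp [LeftDual.mul_apply, leftOp_mul]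
    one_mul := fun a => LeftDual.ext fun u => by simp [LeftDual.mul_apply, leftOp_one]
    mul_one := fun a => LeftDual.ext fun u => by
      rw [LeftDual.mul_apply, LeftDual.one_apply, eps_leftOp]
    left_distrib := fun a b c => LeftDual.ext fun u => by simp [LeftDual.mul_apply]
    right_distrib := fun a b c => LeftDual.ext fun u => by simp [LeftDual.mul_apply, leftOp_add]
    zero_mul := fun a => LeftDual.ext fun u => by
      have h := H.leftOp_smul (0 : k) (0 : H.LeftDual) u
      simp only [zero_smul] at h
      simp [LeftDual.mul_apply, h]
    mul_zero := fun a => LeftDual.ext fun u => by simp [LeftDual.mul_apply] }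

instance : Algebra k H.LeftDual :=
  Algebra.ofModule
    (fun c a b => LeftDual.ext fun u => by simp [LeftDual.mul_apply, leftOp_smul])
    (fun c a b => LeftDual.ext fun u => by simp [LeftDual.mul_apply])

end LeftMul

/-! The ring structure of the right dual: `(φ φ')(u) = φ'(s(φ(u₁)) u₂)`. -/

section RightMul

variable {P : Type*} [AddCommGroup P] [Module k P]

/-- The map `p ⊗ u ↦ s(g(p)) u` given by a right `A`-linear map `g`. -/
def rightEv (C : Bimod k A P) (g : P →ₗ[k] A) (hg : ∀ a p, g (C.r (op a) p) = g p * a) :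
    C.Tensor H.outer →ₗ[k] U :=
  BalTensor.lift (LinearMap.mul k U ∘ₗ H.s.toLinearMap ∘ₗ g)
    (fun a u v => by simp [hg, mul_assoc])

@[simp]
theorem rightEv_tmul (C : Bimod k A P) (g : P →ₗ[k] A) (hg : ∀ a p, g (C.r (op a) p) = g p * a)
    (u : U) (p : P) : H.rightEv C g hg (C.tmul H.outer p u) = H.s (g p) * u := rfl

theorem rightEv_r (C : Bimod k A P) (g : P →ₗ[k] A) (hg : ∀ a p, g (C.r (op a) p) = g p * a)
    (b : Aᵐᵒᵖ) (X : C.Tensor H.outer) :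
    H.rightEv C g hg ((C.tensor H.outer).r b X) = H.t b * H.rightEv C g hg X := by
  induction X using BalTensor.induction with
  | h0 => simp
  | ht u p => simp [← mul_assoc, H.comm]
  | ha X Y h1 h2 => simp only [map_add, h1, h2, mul_add]

theorem RightDual.map_r {H : LeftBialgebroid k A U} (φ : H.RightDual) (a : A) (u : U) :
    RightDual.lin φ (H.outer.r (op a) u) = RightDual.lin φ u * a := φ.2 a u

/-- The map `u ⊗ v ↦ s(φ(u)) v`. -/
abbrev rightEvD (φ : H.RightDual) : H.outer.Tensor H.outer →ₗ[k] U :=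
  H.rightEv H.outer (RightDual.lin φ) φ.map_r

/-- The map `u ↦ s(φ(u₁)) u₂`. -/
def rightOp (φ : H.RightDual) : U →ₗ[k] U := H.rightEvD φ ∘ₗ H.comul

theorem rightOp_apply (φ : H.RightDual) (u : U) :
    H.rightOp φ u = H.rightEvD φ (H.comul u) := rfl

theorem rightOp_t_mul (φ : H.RightDual) (a : A) (u : U) :
    H.rightOp φ (H.t (op a) * u) = H.t (op a) * H.rightOp φ u := by
  rw [rightOp_apply, comul_t_mul, rightEv_r]; rfl

instance : Mul H.RightDual where
  mul φ φ' := RightDual.mk (RightDual.lin φ' ∘ₗ H.rightOp φ) (fun a u => by simp [rightOp_t_mul])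

instance : One H.RightDual where
  one := RightDual.mk H.eps H.eps_t_mul

variable {H}

theorem RightDual.mul_apply (φ φ' : H.RightDual) (u : U) : (φ * φ') u = φ' (H.rightOp φ u) := rfl

theorem RightDual.one_apply (u : U) : (1 : H.RightDual) u = H.eps u := rfl

theorem rightOp_one (u : U) : H.rightOp 1 u = u := by
  conv_rhs => rw [← H.coring.counit_comul u]
  rw [rightOp_apply]
  exact LinearMap.congr_fun (BalTensor.hom_ext fun m n => rfl) _

theorem rightOp_mul (φ φ' : H.RightDual) (u : U) :
    H.rightOp (φ * φ') u = H.rightOp φ' (H.rightOp φ u) := by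
  let T : H.outer.Tensor (H.outer.tensor H.outer) →ₗ[k] U :=
    BalTensor.lift
      (((H.outer.tensor H.outer).l.toLinearMap ∘ₗ RightDual.lin φ).compr₂ (H.rightEvD φ'))
      (fun a u X => by
        have h := φ.map_r a u
        simp only [LinearMap.compr₂_apply, LinearMap.comp_apply, AlgHom.toLinearMap_apply]
        rw [h, map_mul]
        rfl)
  have hT : ∀ u X, T (H.outer.tmul (H.outer.tensor H.outer) u X) =
      H.rightEvD φ' ((H.outer.tensor H.outer).l (φ u) X) := fun _ _ => rfl
  have key := congrArg T (H.coring.coassoc u)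
  have hR : ∀ X : H.outer.Tensor H.outer, T
      (BalTensor.map (ρ' := fun a => H.outer.r (op a))
        (l' := fun a => (H.outer.tensor H.outer).l a) id LinearMap.id
          H.coring.comul (fun _ _ => rfl) (fun a c => H.coring.comul_l a c) X) =
      H.rightOp φ' (H.rightEvD φ X) :=
    fun X => by
      induction X using BalTensor.induction with
      | h0 => simp
      | ht u v =>
        rw [BalTensor.map_tmul]
        have h1 := H.rightEv_tmul H.outer (RightDual.lin φ) φ.map_r v u
        rw [h1, rightOp_apply, comul_s_mul]
        rfl
      | ha X Y h1 h2 => simp only [map_add, h1, h2]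
  have hL : ∀ X : H.outer.Tensor H.outer, T
      (Bimod.assoc H.outer H.outer H.outer
        (BalTensor.map (ρ' := fun a => (H.outer.tensor H.outer).r (op a))
          (l' := fun a => H.outer.l a) id H.coring.comul
          LinearMap.id (fun a c => H.coring.comul_r (op a) c) (fun _ _ => rfl) X)) =
      H.rightEvD (φ * φ') X := by
    intro X
    induction X using BalTensor.induction with
    | h0 => simp
    | ht u v =>
      rw [BalTensor.map_tmul]
      change T (Bimod.assoc H.outer H.outer H.outer
        ((H.outer.tensor H.outer).tmul H.outer (H.comul u) v)) =
          H.s (φ' (H.rightEvD φ (H.comul u))) * v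
      generalize H.comul u = Y
      induction Y using BalTensor.induction with
      | h0 => simp
      | ht x y =>
        rw [Bimod.assoc_tmul, hT]
        rfl
      | ha Y Z h1 h2 =>
        simp only [Bimod.tmul, BalTensor.add_tmul, map_add, add_mul] at h1 h2 ⊢
        rw [h1, h2]
    | ha X Y h1 h2 => simp only [map_add, h1, h2]
  rw [hL, hR] at key
  exact key

theorem rightOp_add (φ φ' : H.RightDual) (u : U) :
    H.rightOp (φ + φ') u = H.rightOp φ u + H.rightOp φ' u := by
  have h : H.rightEvD (φ + φ') = H.rightEvD φ + H.rightEvD φ' := BalTensor.hom_ext fun m n => by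
    rw [LinearMap.add_apply, rightEv_tmul, rightEv_tmul, rightEv_tmul]
    simp [add_mul]
  simp only [rightOp_apply, h, LinearMap.add_apply]

theorem rightOp_smul (c : k) (φ : H.RightDual) (u : U) :
    H.rightOp (c • φ) u = c • H.rightOp φ u := by
  have h : H.rightEvD (c • φ) = c • H.rightEvD φ := BalTensor.hom_ext fun m n => by
    rw [LinearMap.smul_apply, rightEv_tmul, rightEv_tmul]
    simp
  simp only [rightOp_apply, h, LinearMap.smul_apply]

/-- `ε(s(φ(u₁)) u₂) = φ(u)`. -/
theorem eps_rightOp (φ : H.RightDual) (u : U) : H.eps (H.rightOp φ u) = φ u := by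
  have h : H.eps ∘ₗ H.rightEvD φ =
      RightDual.lin φ ∘ₗ BalTensor.lift
        ((H.outer.r.toLinearMap ∘ₗ (opLinearEquiv k).toLinearMap ∘ₗ H.eps).flip)
        (fun a m n => by simp [eps_s_mul]) :=
    BalTensor.hom_ext fun m n => by
      rw [LinearMap.comp_apply, rightEv_tmul, eps_s_mul]
      exact (φ.map_t _ _).symm
  conv_rhs => rw [← H.coring.comul_counit u]
  exact LinearMap.congr_fun h (H.comul u)

instance : Ring H.RightDual :=
  { (inferInstance : AddCommGroup H.RightDual) with
    mul := (· * ·)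
    one := 1
    mul_assoc := fun a b c => RightDual.ext fun u => by simp [RightDual.mul_apply, rightOp_mul]
    one_mul := fun a => RightDual.ext fun u => by simp [RightDual.mul_apply, rightOp_one]
    mul_one := fun a => RightDual.ext fun u => by
      rw [RightDual.mul_apply, RightDual.one_apply, eps_rightOp]
    left_distrib := fun a b c => RightDual.ext fun u => by simp [RightDual.mul_apply]
    right_distrib := fun a b c => RightDual.ext fun u => by
      simp [RightDual.mul_apply, rightOp_add]
    zero_mul := fun a => RightDual.ext fun u => by
      have h := H.rightOp_smul (0 : k) (0 : H.RightDual) u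
      simp only [zero_smul] at h
      simp [RightDual.mul_apply, h]
    mul_zero := fun a => RightDual.ext fun u => by simp [RightDual.mul_apply] }

instance : Algebra k H.RightDual :=
  Algebra.ofModule
    (fun c a b => RightDual.ext fun u => by simp [RightDual.mul_apply, rightOp_smul])
    (fun c a b => RightDual.ext fun u => by simp [RightDual.mul_apply])

end RightMul

/-! The duals as `Aᵉ`-rings with augmentation. -/

variable {H}

theorem leftOp_mul_s (ψ : H.LeftDual) (a : A) (u : U) :
    H.leftOp ψ (u * H.s a) = H.leftOp ψ u * H.s a := by
  rw [leftOp_apply, comul_mul_s, leftOp_apply]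
  generalize H.comul u = X
  induction X using BalTensor.induction with
  | h0 => simp
  | ht u v =>
    rw [AeRing.outerMulRight_tmul, leftEv_tmul, leftEv_tmul, mul_one, mul_assoc]
  | ha X Y h1 h2 => simp only [map_add, h1, h2, add_mul]

theorem rightOp_mul_t (φ : H.RightDual) (a : A) (u : U) :
    H.rightOp φ (u * H.t (op a)) = H.rightOp φ u * H.t (op a) := by
  rw [rightOp_apply, comul_mul_t, rightOp_apply]
  generalize H.comul u = X
  induction X using BalTensor.induction with
  | h0 => simp
  | ht u v =>
    rw [AeRing.outerMulRight_tmul, rightEv_tmul, rightEv_tmul, mul_one, mul_assoc]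
  | ha X Y h1 h2 => simp only [map_add, h1, h2, add_mul]

theorem leftOp_apply_one (ψ : H.LeftDual) : H.leftOp ψ 1 = H.t (op (ψ 1)) := by
  rw [leftOp_apply, H.comul_one, leftEv_tmul, mul_one]

theorem rightOp_apply_one (φ : H.RightDual) : H.rightOp φ 1 = H.s (φ 1) := by
  rw [rightOp_apply, H.comul_one, rightEv_tmul, mul_one]

variable (H)

/-- The source map of the left dual, `s(a)(u) = ε(u) a`. -/
def leftDualS : A →ₗ[k] H.LeftDual where
  toFun a := LeftDual.mk (LinearMap.mulRight k a ∘ₗ H.eps)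
    (fun b u => by simp [eps_s_mul, mul_assoc])
  map_add' a b := LeftDual.ext fun u => mul_add (H.eps u) a b
  map_smul' c a := LeftDual.ext fun u => mul_smul_comm c (H.eps u) a

/-- The target map of the left dual, `t(a)(u) = ε(u t(a))`. -/
def leftDualT : Aᵐᵒᵖ →ₗ[k] H.LeftDual where
  toFun a := LeftDual.mk (H.eps ∘ₗ LinearMap.mulRight k (H.t a))
    (fun b u => by simp [eps_s_mul, mul_assoc])
  map_add' a b := LeftDual.ext fun u => by
    change H.eps (u * H.t (a + b)) = H.eps (u * H.t a) + H.eps (u * H.t b)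
    rw [map_add, mul_add, map_add]
  map_smul' c a := LeftDual.ext fun u => by
    change H.eps (u * H.t (c • a)) = c • H.eps (u * H.t a)
    rw [map_smul, mul_smul_comm, map_smul]

/-- The source map of the right dual, `s(a)(u) = ε(u s(a))`. -/
def rightDualS : A →ₗ[k] H.RightDual where
  toFun a := RightDual.mk (H.eps ∘ₗ LinearMap.mulRight k (H.s a))
    (fun b u => by simp [eps_t_mul, mul_assoc])
  map_add' a b := RightDual.ext fun u => by
    change H.eps (u * H.s (a + b)) = H.eps (u * H.s a) + H.eps (u * H.s b)
    rw [map_add, mul_add, map_add]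
  map_smul' c a := RightDual.ext fun u => by
    change H.eps (u * H.s (c • a)) = c • H.eps (u * H.s a)
    rw [map_smul, mul_smul_comm, map_smul]

/-- The target map of the right dual, `t(a)(u) = a ε(u)`. -/
def rightDualT : Aᵐᵒᵖ →ₗ[k] H.RightDual where
  toFun a := RightDual.mk (LinearMap.mulLeft k (unop a) ∘ₗ H.eps)
    (fun b u => by simp [eps_t_mul, mul_assoc])
  map_add' a b := RightDual.ext fun u => add_mul (unop a) (unop b) (H.eps u)
  map_smul' c a := RightDual.ext fun u => smul_mul_assoc c (unop a) (H.eps u)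

variable {H}

@[simp]
theorem leftDualS_apply (a : A) (u : U) : H.leftDualS a u = H.eps u * a := rfl

@[simp]
theorem leftDualT_apply (a : Aᵐᵒᵖ) (u : U) : H.leftDualT a u = H.eps (u * H.t a) := rfl

@[simp]
theorem rightDualS_apply (a : A) (u : U) : H.rightDualS a u = H.eps (u * H.s a) := rfl

@[simp]
theorem rightDualT_apply (a : Aᵐᵒᵖ) (u : U) : H.rightDualT a u = unop a * H.eps u := rfl

theorem leftOp_leftDualS (a : A) (u : U) : H.leftOp (H.leftDualS a) u = H.t (op a) * u := by
  conv_rhs => rw [← leftOp_one (H := H) u]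
  rw [leftOp_apply, leftOp_apply]
  generalize H.comul u = X
  induction X using BalTensor.induction with
  | h0 => simp
  | ht u v =>
    rw [leftEv_tmul, leftEv_tmul, ← mul_assoc, ← map_mul, leftDualS_apply, LeftDual.one_apply, op_mul]
  | ha X Y h1 h2 => simp only [map_add, h1, h2, mul_add]

theorem leftOp_leftDualT (a : Aᵐᵒᵖ) (u : U) : H.leftOp (H.leftDualT a) u = u * H.t a := by
  obtain ⟨a, rfl⟩ := op_surjective a
  have h : ∀ X : H.outer.Tensor H.outer, H.leftEvD (H.leftDualT (op a)) X =
      H.leftEvD 1 (H.outerMulRight 1 (H.s a) X) := by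
    intro X
    induction X using BalTensor.induction with
    | h0 => simp
    | ht u v =>
      rw [leftEv_tmul, AeRing.outerMulRight_tmul, leftEv_tmul, leftDualT_apply,
        LeftDual.one_apply, eps_mul_s, mul_one]
    | ha X Y h1 h2 => simp only [map_add, h1, h2]
  conv_rhs => rw [← leftOp_one (H := H) u]
  rw [leftOp_apply, leftOp_apply, h, ← H.comul_takeuchi u a]
  change H.leftEvD 1 (H.outerMulRight _ _ (H.comul u)) = _
  generalize H.comul u = X
  induction X using BalTensor.induction with
  | h0 => simp
  | ht u v =>
    rw [AeRing.outerMulRight_tmul, leftEv_tmul, leftEv_tmul, mul_one, mul_assoc]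
  | ha X Y h1 h2 => simp only [map_add, h1, h2, add_mul]

theorem rightOp_rightDualT (a : Aᵐᵒᵖ) (u : U) :
    H.rightOp (H.rightDualT a) u = H.s (unop a) * u := by
  conv_rhs => rw [← rightOp_one (H := H) u]
  rw [rightOp_apply, rightOp_apply]
  generalize H.comul u = X
  induction X using BalTensor.induction with
  | h0 => simp
  | ht u v =>
    rw [rightEv_tmul, rightEv_tmul, ← mul_assoc, ← map_mul, rightDualT_apply, RightDual.one_apply]
  | ha X Y h1 h2 => simp only [map_add, h1, h2, mul_add]

theorem rightOp_rightDualS (a : A) (u : U) : H.rightOp (H.rightDualS a) u = u * H.s a := by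
  have h : ∀ X : H.outer.Tensor H.outer, H.rightEvD (H.rightDualS a) X =
      H.rightEvD 1 (H.outerMulRight (H.t (op a)) 1 X) := by
    intro X
    induction X using BalTensor.induction with
    | h0 => simp
    | ht u v =>
      rw [rightEv_tmul, AeRing.outerMulRight_tmul, rightEv_tmul, rightDualS_apply,
        RightDual.one_apply, eps_mul_s, mul_one]
    | ha X Y h1 h2 => simp only [map_add, h1, h2]
  conv_rhs => rw [← rightOp_one (H := H) u]
  rw [rightOp_apply, rightOp_apply, h, H.comul_takeuchi u a]
  change H.rightEvD 1 (H.outerMulRight _ _ (H.comul u)) = _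
  generalize H.comul u = X
  induction X using BalTensor.induction with
  | h0 => simp
  | ht u v =>
    rw [AeRing.outerMulRight_tmul, rightEv_tmul, rightEv_tmul, mul_one, mul_assoc]
  | ha X Y h1 h2 => simp only [map_add, h1, h2, add_mul]

theorem mul_leftDualS_apply (ψ : H.LeftDual) (a : A) (u : U) :
    (ψ * H.leftDualS a) u = ψ u * a := by
  rw [LeftDual.mul_apply, leftDualS_apply, eps_leftOp]

theorem mul_leftDualT_apply (ψ : H.LeftDual) (a : A) (u : U) :
    (ψ * H.leftDualT (op a)) u = ψ (u * H.s a) := by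
  rw [LeftDual.mul_apply, leftDualT_apply, ← eps_mul_s, ← leftOp_mul_s, eps_leftOp]

theorem mul_rightDualS_apply (φ : H.RightDual) (a : A) (u : U) :
    (φ * H.rightDualS a) u = φ (u * H.t (op a)) := by
  rw [RightDual.mul_apply, rightDualS_apply, eps_mul_s, ← rightOp_mul_t, eps_rightOp]

theorem mul_rightDualT_apply (φ : H.RightDual) (a : A) (u : U) :
    (φ * H.rightDualT (op a)) u = a * φ u := by
  rw [RightDual.mul_apply, rightDualT_apply, eps_rightOp, unop_op]

variable (H)

/-- The left dual `U_*` as an `Aᵉ`-ring with augmentation, with counit `∂(ψ) = ψ(1)`. -/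
def leftDualAug : AugAeRing k A H.LeftDual where
  s := AlgHom.ofLinearMap H.leftDualS (LeftDual.ext fun u => by simp [LeftDual.one_apply])
    (fun a b => LeftDual.ext fun u => by simp [mul_leftDualS_apply, mul_assoc])
  t := AlgHom.ofLinearMap H.leftDualT (LeftDual.ext fun u => by simp [LeftDual.one_apply])
    (fun a b => LeftDual.ext fun u => by
      simp [LeftDual.mul_apply, leftOp_leftDualT, mul_assoc])
  comm := fun a b => LeftDual.ext fun u => by
    obtain ⟨b, rfl⟩ := op_surjective b
    simp [LeftDual.mul_apply, leftOp_leftDualT, leftOp_leftDualS, mul_assoc, eps_t_mul]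
  counit := LeftDual.lin.flip 1
  counit_l := fun a ψ => by
    have h := mul_leftDualT_apply ψ a 1
    rw [one_mul, ← mul_one (H.s a), LeftDual.map_s] at h
    exact h
  counit_r := fun a ψ => mul_leftDualS_apply ψ a 1
  counit_one := H.counit_one
  counit_s_mul := fun ψ ψ' => by
    change (ψ * ψ') 1 = (H.leftDualS (ψ 1) * ψ') 1
    rw [LeftDual.mul_apply, LeftDual.mul_apply, leftOp_leftDualS, leftOp_apply_one, mul_one]
  counit_t_mul := fun ψ ψ' => by
    change (ψ * ψ') 1 = (H.leftDualT (op (ψ 1)) * ψ') 1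
    rw [LeftDual.mul_apply, LeftDual.mul_apply, leftOp_leftDualT, leftOp_apply_one, one_mul]

/-- The right dual `U^*` as an `Aᵉ`-ring with augmentation, with counit `∂(φ) = φ(1)`. -/
def rightDualAug : AugAeRing k A H.RightDual where
  s := AlgHom.ofLinearMap H.rightDualS (RightDual.ext fun u => by simp [RightDual.one_apply])
    (fun a b => RightDual.ext fun u => by
      simp [RightDual.mul_apply, rightOp_rightDualS, mul_assoc])
  t := AlgHom.ofLinearMap H.rightDualT (RightDual.ext fun u => by simp [RightDual.one_apply])
    (fun a b => RightDual.ext fun u => by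
      simp [RightDual.mul_apply, rightOp_rightDualT, mul_assoc, eps_s_mul])
  comm := fun a b => RightDual.ext fun u => by
    simp [RightDual.mul_apply, rightOp_rightDualT, rightOp_rightDualS, mul_assoc, eps_s_mul]
  counit := RightDual.lin.flip 1
  counit_l := fun a φ => mul_rightDualT_apply φ a 1
  counit_r := fun a φ => by
    have h := mul_rightDualS_apply φ a 1
    rw [one_mul, ← mul_one (H.t (op a)), RightDual.map_t] at h
    exact h
  counit_one := H.counit_one
  counit_s_mul := fun φ φ' => by
    change (φ * φ') 1 = (H.rightDualS (φ 1) * φ') 1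
    rw [RightDual.mul_apply, RightDual.mul_apply, rightOp_rightDualS, rightOp_apply_one, one_mul]
  counit_t_mul := fun φ φ' => by
    change (φ * φ') 1 = (H.rightDualT (op (φ 1)) * φ') 1
    rw [RightDual.mul_apply, RightDual.mul_apply, rightOp_rightDualT, rightOp_apply_one, mul_one,
      unop_op]


/-! The coproduct of the left dual, if `▷U` is finitely generated projective. -/

section LeftComul

/-- `▷U` is a finitely generated projective left `A`-module. -/
def LeftFGP : Prop :=
  letI : Module A U := Module.compHom U H.s.toRingHom
  Module.Finite A U ∧ Module.Projective A U

/-- Existence of dual bases. -/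
theorem exists_leftBasis (h : H.LeftFGP) : ∃ (n : ℕ) (e : Fin n → U) (f : Fin n → H.LeftDual),
    ∀ u, ∑ i, H.s (f i u) * e i = u := by
  let _ : Module A U := Module.compHom U H.s.toRingHom
  obtain ⟨h1, h2⟩ : Module.Finite A U ∧ Module.Projective A U := h
  obtain ⟨n, p, hp⟩ := Module.Finite.exists_fin' A U
  obtain ⟨g, hg⟩ := Module.projective_lifting_property p LinearMap.id hp
  have hs : ∀ (a : A) (u : U), a • u = H.s a * u := fun _ _ => rfl
  refine ⟨n, fun i => p (Pi.single i 1), fun i => LeftDual.mk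
    { toFun := fun u => g u i
      map_add' := fun u v => by simp
      map_smul' := fun c u => by
        have : c • u = (algebraMap k A c) • u := by
          rw [hs, AlgHom.commutes, Algebra.smul_def]
        rw [this, map_smul]
        simp [Algebra.smul_def] }
    (fun a u => by
      change g (H.s a * u) i = a * g u i
      rw [← hs, map_smul]; rfl), fun u => ?_⟩
  have h3 : p (g u) = u := LinearMap.congr_fun hg u
  conv_rhs => rw [← h3, pi_eq_sum_univ' (g u), map_sum]
  refine Finset.sum_congr rfl fun i _ => ?_
  rw [map_smul, hs]
  congr 2

variable {H}
variable {P : Type*} [AddCommGroup P] [Module k P]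

/-- The left action of `U` on the left dual by right multiplication, `(v ψ)(u) = ψ(u v)`. -/
def leftDualAct (v : U) : H.LeftDual →ₗ[k] H.LeftDual where
  toFun ψ := LeftDual.mk (LeftDual.lin ψ ∘ₗ LinearMap.mulRight k v) (fun a u => by simp [mul_assoc])
  map_add' ψ ψ' := LeftDual.ext fun u => rfl
  map_smul' c ψ := LeftDual.ext fun u => rfl

@[simp]
theorem leftDualAct_apply (v : U) (ψ : H.LeftDual) (u : U) : leftDualAct v ψ u = ψ (u * v) := rfl

theorem leftDual_inner_l (a : A) (ψ : H.LeftDual) (u : U) :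
    (H.leftDualAug.inner.l a ψ) u = ψ (u * H.s a) := mul_leftDualT_apply ψ a u

theorem leftDual_inner_r (a : A) (ψ : H.LeftDual) (u : U) :
    (H.leftDualAug.inner.r (op a) ψ) u = ψ u * a := mul_leftDualS_apply ψ a u

/-- The map `ψ ⊗ p ↦ ψ(v) p`. -/
def leftTheta (C : Bimod k A P) (v : U) : H.leftDualAug.inner.Tensor C →ₗ[k] P :=
  BalTensor.lift (C.l.toLinearMap ∘ₗ LeftDual.lin.flip v) (fun a ψ p => by
    have h := leftDual_inner_r a ψ v
    simp only [LinearMap.comp_apply, LinearMap.flip_apply, h]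
    simp)

theorem leftTheta_tmul (C : Bimod k A P) (v : U) (ψ : H.LeftDual) (p : P) :
    leftTheta C v (H.leftDualAug.inner.tmul C ψ p) = C.l (ψ v) p := rfl

theorem leftTheta_ext (h : H.LeftFGP) (C : Bimod k A P) {X Y : H.leftDualAug.inner.Tensor C}
    (hXY : ∀ v, leftTheta C v X = leftTheta C v Y) : X = Y := by
  obtain ⟨n, e, f, hef⟩ := H.exists_leftBasis h
  have key : ∀ X : H.leftDualAug.inner.Tensor C,
      ∑ i, H.leftDualAug.inner.tmul C (f i) (leftTheta C (e i) X) = X := by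
    intro X
    induction X using BalTensor.induction with
    | h0 => simp
    | ht ψ p =>
      have h1 : ∑ i, H.leftDualAug.inner.r (op (ψ (e i))) (f i) = ψ := LeftDual.ext fun u => by
        rw [map_sum, LinearMap.sum_apply]
        conv_rhs => rw [← hef u, map_sum]
        exact Finset.sum_congr rfl fun i _ => by rw [leftDual_inner_r, LeftDual.map_s]
      conv_rhs => rw [← h1]
      rw [BalTensor.sum_tmul]
      refine Finset.sum_congr rfl fun i _ => ?_
      rw [leftTheta_tmul]
      exact (BalTensor.tmul_balanced (ρ := fun a : A => H.leftDualAug.inner.r (op a))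
        (ψ (e i)) (f i) p).symm
    | ha X Y h1 h2 =>
      simp only [map_add, Bimod.tmul, BalTensor.tmul_add, Finset.sum_add_distrib] at h1 h2 ⊢
      rw [h1, h2]
  rw [← key X, ← key Y]
  simp only [hXY]

/-- The coproduct of the left dual, `ψ ↦ ∑ fᵢ ⊗ ψ(· eᵢ)` for a dual basis `eᵢ`, `fᵢ` of `▷U`. By
`leftTheta_comul` and `leftTheta_ext` it is the only map with `ψ(u v) = ψ₂(u s(ψ₁(v)))`, that is, the
transpose of the multiplication of `U`, and does not depend on the dual basis. -/
noncomputable def leftDualComul (h : H.LeftFGP) :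
    H.LeftDual →ₗ[k] H.leftDualAug.inner.Tensor H.leftDualAug.inner :=
  ∑ i, BalTensor.mk _ _ ((H.exists_leftBasis h).choose_spec.choose_spec.choose i) ∘ₗ
    leftDualAct ((H.exists_leftBasis h).choose_spec.choose i)

theorem exists_leftDualComul (h : H.LeftFGP) :
    ∃ (n : ℕ) (e : Fin n → U) (f : Fin n → H.LeftDual), (∀ u, ∑ i, H.s (f i u) * e i = u) ∧
      ∀ ψ, leftDualComul h ψ =
        ∑ i, H.leftDualAug.inner.tmul H.leftDualAug.inner (f i) (leftDualAct (e i) ψ) :=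
  ⟨_, _, _, (H.exists_leftBasis h).choose_spec.choose_spec.choose_spec, fun ψ => by
    simp [leftDualComul, LinearMap.sum_apply]⟩

theorem sum_leftBasis {n : ℕ} {e : Fin n → U} {f : Fin n → H.LeftDual}
    (hef : ∀ u, ∑ i, H.s (f i u) * e i = u) (v : U) (ψ : H.LeftDual) :
    ∑ i, H.leftDualAug.inner.l (f i v) (leftDualAct (e i) ψ) = leftDualAct v ψ :=
  LeftDual.ext fun u => by
    rw [map_sum, LinearMap.sum_apply, leftDualAct_apply]
    conv_rhs => rw [← hef v, Finset.mul_sum, map_sum]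
    exact Finset.sum_congr rfl fun i _ => by rw [leftDual_inner_l, leftDualAct_apply, mul_assoc]

theorem leftTheta_comul (h : H.LeftFGP) (v : U) (ψ : H.LeftDual) :
    leftTheta H.leftDualAug.inner v (leftDualComul h ψ) = leftDualAct v ψ := by
  obtain ⟨n, e, f, hef, hc⟩ := exists_leftDualComul h
  rw [hc, map_sum, ← sum_leftBasis hef]
  rfl

theorem leftTheta_l (C : Bimod k A P) (v : U) (a : A) (X : H.leftDualAug.inner.Tensor C) :
    leftTheta C v ((H.leftDualAug.inner.tensor C).l a X) = leftTheta C (v * H.s a) X := by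
  induction X using BalTensor.induction with
  | h0 => simp
  | ht ψ p => rw [Bimod.tensor_l_tmul, leftTheta_tmul, leftTheta_tmul, leftDual_inner_l]
  | ha X Y h1 h2 => simp only [map_add, h1, h2]

theorem leftTheta_r (C : Bimod k A P) (v : U) (b : Aᵐᵒᵖ) (X : H.leftDualAug.inner.Tensor C) :
    leftTheta C v ((H.leftDualAug.inner.tensor C).r b X) = C.r b (leftTheta C v X) := by
  induction X using BalTensor.induction with
  | h0 => simp
  | ht ψ p => rw [Bimod.tensor_r_tmul, leftTheta_tmul, leftTheta_tmul, C.comm]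
  | ha X Y h1 h2 => simp only [map_add, h1, h2]

theorem leftDualComul_l (h : H.LeftFGP) (a : A) (ψ : H.LeftDual) :
    leftDualComul h (H.leftDualAug.inner.l a ψ) =
      (H.leftDualAug.inner.tensor H.leftDualAug.inner).l a (leftDualComul h ψ) :=
  leftTheta_ext h _ fun v => by
    rw [leftTheta_l, leftTheta_comul, leftTheta_comul]
    exact LeftDual.ext fun u => by
      rw [leftDualAct_apply, leftDual_inner_l, leftDualAct_apply, mul_assoc]

theorem leftDualComul_r (h : H.LeftFGP) (b : Aᵐᵒᵖ) (ψ : H.LeftDual) :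
    leftDualComul h (H.leftDualAug.inner.r b ψ) =
      (H.leftDualAug.inner.tensor H.leftDualAug.inner).r b (leftDualComul h ψ) :=
  leftTheta_ext h _ fun v => by
    obtain ⟨b, rfl⟩ := op_surjective b
    rw [leftTheta_r, leftTheta_comul, leftTheta_comul]
    exact LeftDual.ext fun u => by
      rw [leftDualAct_apply, leftDual_inner_r, leftDual_inner_r, leftDualAct_apply]

/-- The coring structure of the left dual. -/
noncomputable def leftDualCoring (h : H.LeftFGP) : Coring H.leftDualAug.inner where
  comul := leftDualComul h
  counit := H.leftDualAug.counit
  comul_l := leftDualComul_l h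
  comul_r := leftDualComul_r h
  counit_l := H.leftDualAug.counit_l
  counit_r := H.leftDualAug.counit_r
  coassoc := fun ψ => leftTheta_ext h _ fun v => leftTheta_ext h _ fun w => by
    have hR : ∀ X : H.leftDualAug.inner.Tensor H.leftDualAug.inner,
        leftTheta (H.leftDualAug.inner.tensor H.leftDualAug.inner) v
          (BalTensor.map (ρ' := fun a => H.leftDualAug.inner.r (op a))
            (l' := fun a => (H.leftDualAug.inner.tensor H.leftDualAug.inner).l a) id LinearMap.id
            (leftDualComul h) (fun _ _ => rfl) (fun a c => leftDualComul_l h a c) X) =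
        leftDualComul h (leftTheta H.leftDualAug.inner v X) := by
      intro X
      induction X using BalTensor.induction with
      | h0 => simp
      | ht α β => exact (leftDualComul_l h (α v) β).symm
      | ha X Y h1 h2 => simp only [map_add, h1, h2]
    have hA : ∀ (Z : H.leftDualAug.inner.Tensor H.leftDualAug.inner) (γ : H.LeftDual),
        leftTheta (H.leftDualAug.inner.tensor H.leftDualAug.inner) v
          (Bimod.assoc H.leftDualAug.inner H.leftDualAug.inner H.leftDualAug.inner
            ((H.leftDualAug.inner.tensor H.leftDualAug.inner).tmul H.leftDualAug.inner Z γ)) =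
          H.leftDualAug.inner.tmul H.leftDualAug.inner
            (leftTheta H.leftDualAug.inner v Z) γ := by
      intro Z γ
      induction Z using BalTensor.induction with
      | h0 => simp
      | ht α β => rfl
      | ha X Y h1 h2 =>
        simp only [Bimod.tmul, BalTensor.add_tmul, map_add] at h1 h2 ⊢
        rw [h1, h2]
    have hL : ∀ X : H.leftDualAug.inner.Tensor H.leftDualAug.inner,
        leftTheta H.leftDualAug.inner w
          (leftTheta (H.leftDualAug.inner.tensor H.leftDualAug.inner) v
            (Bimod.assoc H.leftDualAug.inner H.leftDualAug.inner H.leftDualAug.inner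
              (BalTensor.map
                (ρ' := fun a => (H.leftDualAug.inner.tensor H.leftDualAug.inner).r (op a))
                (l' := fun a => H.leftDualAug.inner.l a) id (leftDualComul h) LinearMap.id
                (fun a c => leftDualComul_r h (op a) c) (fun _ _ => rfl) X))) =
        leftTheta H.leftDualAug.inner (w * v) X := by
      intro X
      induction X using BalTensor.induction with
      | h0 => simp
      | ht α β =>
        rw [BalTensor.map_tmul]
        refine (congrArg _ (hA (leftDualComul h α) β)).trans ?_
        rw [leftTheta_comul]
        rfl
      | ha X Y h1 h2 => simp only [map_add, h1, h2]
    rw [hR, hL, leftTheta_comul, leftTheta_comul, leftTheta_comul]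
    exact LeftDual.ext fun u => by simp [mul_assoc]
  counit_comul := fun ψ => by
    refine Eq.trans ?_ ((leftTheta_comul h 1 ψ).trans (LeftDual.ext fun u => by simp))
    rfl
  comul_counit := fun ψ => LeftDual.ext fun u => by
    have hX : ∀ X : H.leftDualAug.inner.Tensor H.leftDualAug.inner,
        LeftDual.lin (BalTensor.lift ((H.leftDualAug.inner.r.toLinearMap ∘ₗ
          (opLinearEquiv k).toLinearMap ∘ₗ H.leftDualAug.counit).flip)
          (fun a m n => by
            simp only [LinearMap.flip_apply, LinearMap.comp_apply, H.leftDualAug.counit_l]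
            simp [mul_assoc]) X) u =
        leftTheta H.leftDualAug.inner u X 1 := by
      intro X
      induction X using BalTensor.induction with
      | h0 => simp
      | ht α β =>
        rw [leftTheta_tmul, leftDual_inner_l, one_mul, ← mul_one (H.s _), LeftDual.map_s]
        exact leftDual_inner_r (β 1) α u
      | ha X Y h1 h2 => simp only [map_add, LinearMap.add_apply, h1, h2]
    refine (hX _).trans ?_
    rw [leftTheta_comul, leftDualAct_apply, one_mul]

theorem sum_leftOp {n : ℕ} {e : Fin n → U} {f : Fin n → H.LeftDual}
    (hef : ∀ u, ∑ i, H.s (f i u) * e i = u) (ψ : H.LeftDual) (u v : U) :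
    ∑ i, H.leftOp (leftDualAct (e i) ψ) u * H.leftOp (f i) v = H.leftOp ψ (u * v) := by
  simp only [H.leftOp_apply _ v, H.leftOp_apply _ (u * v)]
  rw [H.comul_mul]
  change ∑ i, H.leftOp (leftDualAct (e i) ψ) u * H.leftEvD (f i) (H.comul v) =
    H.leftEvD ψ (H.leftTakeuchiMul (H.comul u) (H.comul_takeuchi u) (H.comul v))
  generalize H.comul v = Y
  induction Y using BalTensor.induction with
  | h0 => simp
  | ht y y' =>
    have h1 : ∀ X : H.outer.Tensor H.outer, H.leftEvD ψ (H.outerMulRight y y' X) =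
        H.leftEvD (leftDualAct y' ψ) X * y := by
      intro X
      induction X using BalTensor.induction with
      | h0 => simp
      | ht x x' =>
        rw [AeRing.outerMulRight_tmul, leftEv_tmul, leftEv_tmul, leftDualAct_apply, mul_assoc]
      | ha X Y h1 h2 => simp only [map_add, h1, h2, add_mul]
    have h2 : H.leftTakeuchiMul (H.comul u) (H.comul_takeuchi u) (H.outer.tmul H.outer y y') =
        H.outerMulRight y y' (H.comul u) := rfl
    rw [h2, h1, ← leftOp_apply, ← sum_leftBasis hef y' ψ]
    have h3 := map_sum (AddMonoidHom.mk' (fun ψ => H.leftOp ψ u) (fun a b => leftOp_add a b u))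
      (fun i => H.leftDualAug.inner.l (f i y') (leftDualAct (e i) ψ)) Finset.univ
    simp only [AddMonoidHom.mk'_apply] at h3
    rw [h3, Finset.sum_mul]
    refine Finset.sum_congr rfl fun i _ => ?_
    have h4 : H.leftDualAug.inner.l (f i y') (leftDualAct (e i) ψ) =
      leftDualAct (e i) ψ * H.leftDualT (op (f i y')) := rfl
    rw [h4, leftOp_mul, leftOp_leftDualT, leftEv_tmul, mul_assoc]
  | ha X Y h1 h2 => simp only [map_add, mul_add, Finset.sum_add_distrib, h1, h2]

theorem leftDualComul_takeuchi (h : H.LeftFGP) (ψ : H.LeftDual) :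
    leftDualComul h ψ ∈ H.leftDualAug.rightTakeuchi := fun a => leftTheta_ext h _ fun v => by
  have h1 : ∀ X, leftTheta H.leftDualAug.inner v
      (H.leftDualAug.innerMulLeft (H.leftDualAug.s a) 1 X) =
      leftTheta H.leftDualAug.inner (H.t (op a) * v) X := by
    intro X
    induction X using BalTensor.induction with
    | h0 => simp
    | ht α β =>
      rw [AeRing.innerMulLeft_tmul, leftTheta_tmul, leftTheta_tmul, one_mul,
        LeftDual.mul_apply]
      exact congrArg (fun x => H.leftDualAug.inner.l (α x) β) (leftOp_leftDualS a v)
    | ha X Y h1 h2 => simp only [map_add, h1, h2]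
  have h2 : ∀ X, leftTheta H.leftDualAug.inner v
      (H.leftDualAug.innerMulLeft 1 (H.leftDualAug.t (op a)) X) =
      H.leftDualAug.t (op a) * leftTheta H.leftDualAug.inner v X := by
    intro X
    induction X using BalTensor.induction with
    | h0 => simp
    | ht α β =>
      rw [AeRing.innerMulLeft_tmul, leftTheta_tmul, leftTheta_tmul, one_mul, AeRing.inner_l,
        AeRing.inner_l, mul_assoc]
    | ha X Y h1 h2 => simp only [map_add, h1, h2, mul_add]
  rw [h1, h2, leftTheta_comul, leftTheta_comul]
  refine LeftDual.ext fun u => ?_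
  rw [LeftDual.mul_apply, leftDualAct_apply, leftDualAct_apply, ← mul_assoc]
  exact congrArg (fun x => ψ (x * v)) (leftOp_leftDualT (op a) u).symm

variable (H)

/-- The right bialgebroid structure of the left dual `U_*`. -/
noncomputable def leftDualBialgebroid (h : H.LeftFGP) : RightBialgebroid k A H.LeftDual where
  toAugAeRing := H.leftDualAug
  coring := leftDualCoring h
  coring_counit := rfl
  comul_takeuchi := leftDualComul_takeuchi h
  comul_one := leftTheta_ext h _ fun v => by
    refine (leftTheta_comul h v 1).trans (LeftDual.ext fun u => ?_)
    rw [leftTheta_tmul, leftDual_inner_l]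
    exact H.counit_mul_s u v
  comul_mul := fun ψ ψ' => leftTheta_ext h _ fun v => by
    refine (leftTheta_comul h v (ψ * ψ')).trans (LeftDual.ext fun u => ?_)
    have h1 : ∀ (α β : H.LeftDual) (Y : H.leftDualAug.inner.Tensor H.leftDualAug.inner),
        leftTheta H.leftDualAug.inner v (H.leftDualAug.innerMulLeft α β Y) =
          β * leftTheta H.leftDualAug.inner (H.leftOp α v) Y := by
      intro α β Y
      induction Y using BalTensor.induction with
      | h0 => simp
      | ht γ δ =>
        rw [AeRing.innerMulLeft_tmul, leftTheta_tmul, leftTheta_tmul, AeRing.inner_l,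
          AeRing.inner_l, mul_assoc]
        rfl
      | ha X Y h1 h2 => simp only [map_add, h1, h2, mul_add]
    obtain ⟨n, e, f, hef, hc⟩ := exists_leftDualComul h
    have h2 : H.leftDualAug.rightTakeuchiMul (leftDualComul h ψ') (leftDualComul_takeuchi h ψ')
        (leftDualComul h ψ) =
        ∑ i, H.leftDualAug.innerMulLeft (f i) (leftDualAct (e i) ψ) (leftDualComul h ψ') := by
      rw [hc ψ, map_sum]
      rfl
    refine Eq.trans ?_ (congrArg (fun X => LeftDual.lin (leftTheta _ v X) u) h2.symm)
    simp only [map_sum, LinearMap.sum_apply, h1, leftTheta_comul]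
    simp only [LeftDual.mul_apply, leftDualAct_apply]
    rw [← map_sum, sum_leftOp hef]

end LeftComul

/-! The coproduct of the right dual, if `U_◁` is finitely generated projective. -/

section RightComul

/-- `U_◁` is a finitely generated projective right `A`-module. -/
def RightFGP : Prop :=
  letI : Module Aᵐᵒᵖ U := Module.compHom U H.t.toRingHom
  Module.Finite Aᵐᵒᵖ U ∧ Module.Projective Aᵐᵒᵖ U

/-- Existence of dual bases. -/
theorem exists_rightBasis (h : H.RightFGP) : ∃ (n : ℕ) (e : Fin n → U) (f : Fin n → H.RightDual),
    ∀ u, ∑ i, H.t (op (f i u)) * e i = u := by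
  let _ : Module Aᵐᵒᵖ U := Module.compHom U H.t.toRingHom
  obtain ⟨h1, h2⟩ : Module.Finite Aᵐᵒᵖ U ∧ Module.Projective Aᵐᵒᵖ U := h
  obtain ⟨n, p, hp⟩ := Module.Finite.exists_fin' Aᵐᵒᵖ U
  obtain ⟨g, hg⟩ := Module.projective_lifting_property p LinearMap.id hp
  have hs : ∀ (a : Aᵐᵒᵖ) (u : U), a • u = H.t a * u := fun _ _ => rfl
  refine ⟨n, fun i => p (Pi.single i 1), fun i => RightDual.mk
    { toFun := fun u => unop (g u i)
      map_add' := fun u v => by simp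
      map_smul' := fun c u => by
        have : c • u = (algebraMap k Aᵐᵒᵖ c) • u := by
          rw [hs, AlgHom.commutes, Algebra.smul_def]
        rw [this, map_smul]
        simp [Algebra.smul_def, Algebra.commutes] }
    (fun a u => by
      change unop (g (H.t (op a) * u) i) = unop (g u i) * a
      rw [← hs, map_smul]; rfl), fun u => ?_⟩
  have h3 : p (g u) = u := LinearMap.congr_fun hg u
  conv_rhs => rw [← h3, pi_eq_sum_univ' (g u), map_sum]
  refine Finset.sum_congr rfl fun i _ => ?_
  rw [map_smul, hs]
  congr 2

variable {H}
variable {P : Type*} [AddCommGroup P] [Module k P]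

/-- The left action of `U` on the right dual by right multiplication, `(v φ)(u) = φ(u v)`. -/
def rightDualAct (v : U) : H.RightDual →ₗ[k] H.RightDual where
  toFun φ := RightDual.mk (RightDual.lin φ ∘ₗ LinearMap.mulRight k v)
    (fun a u => by simp [mul_assoc])
  map_add' φ φ' := RightDual.ext fun u => rfl
  map_smul' c φ := RightDual.ext fun u => rfl

@[simp]
theorem rightDualAct_apply (v : U) (φ : H.RightDual) (u : U) :
    rightDualAct v φ u = φ (u * v) := rfl

theorem rightDual_inner_l (a : A) (φ : H.RightDual) (u : U) :
    (H.rightDualAug.inner.l a φ) u = a * φ u := mul_rightDualT_apply φ a u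

theorem rightDual_inner_r (a : A) (φ : H.RightDual) (u : U) :
    (H.rightDualAug.inner.r (op a) φ) u = φ (u * H.t (op a)) := mul_rightDualS_apply φ a u

/-- The map `p ⊗ φ ↦ p φ(v)`. -/
def rightTheta (C : Bimod k A P) (v : U) : C.Tensor H.rightDualAug.inner →ₗ[k] P :=
  BalTensor.lift
    (C.r.toLinearMap ∘ₗ (opLinearEquiv k).toLinearMap ∘ₗ RightDual.lin.flip v).flip
    (fun a p φ => by
      have h := rightDual_inner_l a φ v
      simp only [LinearMap.comp_apply, LinearMap.flip_apply, h]
      simp)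

theorem rightTheta_tmul (C : Bimod k A P) (v : U) (φ : H.RightDual) (p : P) :
    rightTheta C v (C.tmul H.rightDualAug.inner p φ) = C.r (op (φ v)) p := rfl

theorem sum_rightTheta {n : ℕ} {e : Fin n → U} {f : Fin n → H.RightDual}
    (hef : ∀ u, ∑ i, H.t (op (f i u)) * e i = u) (C : Bimod k A P)
    (X : C.Tensor H.rightDualAug.inner) :
    ∑ i, C.tmul H.rightDualAug.inner (rightTheta C (e i) X) (f i) = X := by
  induction X using BalTensor.induction with
  | h0 => simp
  | ht p φ =>
    have h1 : ∑ i, H.rightDualAug.inner.l (φ (e i)) (f i) = φ := RightDual.ext fun u => by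
      rw [map_sum, LinearMap.sum_apply]
      conv_rhs => rw [← hef u, map_sum]
      exact Finset.sum_congr rfl fun i _ => by rw [rightDual_inner_l, RightDual.map_t]
    conv_rhs => rw [← h1]
    rw [BalTensor.tmul_sum]
    refine Finset.sum_congr rfl fun i _ => ?_
    rw [rightTheta_tmul]
    exact BalTensor.tmul_balanced (ρ := fun a : A => C.r (op a))
      (l := fun a : A => H.rightDualAug.inner.l a) (φ (e i)) p (f i)
  | ha X Y h1 h2 =>
    simp only [map_add, Bimod.tmul, BalTensor.add_tmul, Finset.sum_add_distrib] at h1 h2 ⊢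
    rw [h1, h2]

theorem rightTheta_ext (h : H.RightFGP) (C : Bimod k A P) {X Y : C.Tensor H.rightDualAug.inner}
    (hXY : ∀ v, rightTheta C v X = rightTheta C v Y) : X = Y := by
  obtain ⟨n, e, f, hef⟩ := H.exists_rightBasis h
  rw [← sum_rightTheta hef C X, ← sum_rightTheta hef C Y]
  simp only [hXY]

/-- The coproduct of the right dual, `φ ↦ ∑ φ(· eᵢ) ⊗ fᵢ` for a dual basis `eᵢ`, `fᵢ` of `U_◁`. By
`rightTheta_comul` and `rightTheta_ext` it is the only map with `φ(u v) = φ₁(u t(φ₂(v)))`, that is,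
the transpose of the multiplication of `U`, and does not depend on the dual basis. -/
noncomputable def rightDualComul (h : H.RightFGP) :
    H.RightDual →ₗ[k] H.rightDualAug.inner.Tensor H.rightDualAug.inner :=
  ∑ i, (BalTensor.mk _ _).flip ((H.exists_rightBasis h).choose_spec.choose_spec.choose i) ∘ₗ
    rightDualAct ((H.exists_rightBasis h).choose_spec.choose i)

theorem exists_rightDualComul (h : H.RightFGP) :
    ∃ (n : ℕ) (e : Fin n → U) (f : Fin n → H.RightDual),
      (∀ u, ∑ i, H.t (op (f i u)) * e i = u) ∧ ∀ φ, rightDualComul h φ =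
        ∑ i, H.rightDualAug.inner.tmul H.rightDualAug.inner (rightDualAct (e i) φ) (f i) :=
  ⟨_, _, _, (H.exists_rightBasis h).choose_spec.choose_spec.choose_spec, fun φ => by
    simp [rightDualComul, LinearMap.sum_apply]⟩

theorem sum_rightBasis {n : ℕ} {e : Fin n → U} {f : Fin n → H.RightDual}
    (hef : ∀ u, ∑ i, H.t (op (f i u)) * e i = u) (v : U) (φ : H.RightDual) :
    ∑ i, H.rightDualAug.inner.r (op (f i v)) (rightDualAct (e i) φ) = rightDualAct v φ :=
  RightDual.ext fun u => by
    rw [map_sum, LinearMap.sum_apply, rightDualAct_apply]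
    conv_rhs => rw [← hef v, Finset.mul_sum, map_sum]
    exact Finset.sum_congr rfl fun i _ => by rw [rightDual_inner_r, rightDualAct_apply, mul_assoc]

theorem rightTheta_comul (h : H.RightFGP) (v : U) (φ : H.RightDual) :
    rightTheta H.rightDualAug.inner v (rightDualComul h φ) = rightDualAct v φ := by
  obtain ⟨n, e, f, hef, hc⟩ := exists_rightDualComul h
  rw [hc, map_sum, ← sum_rightBasis hef]
  rfl

theorem rightTheta_l (C : Bimod k A P) (v : U) (a : A) (X : C.Tensor H.rightDualAug.inner) :
    rightTheta C v ((C.tensor H.rightDualAug.inner).l a X) = C.l a (rightTheta C v X) := by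
  induction X using BalTensor.induction with
  | h0 => simp
  | ht p φ => rw [Bimod.tensor_l_tmul, rightTheta_tmul, rightTheta_tmul, C.comm]
  | ha X Y h1 h2 => simp only [map_add, h1, h2]

theorem rightTheta_r (C : Bimod k A P) (v : U) (b : A) (X : C.Tensor H.rightDualAug.inner) :
    rightTheta C v ((C.tensor H.rightDualAug.inner).r (op b) X) =
      rightTheta C (v * H.t (op b)) X := by
  induction X using BalTensor.induction with
  | h0 => simp
  | ht p φ => rw [Bimod.tensor_r_tmul, rightTheta_tmul, rightTheta_tmul, rightDual_inner_r]
  | ha X Y h1 h2 => simp only [map_add, h1, h2]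

theorem rightDualAct_inner_l (v : U) (a : A) (φ : H.RightDual) :
    rightDualAct v (H.rightDualAug.inner.l a φ) = H.rightDualAug.inner.l a (rightDualAct v φ) :=
  RightDual.ext fun u => by
    rw [rightDualAct_apply, rightDual_inner_l, rightDual_inner_l, rightDualAct_apply]

theorem rightDualComul_l (h : H.RightFGP) (a : A) (φ : H.RightDual) :
    rightDualComul h (H.rightDualAug.inner.l a φ) =
      (H.rightDualAug.inner.tensor H.rightDualAug.inner).l a (rightDualComul h φ) :=
  rightTheta_ext h _ fun v => by
    rw [rightTheta_l, rightTheta_comul, rightTheta_comul, rightDualAct_inner_l]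

theorem rightDualComul_r (h : H.RightFGP) (b : Aᵐᵒᵖ) (φ : H.RightDual) :
    rightDualComul h (H.rightDualAug.inner.r b φ) =
      (H.rightDualAug.inner.tensor H.rightDualAug.inner).r b (rightDualComul h φ) :=
  rightTheta_ext h _ fun v => by
    obtain ⟨b, rfl⟩ := op_surjective b
    rw [rightTheta_r, rightTheta_comul, rightTheta_comul]
    exact RightDual.ext fun u => by
      rw [rightDualAct_apply, rightDual_inner_r, rightDualAct_apply, mul_assoc]

/-- The map `α ⊗ (β ⊗ γ) ↦ α ⊗ β γ(v)`. -/
def rightTheta₂ (v : U) : H.rightDualAug.inner.Tensor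
      (H.rightDualAug.inner.tensor H.rightDualAug.inner) →ₗ[k]
    H.rightDualAug.inner.Tensor H.rightDualAug.inner :=
  BalTensor.map id LinearMap.id (rightTheta H.rightDualAug.inner v) (fun _ _ => rfl)
    (fun a X => rightTheta_l _ v a X)

theorem rightTheta₂_tmul (v : U) (α : H.RightDual)
    (X : H.rightDualAug.inner.Tensor H.rightDualAug.inner) :
    rightTheta₂ v (H.rightDualAug.inner.tmul
      (H.rightDualAug.inner.tensor H.rightDualAug.inner) α X) =
    H.rightDualAug.inner.tmul H.rightDualAug.inner α (rightTheta H.rightDualAug.inner v X) := rfl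

theorem rightTheta₂_ext (h : H.RightFGP) {X Y : H.rightDualAug.inner.Tensor
      (H.rightDualAug.inner.tensor H.rightDualAug.inner)}
    (hXY : ∀ v, rightTheta₂ v X = rightTheta₂ v Y) : X = Y := by
  obtain ⟨n, e, f, hef⟩ := H.exists_rightBasis h
  have key : ∀ X : H.rightDualAug.inner.Tensor
      (H.rightDualAug.inner.tensor H.rightDualAug.inner),
      ∑ i, Bimod.assocAux _ _ H.rightDualAug.inner (f i) (rightTheta₂ (e i) X) = X := by
    intro X
    induction X using BalTensor.induction with
    | h0 => simp
    | ht α Z =>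
      conv_rhs => rw [← sum_rightTheta hef _ Z, BalTensor.tmul_sum]
      rfl
    | ha X Y h1 h2 =>
      simp only [map_add, Finset.sum_add_distrib]
      rw [h1, h2]
  rw [← key X, ← key Y]
  simp only [hXY]

/-- The coring structure of the right dual. -/
noncomputable def rightDualCoring (h : H.RightFGP) : Coring H.rightDualAug.inner where
  comul := rightDualComul h
  counit := H.rightDualAug.counit
  comul_l := rightDualComul_l h
  comul_r := rightDualComul_r h
  counit_l := H.rightDualAug.counit_l
  counit_r := H.rightDualAug.counit_r
  coassoc := fun φ => rightTheta₂_ext h fun v => rightTheta_ext h _ fun w => by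
    have hR : ∀ X : H.rightDualAug.inner.Tensor H.rightDualAug.inner,
        rightTheta H.rightDualAug.inner w (rightTheta₂ v
          (BalTensor.map (ρ' := fun a => H.rightDualAug.inner.r (op a))
            (l' := fun a => (H.rightDualAug.inner.tensor H.rightDualAug.inner).l a) id
            LinearMap.id (rightDualComul h) (fun _ _ => rfl)
            (fun a c => rightDualComul_l h a c) X)) =
        rightTheta H.rightDualAug.inner (w * v) X := by
      intro X
      induction X using BalTensor.induction with
      | h0 => simp
      | ht α β =>
        rw [BalTensor.map_tmul]
        refine (congrArg _ (rightTheta₂_tmul v α (rightDualComul h β))).trans ?_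
        rw [rightTheta_comul]
        rfl
      | ha X Y h1 h2 => simp only [map_add, h1, h2]
    have hA : ∀ (Z : H.rightDualAug.inner.Tensor H.rightDualAug.inner) (γ : H.RightDual),
        rightTheta₂ v
          (Bimod.assoc H.rightDualAug.inner H.rightDualAug.inner H.rightDualAug.inner
            ((H.rightDualAug.inner.tensor H.rightDualAug.inner).tmul
              H.rightDualAug.inner Z γ)) =
          (H.rightDualAug.inner.tensor H.rightDualAug.inner).r (op (γ v)) Z := by
      intro Z γ
      induction Z using BalTensor.induction with
      | h0 => simp
      | ht α β => rfl
      | ha X Y h1 h2 =>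
        simp only [Bimod.tmul, BalTensor.add_tmul, map_add] at h1 h2 ⊢
        rw [h1, h2]
    have hL : ∀ X : H.rightDualAug.inner.Tensor H.rightDualAug.inner,
          rightTheta₂ v
            (Bimod.assoc H.rightDualAug.inner H.rightDualAug.inner H.rightDualAug.inner
              (BalTensor.map
                (ρ' := fun a => (H.rightDualAug.inner.tensor H.rightDualAug.inner).r (op a))
                (l' := fun a => H.rightDualAug.inner.l a) id (rightDualComul h) LinearMap.id
                (fun a c => rightDualComul_r h (op a) c) (fun _ _ => rfl) X)) =
        rightDualComul h (rightTheta H.rightDualAug.inner v X) := by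
      intro X
      induction X using BalTensor.induction with
      | h0 => simp
      | ht α β =>
        rw [BalTensor.map_tmul]
        refine (hA (rightDualComul h α) β).trans ?_
        exact (rightDualComul_r h (op (β v)) α).symm
      | ha X Y h1 h2 => simp only [map_add, h1, h2]
    rw [hR, hL, rightTheta_comul, rightTheta_comul, rightTheta_comul]
    exact RightDual.ext fun u => by simp [mul_assoc]
  counit_comul := fun φ => RightDual.ext fun u => by
    have hX : ∀ X : H.rightDualAug.inner.Tensor H.rightDualAug.inner,
        RightDual.lin (BalTensor.lift (H.rightDualAug.inner.l.toLinearMap ∘ₗ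
          H.rightDualAug.counit) (fun a m n => by
            simp only [LinearMap.comp_apply, H.rightDualAug.counit_r]
            simp [mul_assoc]) X) u =
        rightTheta H.rightDualAug.inner u X 1 := by
      intro X
      induction X using BalTensor.induction with
      | h0 => simp
      | ht α β =>
        rw [rightTheta_tmul, rightDual_inner_r, one_mul, ← mul_one (H.t _), RightDual.map_t]
        exact rightDual_inner_l (α 1) β u
      | ha X Y h1 h2 => simp only [map_add, LinearMap.add_apply, h1, h2]
    refine (hX _).trans ?_
    rw [rightTheta_comul, rightDualAct_apply, one_mul]
  comul_counit := fun φ => by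
    refine Eq.trans ?_ ((rightTheta_comul h 1 φ).trans (RightDual.ext fun u => by simp))
    rfl

theorem sum_rightOp {n : ℕ} {e : Fin n → U} {f : Fin n → H.RightDual}
    (hef : ∀ u, ∑ i, H.t (op (f i u)) * e i = u) (φ : H.RightDual) (u v : U) :
    ∑ i, H.rightOp (rightDualAct (e i) φ) u * H.rightOp (f i) v = H.rightOp φ (u * v) := by
  simp only [H.rightOp_apply _ v, H.rightOp_apply _ (u * v)]
  rw [H.comul_mul]
  change ∑ i, H.rightOp (rightDualAct (e i) φ) u * H.rightEvD (f i) (H.comul v) =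
    H.rightEvD φ (H.leftTakeuchiMul (H.comul u) (H.comul_takeuchi u) (H.comul v))
  generalize H.comul v = Y
  induction Y using BalTensor.induction with
  | h0 => simp
  | ht y y' =>
    have h1 : ∀ X : H.outer.Tensor H.outer, H.rightEvD φ (H.outerMulRight y y' X) =
        H.rightEvD (rightDualAct y φ) X * y' := by
      intro X
      induction X using BalTensor.induction with
      | h0 => simp
      | ht x x' =>
        rw [AeRing.outerMulRight_tmul, rightEv_tmul, rightEv_tmul, rightDualAct_apply, mul_assoc]
      | ha X Y h1 h2 => simp only [map_add, h1, h2, add_mul]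
    have h2 : H.leftTakeuchiMul (H.comul u) (H.comul_takeuchi u) (H.outer.tmul H.outer y y') =
        H.outerMulRight y y' (H.comul u) := rfl
    rw [h2, h1, ← rightOp_apply, ← sum_rightBasis hef y φ]
    have h3 := map_sum (AddMonoidHom.mk' (fun φ => H.rightOp φ u) (fun a b => rightOp_add a b u))
      (fun i => H.rightDualAug.inner.r (op (f i y)) (rightDualAct (e i) φ)) Finset.univ
    simp only [AddMonoidHom.mk'_apply] at h3
    rw [h3, Finset.sum_mul]
    refine Finset.sum_congr rfl fun i _ => ?_
    have h4 : H.rightDualAug.inner.r (op (f i y)) (rightDualAct (e i) φ) =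
      rightDualAct (e i) φ * H.rightDualS (f i y) := rfl
    rw [h4, rightOp_mul, rightOp_rightDualS, rightEv_tmul, mul_assoc]
  | ha X Y h1 h2 => simp only [map_add, mul_add, Finset.sum_add_distrib, h1, h2]

theorem rightDualComul_takeuchi (h : H.RightFGP) (φ : H.RightDual) :
    rightDualComul h φ ∈ H.rightDualAug.rightTakeuchi := fun a => rightTheta_ext h _ fun v => by
  have h1 : ∀ X, rightTheta H.rightDualAug.inner v
      (H.rightDualAug.innerMulLeft 1 (H.rightDualAug.t (op a)) X) =
      rightTheta H.rightDualAug.inner (H.s a * v) X := by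
    intro X
    induction X using BalTensor.induction with
    | h0 => simp
    | ht α β =>
      rw [AeRing.innerMulLeft_tmul, rightTheta_tmul, rightTheta_tmul, one_mul,
        RightDual.mul_apply]
      exact congrArg (fun x => H.rightDualAug.inner.r (op (β x)) α) (rightOp_rightDualT (op a) v)
    | ha X Y h1 h2 => simp only [map_add, h1, h2]
  have h2 : ∀ X, rightTheta H.rightDualAug.inner v
      (H.rightDualAug.innerMulLeft (H.rightDualAug.s a) 1 X) =
      H.rightDualAug.s a * rightTheta H.rightDualAug.inner v X := by
    intro X
    induction X using BalTensor.induction with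
    | h0 => simp
    | ht α β =>
      rw [AeRing.innerMulLeft_tmul, rightTheta_tmul, rightTheta_tmul, one_mul, AeRing.inner_r,
        AeRing.inner_r, mul_assoc]
    | ha X Y h1 h2 => simp only [map_add, h1, h2, mul_add]
  rw [h1, h2, rightTheta_comul, rightTheta_comul]
  refine RightDual.ext fun u => ?_
  rw [RightDual.mul_apply, rightDualAct_apply, rightDualAct_apply, ← mul_assoc]
  exact congrArg (fun x => φ (x * v)) (rightOp_rightDualS a u)

variable (H)

/-- The right bialgebroid structure of the right dual `U^*`. -/
noncomputable def rightDualBialgebroid (h : H.RightFGP) :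
    RightBialgebroid k A H.RightDual where
  toAugAeRing := H.rightDualAug
  coring := rightDualCoring h
  coring_counit := rfl
  comul_takeuchi := rightDualComul_takeuchi h
  comul_one := rightTheta_ext h _ fun v => by
    refine (rightTheta_comul h v 1).trans (RightDual.ext fun u => ?_)
    rw [rightTheta_tmul, rightDual_inner_r]
    exact H.counit_mul_t u v
  comul_mul := fun φ φ' => rightTheta_ext h _ fun v => by
    refine (rightTheta_comul h v (φ * φ')).trans (RightDual.ext fun u => ?_)
    have h1 : ∀ (α β : H.RightDual) (Y : H.rightDualAug.inner.Tensor H.rightDualAug.inner),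
        rightTheta H.rightDualAug.inner v (H.rightDualAug.innerMulLeft α β Y) =
          α * rightTheta H.rightDualAug.inner (H.rightOp β v) Y := by
      intro α β Y
      induction Y using BalTensor.induction with
      | h0 => simp
      | ht γ δ =>
        rw [AeRing.innerMulLeft_tmul, rightTheta_tmul, rightTheta_tmul, AeRing.inner_r,
          AeRing.inner_r, mul_assoc]
        rfl
      | ha X Y h1 h2 => simp only [map_add, h1, h2, mul_add]
    obtain ⟨n, e, f, hef, hc⟩ := exists_rightDualComul h
    have h2 : H.rightDualAug.rightTakeuchiMul (rightDualComul h φ') (rightDualComul_takeuchi h φ')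
        (rightDualComul h φ) =
        ∑ i, H.rightDualAug.innerMulLeft (rightDualAct (e i) φ) (f i) (rightDualComul h φ') := by
      rw [hc φ, map_sum]
      rfl
    refine Eq.trans ?_ (congrArg (fun X => RightDual.lin (rightTheta _ v X) u) h2.symm)
    simp only [map_sum, LinearMap.sum_apply, h1, rightTheta_comul]
    simp only [RightDual.mul_apply, rightDualAct_apply]
    rw [← map_sum, sum_rightOp hef]

end RightComul

/-! Left and right Hopf algebroids. -/

section Hopf

/-- The tensor product `▶U ⊗_{Aᵒᵖ} U_◁`, in which `u t(a) ⊗ v = u ⊗ t(a) v`. -/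
abbrev LeftGaloisTensor : Type _ :=
  BalTensor (fun a : A => H.inner.l a) (fun a : A => H.outer.r (op a))

/-- The tensor product `U_◀ ⊗^A ▷U`, in which `u s(a) ⊗ v = u ⊗ s(a) v`. -/
abbrev RightGaloisTensor : Type _ :=
  BalTensor (fun a : A => H.inner.r (op a)) (fun a : A => H.outer.l a)

/-- The Hopf-Galois map `α_ℓ : ▶U ⊗_{Aᵒᵖ} U_◁ → U_◁ ⊗_A ▷U`, `u ⊗ v ↦ u₁ ⊗ u₂ v`. -/
def leftGalois : H.LeftGaloisTensor →ₗ[k] H.outer.Tensor H.outer :=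
  BalTensor.lift ((H.outerMulRight 1).flip ∘ₗ H.comul) (fun a u v => by
    change H.outerMulRight 1 v (H.comul (u * H.t (op a))) =
      H.outerMulRight 1 (H.t (op a) * v) (H.comul u)
    rw [comul_mul_t, AeRing.outerMulRight_comp, mul_one])

/-- The Hopf-Galois map `α_r : U_◀ ⊗^A ▷U → U_◁ ⊗_A ▷U`, `u ⊗ v ↦ u₁ v ⊗ u₂`. -/
def rightGalois : H.RightGaloisTensor →ₗ[k] H.outer.Tensor H.outer :=
  BalTensor.lift ((H.outerMulRight.flip 1).flip ∘ₗ H.comul) (fun a u v => by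
    change H.outerMulRight v 1 (H.comul (u * H.s a)) =
      H.outerMulRight (H.s a * v) 1 (H.comul u)
    rw [comul_mul_s, AeRing.outerMulRight_comp, mul_one])

/-- `U` is a left Hopf algebroid: `α_ℓ` is bijective. -/
def IsLeftHopf : Prop := Function.Bijective H.leftGalois

/-- `U` is a right Hopf algebroid: `α_r` is bijective. -/
def IsRightHopf : Prop := Function.Bijective H.rightGalois

variable {H}

/-- The translation map `u ↦ u₊ ⊗ u₋ = α_ℓ⁻¹(u ⊗ 1)` of a left Hopf algebroid. -/
noncomputable def leftTrans (h : H.IsLeftHopf) (u : U) : H.LeftGaloisTensor :=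
  (LinearEquiv.ofBijective H.leftGalois h).symm (H.outer.tmul H.outer u 1)

/-- The translation map `u ↦ u₍₊₎ ⊗ u₍₋₎ = α_r⁻¹(1 ⊗ u)` of a right Hopf algebroid. -/
noncomputable def rightTrans (h : H.IsRightHopf) (u : U) : H.RightGaloisTensor :=
  (LinearEquiv.ofBijective H.rightGalois h).symm (H.outer.tmul H.outer 1 u)

/-- For `φ` in the right dual, the map `x ⊗ y ↦ ε(x t(φ(y)))`. -/
def leftHopfEval (φ : H.RightDual) : H.LeftGaloisTensor →ₗ[k] A :=
  BalTensor.lift (((LinearMap.mul k U).compr₂ H.eps).compl₂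
      (H.t.toLinearMap ∘ₗ (opLinearEquiv k).toLinearMap ∘ₗ RightDual.lin φ))
    (fun a x y => by simp [mul_assoc])

/-- For `ψ` in the left dual, the map `x ⊗ y ↦ ε(x s(ψ(y)))`. -/
def rightHopfEval (ψ : H.LeftDual) : H.RightGaloisTensor →ₗ[k] A :=
  BalTensor.lift (((LinearMap.mul k U).compr₂ H.eps).compl₂ (H.s.toLinearMap ∘ₗ LeftDual.lin ψ))
    (fun a x y => by simp [mul_assoc])

/-- The function `S^*(φ) : u ↦ ε(u₊ t(φ(u₋)))`. -/
noncomputable def sStarUp (h : H.IsLeftHopf) (φ : H.RightDual) (u : U) : A :=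
  leftHopfEval φ (leftTrans h u)

/-- The function `S_*(ψ) : u ↦ ε(u₍₊₎ s(ψ(u₍₋₎)))`. -/
noncomputable def sStarDown (h : H.IsRightHopf) (ψ : H.LeftDual) (u : U) : A :=
  rightHopfEval ψ (rightTrans h u)

theorem leftHopfEval_tmul (φ : H.RightDual) (x y : U) :
    leftHopfEval φ (BalTensor.tmul _ _ x y) = H.eps (x * H.t (op (φ y))) := rfl

theorem rightHopfEval_tmul (ψ : H.LeftDual) (x y : U) :
    rightHopfEval ψ (BalTensor.tmul _ _ x y) = H.eps (x * H.s (ψ y)) := rfl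

theorem leftGalois_tmul (x y : U) :
    H.leftGalois (BalTensor.tmul _ _ x y) = H.outerMulRight 1 y (H.comul x) := by
  rw [leftGalois, BalTensor.lift_tmul, LinearMap.comp_apply, LinearMap.flip_apply]

theorem rightGalois_tmul (x y : U) :
    H.rightGalois (BalTensor.tmul _ _ x y) = H.outerMulRight y 1 (H.comul x) := by
  rw [rightGalois, BalTensor.lift_tmul, LinearMap.comp_apply, LinearMap.flip_apply,
    LinearMap.flip_apply]

theorem leftGalois_leftTrans (h : H.IsLeftHopf) (u : U) :
    H.leftGalois (leftTrans h u) = H.outer.tmul H.outer u 1 :=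
  (LinearEquiv.ofBijective H.leftGalois h).apply_symm_apply _

theorem rightGalois_rightTrans (h : H.IsRightHopf) (u : U) :
    H.rightGalois (rightTrans h u) = H.outer.tmul H.outer 1 u :=
  (LinearEquiv.ofBijective H.rightGalois h).apply_symm_apply _

theorem leftTakeuchiMul_outerMulRight (X : H.outer.Tensor H.outer) (hX : X ∈ H.leftTakeuchi)
    (a b : U) (Y : H.outer.Tensor H.outer) :
    H.leftTakeuchiMul X hX (H.outerMulRight a b Y) =
      H.outerMulRight a b (H.leftTakeuchiMul X hX Y) := by
  induction Y using BalTensor.induction with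
  | h0 => simp
  | ht x y => exact (H.outerMulRight_comp x y a b X).symm
  | ha Y Z h1 h2 => simp only [map_add, h1, h2]

/-- The map `p ⊗ q ↦ x p ⊗ q y`. -/
def leftSandwich (x y : U) : H.LeftGaloisTensor →ₗ[k] H.LeftGaloisTensor :=
  BalTensor.map id (LinearMap.mulLeft k x) (LinearMap.mulRight k y)
    (fun _ _ => by simp [mul_assoc]) (fun _ _ => by simp [mul_assoc])

/-- The map `p ⊗ q ↦ x p ⊗ q y`. -/
def rightSandwich (x y : U) : H.RightGaloisTensor →ₗ[k] H.RightGaloisTensor :=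
  BalTensor.map id (LinearMap.mulLeft k x) (LinearMap.mulRight k y)
    (fun _ _ => by simp [mul_assoc]) (fun _ _ => by simp [mul_assoc])

theorem leftSandwich_tmul (x y p q : U) : leftSandwich (H := H) x y (BalTensor.tmul _ _ p q) =
    BalTensor.tmul _ _ (x * p) (q * y) := rfl

theorem rightSandwich_tmul (x y p q : U) : rightSandwich (H := H) x y (BalTensor.tmul _ _ p q) =
    BalTensor.tmul _ _ (x * p) (q * y) := rfl

theorem leftGalois_leftSandwich (x y : U) (T : H.LeftGaloisTensor) :
    H.leftGalois (leftSandwich x y T) =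
      H.outerMulRight 1 y (H.leftTakeuchiMul (H.comul x) (H.comul_takeuchi x) (H.leftGalois T)) := by
  induction T using BalTensor.induction with
  | h0 => simp
  | ht p q =>
    rw [leftSandwich_tmul, leftGalois_tmul, leftGalois_tmul, leftTakeuchiMul_outerMulRight,
      AeRing.outerMulRight_comp, H.comul_mul, mul_one]
  | ha Y Z h1 h2 => simp only [map_add, h1, h2]

theorem rightGalois_rightSandwich (x y : U) (T : H.RightGaloisTensor) :
    H.rightGalois (rightSandwich x y T) =
      H.outerMulRight y 1 (H.leftTakeuchiMul (H.comul x) (H.comul_takeuchi x) (H.rightGalois T)) := by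
  induction T using BalTensor.induction with
  | h0 => simp
  | ht p q =>
    rw [rightSandwich_tmul, rightGalois_tmul, rightGalois_tmul, leftTakeuchiMul_outerMulRight,
      AeRing.outerMulRight_comp, H.comul_mul, mul_one]
  | ha Y Z h1 h2 => simp only [map_add, h1, h2]

theorem comul_t (a : A) : H.comul (H.t (op a)) = H.outer.tmul H.outer 1 (H.t (op a)) := by
  rw [← mul_one (H.t (op a)), comul_t_mul, H.comul_one]
  rfl

theorem comul_s (a : A) : H.comul (H.s a) = H.outer.tmul H.outer (H.s a) 1 := by
  rw [← mul_one (H.s a), comul_s_mul, H.comul_one]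
  rfl

/-- `t(a) u₊ ⊗ u₋ = u₊ ⊗ u₋ t(a)`. -/
theorem leftTrans_takeuchi (h : H.IsLeftHopf) (a : A) (u : U) :
    leftSandwich (H.t (op a)) 1 (leftTrans h u) = leftSandwich 1 (H.t (op a)) (leftTrans h u) := by
  refine h.1 ?_
  rw [leftGalois_leftSandwich, leftGalois_leftSandwich, leftGalois_leftTrans]
  change H.outerMulRight 1 1 (H.outerMulRight u 1 (H.comul _)) =
    H.outerMulRight 1 _ (H.outerMulRight u 1 (H.comul 1))
  rw [comul_t, H.comul_one]
  simp

/-- `s(a) u₊ ⊗ u₋ = u₊ ⊗ u₋ s(a)`. -/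
theorem rightTrans_takeuchi (h : H.IsRightHopf) (a : A) (u : U) :
    rightSandwich (H.s a) 1 (rightTrans h u) = rightSandwich 1 (H.s a) (rightTrans h u) := by
  refine h.1 ?_
  rw [rightGalois_rightSandwich, rightGalois_rightSandwich, rightGalois_rightTrans]
  change H.outerMulRight 1 1 (H.outerMulRight 1 u (H.comul _)) =
    H.outerMulRight _ 1 (H.outerMulRight 1 u (H.comul 1))
  rw [comul_s, H.comul_one]
  simp

/-- `u₊ v₊ ⊗ v₋ u₋`, as a linear map in `u₊ ⊗ u₋`. -/
noncomputable def leftTransMul (h : H.IsLeftHopf) (v : U) :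
    H.LeftGaloisTensor →ₗ[k] H.LeftGaloisTensor :=
  BalTensor.lift
    (LinearMap.mk₂ k (fun x y => leftSandwich x y (leftTrans h v))
      (fun x x' y => by
        induction leftTrans h v using BalTensor.induction with
        | h0 => simp
        | ht p q => simp [leftSandwich_tmul, add_mul, BalTensor.add_tmul]
        | ha Y Z h1 h2 => simp only [map_add, h1, h2]; abel)
      (fun c x y => by
        induction leftTrans h v using BalTensor.induction with
        | h0 => simp
        | ht p q => simp [leftSandwich_tmul, BalTensor.smul_tmul]
        | ha Y Z h1 h2 => simp only [map_add, h1, h2, smul_add])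
      (fun x y y' => by
        induction leftTrans h v using BalTensor.induction with
        | h0 => simp
        | ht p q => simp [leftSandwich_tmul, mul_add, BalTensor.tmul_add]
        | ha Y Z h1 h2 => simp only [map_add, h1, h2]; abel)
      (fun c x y => by
        induction leftTrans h v using BalTensor.induction with
        | h0 => simp
        | ht p q => simp [leftSandwich_tmul, BalTensor.tmul_smul]
        | ha Y Z h1 h2 => simp only [map_add, h1, h2, smul_add]))
    (fun a x y => by
      have h1 := congrArg (leftSandwich x y) (leftTrans_takeuchi h a v)
      have h2 : ∀ (x y x' y' : U) (T : H.LeftGaloisTensor),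
          leftSandwich x y (leftSandwich x' y' T) = leftSandwich (x * x') (y' * y) T := by
        intro x y x' y' T
        induction T using BalTensor.induction with
        | h0 => simp
        | ht p q => simp [leftSandwich_tmul, mul_assoc]
        | ha Y Z h1 h2 => simp only [map_add, h1, h2]
      rw [h2, h2, mul_one, one_mul] at h1
      exact h1)

/-- `u₊ v₊ ⊗ v₋ u₋`, as a linear map in `u₊ ⊗ u₋`. -/
noncomputable def rightTransMul (h : H.IsRightHopf) (v : U) :
    H.RightGaloisTensor →ₗ[k] H.RightGaloisTensor :=
  BalTensor.lift
    (LinearMap.mk₂ k (fun x y => rightSandwich x y (rightTrans h v))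
      (fun x x' y => by
        induction rightTrans h v using BalTensor.induction with
        | h0 => simp
        | ht p q => simp [rightSandwich_tmul, add_mul, BalTensor.add_tmul]
        | ha Y Z h1 h2 => simp only [map_add, h1, h2]; abel)
      (fun c x y => by
        induction rightTrans h v using BalTensor.induction with
        | h0 => simp
        | ht p q => simp [rightSandwich_tmul, BalTensor.smul_tmul]
        | ha Y Z h1 h2 => simp only [map_add, h1, h2, smul_add])
      (fun x y y' => by
        induction rightTrans h v using BalTensor.induction with
        | h0 => simp
        | ht p q => simp [rightSandwich_tmul, mul_add, BalTensor.tmul_add]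
        | ha Y Z h1 h2 => simp only [map_add, h1, h2]; abel)
      (fun c x y => by
        induction rightTrans h v using BalTensor.induction with
        | h0 => simp
        | ht p q => simp [rightSandwich_tmul, BalTensor.tmul_smul]
        | ha Y Z h1 h2 => simp only [map_add, h1, h2, smul_add]))
    (fun a x y => by
      have h1 := congrArg (rightSandwich x y) (rightTrans_takeuchi h a v)
      have h2 : ∀ (x y x' y' : U) (T : H.RightGaloisTensor),
          rightSandwich x y (rightSandwich x' y' T) = rightSandwich (x * x') (y' * y) T := by
        intro x y x' y' T
        induction T using BalTensor.induction with
        | h0 => simp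
        | ht p q => simp [rightSandwich_tmul, mul_assoc]
        | ha Y Z h1 h2 => simp only [map_add, h1, h2]
      rw [h2, h2, mul_one, one_mul] at h1
      exact h1)

/-- `(u v)₊ ⊗ (u v)₋ = u₊ v₊ ⊗ v₋ u₋`. -/
theorem leftTrans_mul (h : H.IsLeftHopf) (u v : U) :
    leftTrans h (u * v) = leftTransMul h v (leftTrans h u) := by
  refine h.1 ?_
  have key : ∀ T : H.LeftGaloisTensor,
      H.leftGalois (leftTransMul h v T) = H.outerMulRight v 1 (H.leftGalois T) := by
    intro T
    induction T using BalTensor.induction with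
    | h0 => simp
    | ht x y =>
      refine (leftGalois_leftSandwich x y (leftTrans h v)).trans ?_
      rw [leftGalois_leftTrans, leftGalois_tmul]
      change H.outerMulRight 1 y (H.outerMulRight v 1 (H.comul x)) = _
      rw [AeRing.outerMulRight_comp, AeRing.outerMulRight_comp, one_mul, one_mul, mul_one, mul_one]
    | ha Y Z h1 h2 => simp only [map_add, h1, h2]
  rw [key, leftGalois_leftTrans, leftGalois_leftTrans]
  simp

/-- `(u v)₊ ⊗ (u v)₋ = u₊ v₊ ⊗ v₋ u₋`. -/
theorem rightTrans_mul (h : H.IsRightHopf) (u v : U) :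
    rightTrans h (u * v) = rightTransMul h v (rightTrans h u) := by
  refine h.1 ?_
  have key : ∀ T : H.RightGaloisTensor,
      H.rightGalois (rightTransMul h v T) = H.outerMulRight 1 v (H.rightGalois T) := by
    intro T
    induction T using BalTensor.induction with
    | h0 => simp
    | ht x y =>
      refine (rightGalois_rightSandwich x y (rightTrans h v)).trans ?_
      rw [rightGalois_rightTrans, rightGalois_tmul]
      change H.outerMulRight y 1 (H.outerMulRight 1 v (H.comul x)) = _
      rw [AeRing.outerMulRight_comp, AeRing.outerMulRight_comp, one_mul, one_mul, mul_one, mul_one]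
    | ha Y Z h1 h2 => simp only [map_add, h1, h2]
  rw [key, rightGalois_rightTrans, rightGalois_rightTrans]
  simp

theorem leftTrans_one (h : H.IsLeftHopf) : leftTrans h 1 = BalTensor.tmul _ _ 1 1 := by
  refine h.1 ?_
  rw [leftGalois_leftTrans, leftGalois_tmul, H.comul_one]
  simp

theorem rightTrans_one (h : H.IsRightHopf) : rightTrans h 1 = BalTensor.tmul _ _ 1 1 := by
  refine h.1 ?_
  rw [rightGalois_rightTrans, rightGalois_tmul, H.comul_one]
  simp

theorem leftTrans_add (h : H.IsLeftHopf) (u v : U) :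
    leftTrans h (u + v) = leftTrans h u + leftTrans h v := by
  rw [leftTrans, Bimod.tmul, BalTensor.add_tmul, map_add]
  rfl

theorem rightTrans_add (h : H.IsRightHopf) (u v : U) :
    rightTrans h (u + v) = rightTrans h u + rightTrans h v := by
  rw [rightTrans, Bimod.tmul, BalTensor.tmul_add, map_add]
  rfl

theorem leftHopfEval_add (φ φ' : H.RightDual) (T : H.LeftGaloisTensor) :
    leftHopfEval (φ + φ') T = leftHopfEval φ T + leftHopfEval φ' T := by
  induction T using BalTensor.induction with
  | h0 => simp
  | ht x y => simp [leftHopfEval_tmul, mul_add]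
  | ha Y Z h1 h2 => simp only [map_add, h1, h2]; abel

theorem leftHopfEval_smul (c : k) (φ : H.RightDual) (T : H.LeftGaloisTensor) :
    leftHopfEval (c • φ) T = c • leftHopfEval φ T := by
  induction T using BalTensor.induction with
  | h0 => simp
  | ht x y => simp [leftHopfEval_tmul]
  | ha Y Z h1 h2 => simp only [map_add, h1, h2, smul_add]

theorem rightHopfEval_add (ψ ψ' : H.LeftDual) (T : H.RightGaloisTensor) :
    rightHopfEval (ψ + ψ') T = rightHopfEval ψ T + rightHopfEval ψ' T := by
  induction T using BalTensor.induction with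
  | h0 => simp
  | ht x y => simp [rightHopfEval_tmul, mul_add]
  | ha Y Z h1 h2 => simp only [map_add, h1, h2]; abel

theorem rightHopfEval_smul (c : k) (ψ : H.LeftDual) (T : H.RightGaloisTensor) :
    rightHopfEval (c • ψ) T = c • rightHopfEval ψ T := by
  induction T using BalTensor.induction with
  | h0 => simp
  | ht x y => simp [rightHopfEval_tmul]
  | ha Y Z h1 h2 => simp only [map_add, h1, h2, smul_add]

/-- The left action of `U` on the right dual of a left Hopf algebroid,
`(u φ)(m) = ε(u₊ t(φ(u₋ m)))`. -/
noncomputable def hopfRightDualAct (h : H.IsLeftHopf) (u : U) (φ : H.RightDual) : H.RightDual :=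
  RightDual.mk
    { toFun := fun m => leftHopfEval (rightDualAct m φ) (leftTrans h u)
      map_add' := fun m m' => by
        rw [← leftHopfEval_add]
        congr 1
        exact congrArg _ (RightDual.ext fun x => by simp [mul_add])
      map_smul' := fun c m => by
        rw [RingHom.id_apply, ← leftHopfEval_smul]
        congr 1
        exact congrArg _ (RightDual.ext fun x => by simp) }
    (fun a m => by
      have h1 : ∀ T : H.LeftGaloisTensor, leftHopfEval (rightDualAct (H.t (op a) * m) φ) T =
          leftHopfEval (rightDualAct m φ) (leftSandwich 1 (H.t (op a)) T) := by
        intro T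
        induction T using BalTensor.induction with
        | h0 => simp
        | ht x y => simp [leftHopfEval_tmul, leftSandwich_tmul, mul_assoc]
        | ha Y Z h1 h2 => simp only [map_add, h1, h2]
      have h2 : ∀ T : H.LeftGaloisTensor,
          leftHopfEval (rightDualAct m φ) (leftSandwich (H.t (op a)) 1 T) =
            leftHopfEval (rightDualAct m φ) T * a := by
        intro T
        induction T using BalTensor.induction with
        | h0 => simp
        | ht x y => simp [leftHopfEval_tmul, leftSandwich_tmul, mul_assoc, eps_t_mul]
        | ha Y Z h1 h2 => simp only [map_add, h1, h2, add_mul]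
      change leftHopfEval (rightDualAct (H.t (op a) * m) φ) (leftTrans h u) =
        leftHopfEval (rightDualAct m φ) (leftTrans h u) * a
      rw [h1, ← leftTrans_takeuchi, h2])

/-- The left action of `U` on the left dual of a right Hopf algebroid,
`(u ψ)(m) = ε(u₍₊₎ s(ψ(u₍₋₎ m)))`. -/
noncomputable def hopfLeftDualAct (h : H.IsRightHopf) (u : U) (ψ : H.LeftDual) : H.LeftDual :=
  LeftDual.mk
    { toFun := fun m => rightHopfEval (leftDualAct m ψ) (rightTrans h u)
      map_add' := fun m m' => by
        rw [← rightHopfEval_add]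
        congr 1
        exact congrArg _ (LeftDual.ext fun x => by simp [mul_add])
      map_smul' := fun c m => by
        rw [RingHom.id_apply, ← rightHopfEval_smul]
        congr 1
        exact congrArg _ (LeftDual.ext fun x => by simp) }
    (fun a m => by
      have h1 : ∀ T : H.RightGaloisTensor, rightHopfEval (leftDualAct (H.s a * m) ψ) T =
          rightHopfEval (leftDualAct m ψ) (rightSandwich 1 (H.s a) T) := by
        intro T
        induction T using BalTensor.induction with
        | h0 => simp
        | ht x y => simp [rightHopfEval_tmul, rightSandwich_tmul, mul_assoc]
        | ha Y Z h1 h2 => simp only [map_add, h1, h2]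
      have h2 : ∀ T : H.RightGaloisTensor,
          rightHopfEval (leftDualAct m ψ) (rightSandwich (H.s a) 1 T) =
            a * rightHopfEval (leftDualAct m ψ) T := by
        intro T
        induction T using BalTensor.induction with
        | h0 => simp
        | ht x y => simp [rightHopfEval_tmul, rightSandwich_tmul, mul_assoc, eps_s_mul]
        | ha Y Z h1 h2 => simp only [map_add, h1, h2, mul_add]
      change rightHopfEval (leftDualAct (H.s a * m) ψ) (rightTrans h u) =
        a * rightHopfEval (leftDualAct m ψ) (rightTrans h u)
      rw [h1, ← rightTrans_takeuchi, h2])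

theorem hopfRightDualAct_apply (h : H.IsLeftHopf) (u : U) (φ : H.RightDual) (m : U) :
    hopfRightDualAct h u φ m = leftHopfEval (rightDualAct m φ) (leftTrans h u) := rfl

theorem hopfLeftDualAct_apply (h : H.IsRightHopf) (u : U) (ψ : H.LeftDual) (m : U) :
    hopfLeftDualAct h u ψ m = rightHopfEval (leftDualAct m ψ) (rightTrans h u) := rfl

/-- The left `U`-module structure `(u φ)(m) = ε(u₊ t(φ(u₋ m)))` on the right dual of a left Hopf
algebroid. -/
noncomputable abbrev hopfRightDualModule (h : H.IsLeftHopf) : Module U H.RightDual where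
  smul u φ := hopfRightDualAct h u φ
  one_smul φ := RightDual.ext fun m => by
    change hopfRightDualAct h 1 φ m = φ m
    rw [hopfRightDualAct_apply, leftTrans_one, leftHopfEval_tmul, one_mul, rightDualAct_apply,
      one_mul, ← mul_one (H.t _), eps_t_mul, H.counit_one, one_mul]
  mul_smul u v φ := RightDual.ext fun m => by
    change hopfRightDualAct h (u * v) φ m = hopfRightDualAct h u (hopfRightDualAct h v φ) m
    rw [hopfRightDualAct_apply, hopfRightDualAct_apply, leftTrans_mul]
    generalize leftTrans h u = T
    induction T using BalTensor.induction with
    | h0 => simp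
    | ht x y =>
      change leftHopfEval (rightDualAct m φ) (leftSandwich x y (leftTrans h v)) =
        H.eps (x * H.t (op (leftHopfEval (rightDualAct (y * m) φ) (leftTrans h v))))
      generalize leftTrans h v = T
      induction T using BalTensor.induction with
      | h0 => simp
      | ht p q =>
        rw [leftSandwich_tmul, leftHopfEval_tmul, leftHopfEval_tmul, mul_assoc, H.counit_mul_t,
          rightDualAct_apply, rightDualAct_apply, mul_assoc]
      | ha Y Z h1 h2 => simp only [map_add, h1, h2, mul_add, op_add]
    | ha Y Z h1 h2 => simp only [map_add, h1, h2]
  smul_zero u := RightDual.ext fun m => by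
    change leftHopfEval (rightDualAct m 0) (leftTrans h u) = 0
    have h1 := leftHopfEval_smul (0 : k) (rightDualAct m (0 : H.RightDual)) (leftTrans h u)
    rwa [zero_smul, zero_smul, ← map_zero (rightDualAct m)] at h1
  smul_add u φ φ' := RightDual.ext fun m => by
    change leftHopfEval (rightDualAct m (φ + φ')) (leftTrans h u) =
      leftHopfEval (rightDualAct m φ) (leftTrans h u) +
        leftHopfEval (rightDualAct m φ') (leftTrans h u)
    rw [map_add, leftHopfEval_add]
  add_smul u v φ := RightDual.ext fun m => by
    change leftHopfEval (rightDualAct m φ) (leftTrans h (u + v)) =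
      leftHopfEval (rightDualAct m φ) (leftTrans h u) +
        leftHopfEval (rightDualAct m φ) (leftTrans h v)
    rw [leftTrans_add, map_add]
  zero_smul φ := RightDual.ext fun m => by
    change leftHopfEval (rightDualAct m φ) (leftTrans h 0) = 0
    rw [leftTrans, Bimod.tmul, BalTensor.zero_tmul, map_zero, map_zero]

/-- The left `U`-module structure `(u ψ)(m) = ε(u₍₊₎ s(ψ(u₍₋₎ m)))` on the left dual of a right Hopf
algebroid. -/
noncomputable abbrev hopfLeftDualModule (h : H.IsRightHopf) : Module U H.LeftDual where
  smul u ψ := hopfLeftDualAct h u ψ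
  one_smul ψ := LeftDual.ext fun m => by
    change hopfLeftDualAct h 1 ψ m = ψ m
    rw [hopfLeftDualAct_apply, rightTrans_one, rightHopfEval_tmul, one_mul, leftDualAct_apply,
      one_mul, ← mul_one (H.s _), eps_s_mul, H.counit_one, mul_one]
  mul_smul u v ψ := LeftDual.ext fun m => by
    change hopfLeftDualAct h (u * v) ψ m = hopfLeftDualAct h u (hopfLeftDualAct h v ψ) m
    rw [hopfLeftDualAct_apply, hopfLeftDualAct_apply, rightTrans_mul]
    generalize rightTrans h u = T
    induction T using BalTensor.induction with
    | h0 => simp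
    | ht x y =>
      change rightHopfEval (leftDualAct m ψ) (rightSandwich x y (rightTrans h v)) =
        H.eps (x * H.s (rightHopfEval (leftDualAct (y * m) ψ) (rightTrans h v)))
      generalize rightTrans h v = T
      induction T using BalTensor.induction with
      | h0 => simp
      | ht p q =>
        rw [rightSandwich_tmul, rightHopfEval_tmul, rightHopfEval_tmul, mul_assoc, H.counit_mul_s,
          leftDualAct_apply, leftDualAct_apply, mul_assoc]
      | ha Y Z h1 h2 => simp only [map_add, h1, h2, mul_add]
    | ha Y Z h1 h2 => simp only [map_add, h1, h2]
  smul_zero u := LeftDual.ext fun m => by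
    change rightHopfEval (leftDualAct m 0) (rightTrans h u) = 0
    have h1 := rightHopfEval_smul (0 : k) (leftDualAct m (0 : H.LeftDual)) (rightTrans h u)
    rwa [zero_smul, zero_smul, ← map_zero (leftDualAct m)] at h1
  smul_add u ψ ψ' := LeftDual.ext fun m => by
    change rightHopfEval (leftDualAct m (ψ + ψ')) (rightTrans h u) =
      rightHopfEval (leftDualAct m ψ) (rightTrans h u) +
        rightHopfEval (leftDualAct m ψ') (rightTrans h u)
    rw [map_add, rightHopfEval_add]
  add_smul u v ψ := LeftDual.ext fun m => by
    change rightHopfEval (leftDualAct m ψ) (rightTrans h (u + v)) =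
      rightHopfEval (leftDualAct m ψ) (rightTrans h u) +
        rightHopfEval (leftDualAct m ψ) (rightTrans h v)
    rw [rightTrans_add, map_add]
  zero_smul ψ := LeftDual.ext fun m => by
    change rightHopfEval (leftDualAct m ψ) (rightTrans h 0) = 0
    rw [rightTrans, Bimod.tmul, BalTensor.tmul_zero, map_zero, map_zero]

variable (H)

/-- The left `U`-module structure `(v ψ)(u) = ψ(u v)` on the left dual. -/
abbrev mulLeftDualModule : Module U H.LeftDual where
  smul v ψ := leftDualAct v ψ
  one_smul ψ := LeftDual.ext fun u => congrArg (LeftDual.lin ψ) (mul_one u)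
  mul_smul v w ψ := LeftDual.ext fun u => congrArg (LeftDual.lin ψ) (mul_assoc u v w).symm
  smul_zero _ := map_zero _
  smul_add _ ψ ψ' := map_add _ ψ ψ'
  add_smul v w ψ := LeftDual.ext fun u =>
    (congrArg (LeftDual.lin ψ) (mul_add u v w)).trans (map_add _ _ _)
  zero_smul ψ := LeftDual.ext fun u =>
    (congrArg (LeftDual.lin ψ) (mul_zero u)).trans (map_zero _)

/-- The left `U`-module structure `(v φ)(u) = φ(u v)` on the right dual. -/
abbrev mulRightDualModule : Module U H.RightDual where
  smul v φ := rightDualAct v φ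
  one_smul φ := RightDual.ext fun u => congrArg (RightDual.lin φ) (mul_one u)
  mul_smul v w φ := RightDual.ext fun u => congrArg (RightDual.lin φ) (mul_assoc u v w).symm
  smul_zero _ := map_zero _
  smul_add _ φ φ' := map_add _ φ φ'
  add_smul v w φ := RightDual.ext fun u =>
    (congrArg (RightDual.lin φ) (mul_add u v w)).trans (map_add _ _ _)
  zero_smul φ := RightDual.ext fun u =>
    (congrArg (RightDual.lin φ) (mul_zero u)).trans (map_zero _)

end Hopf

end LeftBialgebroid
end Duals
end HopfAlgd

namespace HopfAlgd
namespace LeftBialgebroid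

variable {k A U : Type*} [CommRing k] [Ring A] [Algebra k A] [Ring U] [Algebra k U]
  {H : LeftBialgebroid k A U}

/-! Everything rests on two identities for the translation map, each checked by transporting it
through the Galois bijection. Write y·φ for the functional φ(· y). On the left Hopf side they are
t(S^*(φ)(u₂)) u₁ = u₊ t(φ(u₋)) (`leftOp_sStarUpLin`), (u₊ t(φ(u₋)))₊ ⊗ (u₊ t(φ(u₋)))₋ = u₊ ⊗
s(φ(u₋₁)) u₋₂ (`leftTrans_leftHopfOp`). The product of U_* evaluates the second factor at t(ψ(u₂))
u₁. So the first identity says at which element S^*(φ') is evaluated in S^*(φ) S^*(φ'), and the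
second says what the translation map does to that element. The factor s(φ(u₋₁)) u₋₂ is the argument
that occurs in the product of U^*, and multiplicativity follows at once.

The proofs of the two identities share a pattern. A question about u₊ ⊗ u₋ is replaced by an
equality of linear maps on the whole Galois tensor product, where elementary tensors p ⊗ q suffice.
Composed with α_ℓ, the maps see p₁ ⊗ p₂ q; coassociativity produces an inner Δ, on which α_ℓ⁻¹ is
known because α_ℓ(x ⊗ 1) = Δ(x). Specialising to u₊ ⊗ u₋, where α_ℓ gives u ⊗ 1, yields the claim.
The second identity also uses that Δ(p) lies in the Takeuchi product.

Compatibility with sources comes from u₊ u₋ = s(ε(u)), and hence S^*(1) = 1; compatibility with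
targets is then the first identity at φ = 1. Compatibility with augmentations comes from 1₊ ⊗ 1₋ = 1
⊗ 1. The module statement is the rule (m u)₊ ⊗ (m u)₋ = m₊ u₊ ⊗ u₋ m₋ together with the absorption
of inner factors by ε (`leftHopfEval_sandwich`).

For coproducts, the coproduct of U_* is determined by its pairing with products u v, so it is enough
to prove `sStarUpLin_sum`. There a dual basis of U_◁ is summed out by means of the right A-linearity
in `sStarUpLin_act_t_mul`.

The right Hopf side exchanges s with t and the two tensor legs. The unit is then read off from
targets, and sources use the first identity. -/

/-! ### Counit values, the tensor square, and the regular actions on the duals -/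

theorem eps_s (a : A) : H.eps (H.s a) = a := by
  rw [← mul_one (H.s a), eps_s_mul, H.counit_one, mul_one]

theorem eps_t (a : A) : H.eps (H.t (op a)) = a := by
  rw [← mul_one (H.t (op a)), eps_t_mul, H.counit_one, one_mul]

theorem outerMulRight_l (x y : U) (a : A) (X : H.outer.Tensor H.outer) :
    H.outerMulRight x y ((H.outer.tensor H.outer).l a X) =
      (H.outer.tensor H.outer).l a (H.outerMulRight x y X) := by
  induction X using BalTensor.induction with
  | h0 => simp
  | ht u v => simp [mul_assoc]
  | ha X Y h1 h2 => simp only [map_add, h1, h2]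

theorem outerMulRight_r (x y : U) (b : Aᵐᵒᵖ) (X : H.outer.Tensor H.outer) :
    H.outerMulRight x y ((H.outer.tensor H.outer).r b X) =
      (H.outer.tensor H.outer).r b (H.outerMulRight x y X) := by
  induction X using BalTensor.induction with
  | h0 => simp
  | ht u v => simp [mul_assoc]
  | ha X Y h1 h2 => simp only [map_add, h1, h2]

@[simp]
theorem outerMulRight_one_one (X : H.outer.Tensor H.outer) : H.outerMulRight 1 1 X = X := by
  induction X using BalTensor.induction with
  | h0 => simp
  | ht u v => simp
  | ha X Y h1 h2 => simp only [map_add, h1, h2]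

/-- Serves to expand one coproduct Δ(q) with the same representatives on both sides of an equation.
-/
theorem exists_finset_outer_tmul (X : H.outer.Tensor H.outer) :
    ∃ S : Finset (U × U), X = ∑ i ∈ S, H.outer.tmul H.outer i.1 i.2 := by
  obtain ⟨Y, rfl⟩ := (balRel (fun a : A => H.outer.r (op a))
    (fun a : A => H.outer.l a)).mkQ_surjective X
  obtain ⟨S, rfl⟩ := TensorProduct.exists_finset Y
  exact ⟨S, by rw [map_sum]; rfl⟩

theorem rightDualAct_one (φ : H.RightDual) : rightDualAct 1 φ = φ :=
  RightDual.ext fun u => by simp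

theorem rightDualAct_mul (u v : U) (φ : H.RightDual) :
    rightDualAct (u * v) φ = rightDualAct u (rightDualAct v φ) :=
  RightDual.ext fun w => by simp [mul_assoc]

theorem leftDualAct_one (ψ : H.LeftDual) : leftDualAct 1 ψ = ψ :=
  LeftDual.ext fun u => by simp

theorem leftDualAct_mul (u v : U) (ψ : H.LeftDual) :
    leftDualAct (u * v) ψ = leftDualAct u (leftDualAct v ψ) :=
  LeftDual.ext fun w => by simp [mul_assoc]

/-! The map `S^*` of a left Hopf algebroid. -/

section LeftHopf

/-! ### Linearity of the left translation map and of the evaluation ε(x t(φ(y))) -/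

/-- Since Δ is a bimodule map, α_ℓ is linear for multiplication by s(a) on the left of the first
factor. This and the version for t(a) below pass to α_ℓ⁻¹, which makes maps built from α_ℓ⁻¹ well
defined on balanced tensor products. -/
theorem leftGalois_sandwich_s (a : A) (T : H.LeftGaloisTensor) :
    H.leftGalois (leftSandwich (H.s a) 1 T) = (H.outer.tensor H.outer).l a (H.leftGalois T) := by
  induction T using BalTensor.induction with
  | h0 => simp
  | ht p q =>
    rw [leftSandwich_tmul, leftGalois_tmul, leftGalois_tmul, comul_s_mul, outerMulRight_l, mul_one]
  | ha Y Z h1 h2 => simp only [map_add, h1, h2]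

theorem leftGalois_sandwich_t (a : A) (T : H.LeftGaloisTensor) :
    H.leftGalois (leftSandwich (H.t (op a)) 1 T) =
      (H.outer.tensor H.outer).r (op a) (H.leftGalois T) := by
  induction T using BalTensor.induction with
  | h0 => simp
  | ht p q =>
    rw [leftSandwich_tmul, leftGalois_tmul, leftGalois_tmul, comul_t_mul, outerMulRight_r, mul_one]
  | ha Y Z h1 h2 => simp only [map_add, h1, h2]

theorem leftTrans_s_mul (h : H.IsLeftHopf) (a : A) (u : U) :
    leftTrans h (H.s a * u) = leftSandwich (H.s a) 1 (leftTrans h u) := by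
  refine h.1 ?_
  rw [leftGalois_sandwich_s, leftGalois_leftTrans, leftGalois_leftTrans]
  rfl

/-- The counit only sees the counit of a right-hand factor: ε(x w) = ε(x s(ε(w))) with w = p t(φ(q
y)). As the translation of a product is a sandwich, this expresses S^*(φ)(u v) through values of
S^*(y·φ) at v. -/
theorem leftHopfEval_sandwich (φ : H.RightDual) (x y : U) (T : H.LeftGaloisTensor) :
    leftHopfEval φ (leftSandwich x y T) =
      H.eps (x * H.s (leftHopfEval (rightDualAct y φ) T)) := by
  induction T using BalTensor.induction with
  | h0 => simp
  | ht p q =>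
    rw [leftSandwich_tmul, leftHopfEval_tmul, leftHopfEval_tmul, mul_assoc, H.counit_mul_s]
    rfl
  | ha Y Z h1 h2 => simp only [map_add, h1, h2, mul_add]

theorem leftHopfEval_sandwich_s (φ : H.RightDual) (a : A) (T : H.LeftGaloisTensor) :
    leftHopfEval φ (leftSandwich (H.s a) 1 T) = a * leftHopfEval φ T := by
  rw [leftHopfEval_sandwich, ← map_mul, eps_s, rightDualAct_one]

/-- The map `S^* : U^* → U_*` as a linear map. -/
noncomputable def sStarUpLin (h : H.IsLeftHopf) : H.RightDual →ₗ[k] H.LeftDual where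
  toFun φ := LeftDual.mk
    { toFun := sStarUp h φ
      map_add' := fun u v => by rw [sStarUp, leftTrans_add, map_add]; rfl
      map_smul' := fun c u => by
        rw [sStarUp, leftTrans, Bimod.tmul, BalTensor.smul_tmul, map_smul, map_smul]; rfl }
    (fun a u => by
      change leftHopfEval φ (leftTrans h (H.s a * u)) = a * leftHopfEval φ (leftTrans h u)
      rw [leftTrans_s_mul, leftHopfEval_sandwich_s])
  map_add' φ φ' := LeftDual.ext fun u => leftHopfEval_add φ φ' _
  map_smul' c φ := LeftDual.ext fun u => leftHopfEval_smul c φ _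

theorem sStarUpLin_apply (h : H.IsLeftHopf) (φ : H.RightDual) (u : U) :
    sStarUpLin h φ u = leftHopfEval φ (leftTrans h u) := rfl

/-- For `φ` in the right dual, the map `x ⊗ y ↦ x t(φ(y))`. -/
def leftHopfOp (φ : H.RightDual) : H.LeftGaloisTensor →ₗ[k] U :=
  BalTensor.lift ((LinearMap.mul k U).compl₂
      (H.t.toLinearMap ∘ₗ (opLinearEquiv k).toLinearMap ∘ₗ RightDual.lin φ))
    (fun a x y => by simp [mul_assoc])

theorem leftHopfOp_tmul (φ : H.RightDual) (x y : U) :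
    leftHopfOp φ (BalTensor.tmul _ _ x y) = x * H.t (op (φ y)) := rfl

/-- Lets scalars be moved before ε is applied, where they are still multiplications in U. -/
theorem eps_leftHopfOp (φ : H.RightDual) (T : H.LeftGaloisTensor) :
    H.eps (leftHopfOp φ T) = leftHopfEval φ T := by
  induction T using BalTensor.induction with
  | h0 => simp
  | ht p q => rfl
  | ha Y Z h1 h2 => simp only [map_add, h1, h2]

/-! ### The inverse of the left Galois map -/

/-- The map `u ⊗ v ↦ u₊ ⊗ u₋ v`. -/
noncomputable def leftGaloisInv (h : H.IsLeftHopf) :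
    H.outer.Tensor H.outer →ₗ[k] H.LeftGaloisTensor :=
  (LinearEquiv.ofBijective H.leftGalois h).symm.toLinearMap

theorem leftGaloisInv_leftGalois (h : H.IsLeftHopf) (T : H.LeftGaloisTensor) :
    leftGaloisInv h (H.leftGalois T) = T :=
  (LinearEquiv.ofBijective H.leftGalois h).symm_apply_apply T

theorem leftGalois_leftGaloisInv (h : H.IsLeftHopf) (X : H.outer.Tensor H.outer) :
    H.leftGalois (leftGaloisInv h X) = X :=
  (LinearEquiv.ofBijective H.leftGalois h).apply_symm_apply X

/-- This is α_ℓ⁻¹ ∘ α_ℓ = id on elementary tensors. For q = 1 it reads p₁₊ ⊗ p₁₋ p₂ = p ⊗ 1, the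
form used after coassociativity. -/
theorem leftGaloisInv_comul (h : H.IsLeftHopf) (p q : U) :
    leftGaloisInv h (H.outerMulRight 1 q (H.comul p)) = BalTensor.tmul _ _ p q := by
  rw [← leftGalois_tmul, leftGaloisInv_leftGalois]

theorem leftGaloisInv_tmul_one (h : H.IsLeftHopf) (u : U) :
    leftGaloisInv h (H.outer.tmul H.outer u 1) = leftTrans h u := rfl

/-- The map α_ℓ is right U-linear in the last factor. Hence so is its inverse, which is therefore
determined by the translation map, as `leftGaloisInv_tmul` records. -/
theorem leftGalois_sandwich_one (y : U) (T : H.LeftGaloisTensor) :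
    H.leftGalois (leftSandwich 1 y T) = H.outerMulRight 1 y (H.leftGalois T) := by
  induction T using BalTensor.induction with
  | h0 => simp
  | ht p q =>
    rw [leftSandwich_tmul, leftGalois_tmul, leftGalois_tmul, AeRing.outerMulRight_comp]
    simp
  | ha Y Z h1 h2 => simp only [map_add, h1, h2]

theorem leftGaloisInv_outerMulRight (h : H.IsLeftHopf) (y : U) (X : H.outer.Tensor H.outer) :
    leftGaloisInv h (H.outerMulRight 1 y X) = leftSandwich 1 y (leftGaloisInv h X) := by
  refine h.1 ?_
  rw [leftGalois_sandwich_one, leftGalois_leftGaloisInv, leftGalois_leftGaloisInv]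

theorem leftGaloisInv_tmul (h : H.IsLeftHopf) (u v : U) :
    leftGaloisInv h (H.outer.tmul H.outer u v) = leftSandwich 1 v (leftTrans h u) := by
  rw [← leftGaloisInv_tmul_one, ← leftGaloisInv_outerMulRight]
  simp

theorem leftGaloisInv_l (h : H.IsLeftHopf) (a : A) (X : H.outer.Tensor H.outer) :
    leftGaloisInv h ((H.outer.tensor H.outer).l a X) =
      leftSandwich (H.s a) 1 (leftGaloisInv h X) := by
  refine h.1 ?_
  rw [leftGalois_sandwich_s, leftGalois_leftGaloisInv, leftGalois_leftGaloisInv]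

theorem leftGaloisInv_r (h : H.IsLeftHopf) (a : A) (X : H.outer.Tensor H.outer) :
    leftGaloisInv h ((H.outer.tensor H.outer).r (op a) X) =
      leftSandwich (H.t (op a)) 1 (leftGaloisInv h X) := by
  refine h.1 ?_
  rw [leftGalois_sandwich_t, leftGalois_leftGaloisInv, leftGalois_leftGaloisInv]

theorem leftHopfEval_sandwich_one (φ : H.RightDual) (y : U) (T : H.LeftGaloisTensor) :
    leftHopfEval φ (leftSandwich 1 y T) = leftHopfEval (rightDualAct y φ) T := by
  rw [leftHopfEval_sandwich, one_mul, eps_s]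

theorem leftHopfOp_sandwich (φ : H.RightDual) (x y : U) (T : H.LeftGaloisTensor) :
    leftHopfOp φ (leftSandwich x y T) = x * leftHopfOp (rightDualAct y φ) T := by
  induction T using BalTensor.induction with
  | h0 => simp
  | ht p q => rw [leftSandwich_tmul, leftHopfOp_tmul, leftHopfOp_tmul, mul_assoc]; rfl
  | ha Y Z h1 h2 => simp only [map_add, h1, h2, mul_add]

/-- `t(S^*(φ)(u₂)) u₁ = u₊ t(φ(u₋))`. -/
theorem leftOp_sStarUpLin (h : H.IsLeftHopf) (φ : H.RightDual) (u : U) :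
    H.leftOp (sStarUpLin h φ) u = leftHopfOp φ (leftTrans h u) := by
  -- The functional x ⊗ y ↦ ε(x₊ t(φ(x₋ y))) is left A-linear, as `leftEv` requires.
  have hg : ∀ (φ : H.RightDual) (a : A) (X : H.outer.Tensor H.outer),
      (leftHopfEval φ ∘ₗ leftGaloisInv h) ((H.outer.tensor H.outer).l a X) =
        a * (leftHopfEval φ ∘ₗ leftGaloisInv h) X := fun φ a X => by
    rw [LinearMap.comp_apply, leftGaloisInv_l, leftHopfEval_sandwich_s]; rfl
  -- K φ sends u ⊗ v to t(ε(u₂₊ t(φ(u₂₋ v)))) u₁. At v = 1 this is the left-hand side of the claim;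
  -- the aim is that K φ ∘ α_ℓ is x ⊗ y ↦ x t(φ(y)).
  let K : H.RightDual → H.outer.Tensor H.outer →ₗ[k] U := fun φ =>
    H.leftEv (H.outer.tensor H.outer) _ (hg φ) ∘ₗ Bimod.assoc H.outer H.outer H.outer ∘ₗ
      BalTensor.map (ρ' := fun a => (H.outer.tensor H.outer).r (op a))
        (l' := fun a => H.outer.l a) id H.coring.comul LinearMap.id
        (fun a c => H.coring.comul_r (op a) c) (fun _ _ => rfl)
  have hK : ∀ φ u v, K φ (H.outer.tmul H.outer u v) =
      H.leftOp (sStarUpLin h (rightDualAct v φ)) u := by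
    intro φ u v
    change H.leftEv (H.outer.tensor H.outer) _ (hg φ) (Bimod.assoc H.outer H.outer H.outer
        ((H.outer.tensor H.outer).tmul H.outer (H.comul u) v)) = _
    rw [leftOp_apply]
    generalize H.comul u = Y
    induction Y using BalTensor.induction with
    | h0 => simp
    | ht x y =>
      rw [Bimod.assoc_tmul, leftEv_tmul, leftEv_tmul, LinearMap.comp_apply, leftGaloisInv_tmul,
        leftHopfEval_sandwich_one]
      rfl
    | ha Y Z h1 h2 =>
      simp only [Bimod.tmul, BalTensor.add_tmul, map_add] at h1 h2 ⊢
      rw [h1, h2]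
  have hmul : ∀ (φ : H.RightDual) (q : U) (X : H.outer.Tensor H.outer),
      K φ (H.outerMulRight 1 q X) = K (rightDualAct q φ) X := by
    intro φ q X
    induction X using BalTensor.induction with
    | h0 => simp
    | ht x y =>
      rw [AeRing.outerMulRight_tmul, hK, hK, mul_one]
      rw [rightDualAct_mul]
    | ha Y Z h1 h2 => simp only [map_add, h1, h2]
  -- Coassociativity turns Δ(p₁) ⊗ p₂ into p₁ ⊗ Δ(p₂), and α_ℓ⁻¹(Δ(p₂)) = p₂ ⊗ 1. What remains is
  -- t(ε(p₂ t(φ(1)))) p₁, which `leftOp_leftDualT` evaluates.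
  have hcomul : ∀ (φ : H.RightDual) (p : U), K φ (H.comul p) = p * H.t (op (φ 1)) := by
    intro φ p
    refine (congrArg (H.leftEv (H.outer.tensor H.outer) _ (hg φ)) (H.coring.coassoc p)).trans ?_
    rw [← leftOp_leftDualT, leftOp_apply]
    change H.leftEv (H.outer.tensor H.outer) _ (hg φ) (BalTensor.map _ _ _ _ _ (H.comul p)) = _
    generalize H.comul p = X
    induction X using BalTensor.induction with
    | h0 => simp
    | ht x y =>
      rw [BalTensor.map_tmul, leftEv_tmul, leftEv_tmul, LinearMap.comp_apply]
      have h1 := leftGaloisInv_comul h y 1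
      rw [outerMulRight_one_one] at h1
      change H.t (op (leftHopfEval φ (leftGaloisInv h (H.comul y)))) * _ = _
      rw [h1]
      rfl
    | ha Y Z h1 h2 => simp only [map_add, h1, h2]
  -- On p ⊗ q, α_ℓ gives p₁ ⊗ p₂ q; the factor q moves into the functional as q·φ, whose value at 1
  -- is φ(q).
  have hT : ∀ T : H.LeftGaloisTensor, K φ (H.leftGalois T) = leftHopfOp φ T := by
    intro T
    induction T using BalTensor.induction with
    | h0 => simp
    | ht p q =>
      rw [leftGalois_tmul, hmul, hcomul, leftHopfOp_tmul, rightDualAct_apply, one_mul]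
    | ha Y Z h1 h2 => simp only [map_add, h1, h2]
  have h1 := hT (leftTrans h u)
  rw [leftGalois_leftTrans, hK] at h1
  rw [← h1, rightDualAct_one]

/-- For a right `A`-linear map `f` and fixed `u`, the map `v ⊗ w ↦ f(u ⊗ v) ⊗ w`. -/
def evLeftAux (f : H.outer.Tensor H.outer →ₗ[k] U)
    (hf : ∀ a X, f ((H.outer.tensor H.outer).r (op a) X) = H.t (op a) * f X) (u : U) :
    H.outer.Tensor H.outer →ₗ[k] H.outer.Tensor H.outer :=
  BalTensor.map id (f ∘ₗ BalTensor.mk _ _ u) LinearMap.id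
    (fun a v => hf a (H.outer.tmul H.outer u v)) (fun _ _ => rfl)

@[simp]
theorem evLeftAux_tmul (f : H.outer.Tensor H.outer →ₗ[k] U)
    (hf : ∀ a X, f ((H.outer.tensor H.outer).r (op a) X) = H.t (op a) * f X) (u v w : U) :
    evLeftAux f hf u (H.outer.tmul H.outer v w) =
      H.outer.tmul H.outer (f (H.outer.tmul H.outer u v)) w := rfl

/-- For a right `A`-linear map `f`, the map `u ⊗ (v ⊗ w) ↦ f(u ⊗ v) ⊗ w`. -/
def evLeft (f : H.outer.Tensor H.outer →ₗ[k] U)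
    (hf : ∀ a X, f ((H.outer.tensor H.outer).r (op a) X) = H.t (op a) * f X) :
    H.outer.Tensor (H.outer.tensor H.outer) →ₗ[k] H.outer.Tensor H.outer :=
  BalTensor.lift
    { toFun := evLeftAux f hf
      map_add' := fun u u' => BalTensor.hom_ext fun v w => by simp [BalTensor.add_tmul]
      map_smul' := fun c u => BalTensor.hom_ext fun v w => by simp [BalTensor.smul_tmul] }
    (fun a u X => by
      induction X using BalTensor.induction with
      | h0 => simp
      | ht v w =>
        change H.outer.tmul H.outer (f (H.outer.tmul H.outer (H.outer.r (op a) u) v)) w =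
          H.outer.tmul H.outer (f (H.outer.tmul H.outer u (H.outer.l a v))) w
        rw [Bimod.tmul, Bimod.tmul, Bimod.tmul,
          BalTensor.tmul_balanced (ρ := fun a : A => H.outer.r (op a))]
      | ha X Y h1 h2 => simp only [map_add, h1, h2])

theorem evLeft_tmul (f : H.outer.Tensor H.outer →ₗ[k] U)
    (hf : ∀ a X, f ((H.outer.tensor H.outer).r (op a) X) = H.t (op a) * f X) (u v w : U) :
    evLeft f hf (H.outer.tmul (H.outer.tensor H.outer) u (H.outer.tmul H.outer v w)) =
      H.outer.tmul H.outer (f (H.outer.tmul H.outer u v)) w := rfl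

/-- Allows f to act on the first two legs as a block, without splitting X into elementary tensors; X
will be a coproduct. -/
theorem evLeft_assoc (f : H.outer.Tensor H.outer →ₗ[k] U)
    (hf : ∀ a X, f ((H.outer.tensor H.outer).r (op a) X) = H.t (op a) * f X)
    (X : H.outer.Tensor H.outer) (w : U) :
    evLeft f hf (Bimod.assoc H.outer H.outer H.outer ((H.outer.tensor H.outer).tmul H.outer X w)) =
      H.outer.tmul H.outer (f X) w := by
  induction X using BalTensor.induction with
  | h0 => simp
  | ht u v => rfl
  | ha X Y h1 h2 =>
    simp only [Bimod.tmul, BalTensor.add_tmul, map_add] at h1 h2 ⊢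
    rw [h1, h2]

/-- Multiplication by t(a) passes through α_ℓ⁻¹ as left multiplication on the first factor, and from
there out of x t(φ(y)). This is the linearity that `evLeft` needs. -/
theorem leftHopfOp_leftGaloisInv_r (h : H.IsLeftHopf) (φ : H.RightDual) (a : A)
    (X : H.outer.Tensor H.outer) :
    (leftHopfOp φ ∘ₗ leftGaloisInv h) ((H.outer.tensor H.outer).r (op a) X) =
      H.t (op a) * (leftHopfOp φ ∘ₗ leftGaloisInv h) X := by
  rw [LinearMap.comp_apply, leftGaloisInv_r, leftHopfOp_sandwich, rightDualAct_one]
  rfl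

/-- The map `x ⊗ y ↦ x ⊗ s(φ(y₁)) y₂`. -/
def leftGaloisRightOp (φ : H.RightDual) : H.LeftGaloisTensor →ₗ[k] H.LeftGaloisTensor :=
  BalTensor.map id LinearMap.id (H.rightOp φ) (fun _ _ => rfl) (fun a v => H.rightOp_t_mul φ a v)

theorem leftGaloisRightOp_tmul (φ : H.RightDual) (x y : U) :
    leftGaloisRightOp φ (BalTensor.tmul _ _ x y) = BalTensor.tmul _ _ x (H.rightOp φ y) := rfl

/-- `u₊ ⊗ s(φ(u₋₁)) u₋₂` is the translation of `u₊ t(φ(u₋))`. -/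
theorem leftTrans_leftHopfOp (h : H.IsLeftHopf) (φ : H.RightDual) (u : U) :
    leftTrans h (leftHopfOp φ (leftTrans h u)) =
      leftGaloisRightOp φ (leftTrans h u) := by
  -- N φ sends u ⊗ v ⊗ w to u₊ t(φ(u₋ v)) ⊗ w, and D below is id ⊗ Δ. Both sides of the claim will
  -- be compared after α_ℓ as values on u₊ ⊗ u₋ of the single map N φ ∘ D ∘ α_ℓ.
  let N : H.RightDual → H.outer.Tensor (H.outer.tensor H.outer) →ₗ[k] H.outer.Tensor H.outer :=
    fun φ => evLeft _ (leftHopfOp_leftGaloisInv_r h φ)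
  let D : H.outer.Tensor H.outer →ₗ[k] H.outer.Tensor (H.outer.tensor H.outer) :=
    BalTensor.map (ρ' := fun a => H.outer.r (op a)) (l' := fun a => (H.outer.tensor H.outer).l a)
      id LinearMap.id H.coring.comul (fun _ _ => rfl) (fun a c => H.coring.comul_l a c)
  have hD : ∀ u v, D (H.outer.tmul H.outer u v) =
      H.outer.tmul (H.outer.tensor H.outer) u (H.comul v) := fun _ _ => rfl
  have hN : ∀ (φ : H.RightDual) (u z z' : U) (Y : H.outer.Tensor H.outer),
      N φ (H.outer.tmul (H.outer.tensor H.outer) u (H.outerMulRight z z' Y)) =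
        H.outerMulRight 1 z' (N (rightDualAct z φ) (H.outer.tmul (H.outer.tensor H.outer) u Y)) := by
    intro φ u z z' Y
    induction Y using BalTensor.induction with
    | h0 => simp
    | ht x y =>
      rw [AeRing.outerMulRight_tmul, evLeft_tmul, evLeft_tmul, AeRing.outerMulRight_tmul, mul_one,
        LinearMap.comp_apply, LinearMap.comp_apply, leftGaloisInv_tmul, leftGaloisInv_tmul,
        leftHopfOp_sandwich, leftHopfOp_sandwich, rightDualAct_mul]
    | ha Y Z h1 h2 => simp only [Bimod.tmul, BalTensor.tmul_add, map_add] at h1 h2 ⊢; rw [h1, h2]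
  -- Here coassociativity is used towards Δ(p₁) ⊗ p₂, so that α_ℓ⁻¹ meets Δ(p₁) and returns p₁ ⊗ 1.
  have hcomul : ∀ (φ : H.RightDual) (p : U), N φ (D (H.comul p)) =
      H.outerMulRight (H.t (op (φ 1))) 1 (H.comul p) := by
    intro φ p
    refine (congrArg (N φ) (H.coring.coassoc p)).symm.trans ?_
    change N φ (Bimod.assoc _ _ _ (BalTensor.map _ _ _ _ _ (H.comul p))) = _
    generalize H.comul p = X
    induction X using BalTensor.induction with
    | h0 => simp
    | ht x y =>
      refine (evLeft_assoc _ _ (H.comul x) y).trans ?_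
      have h1 := leftGaloisInv_comul h x 1
      rw [outerMulRight_one_one] at h1
      rw [LinearMap.comp_apply, h1, leftHopfOp_tmul, AeRing.outerMulRight_tmul, mul_one]
    | ha Y Z h1 h2 => simp only [map_add, h1, h2]
  -- On p ⊗ q, D gives p₁ ⊗ p₂ q₁ ⊗ p₃ q₂, and N φ reduces this to p₁ t(φ(q₁)) ⊗ p₂ q₂. The Takeuchi
  -- condition rewrites it as p₁ ⊗ p₂ s(φ(q₁)) q₂, the image under α_ℓ of p ⊗ s(φ(q₁)) q₂.
  have key : ∀ T : H.LeftGaloisTensor, N φ (D (H.leftGalois T)) =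
      H.leftGalois (leftGaloisRightOp φ T) := by
    intro T
    induction T using BalTensor.induction with
    | h0 => simp
    | ht p q =>
      rw [leftGaloisRightOp_tmul, leftGalois_tmul, leftGalois_tmul, rightOp_apply]
      obtain ⟨S, hS⟩ := exists_finset_outer_tmul (H := H) (H.comul q)
      have h1 : ∀ X, N φ (D (H.outerMulRight 1 q X)) =
          ∑ i ∈ S, H.outerMulRight 1 i.2 (N (rightDualAct i.1 φ) (D X)) := by
        intro X
        induction X using BalTensor.induction with
        | h0 => simp
        | ht x y =>
          rw [AeRing.outerMulRight_tmul, hD, hD, mul_one, H.comul_mul]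
          change N φ (H.outer.tmul (H.outer.tensor H.outer) x
            (H.leftTakeuchiMul (H.comul y) _ (H.comul q))) = _
          rw [hS, map_sum, Bimod.tmul, BalTensor.tmul_sum, map_sum]
          exact Finset.sum_congr rfl fun i _ => hN φ x i.1 i.2 (H.comul y)
        | ha Y Z h1 h2 => simp only [map_add, h1, h2, Finset.sum_add_distrib]
      rw [h1, hS, map_sum, map_sum, LinearMap.sum_apply]
      refine Finset.sum_congr rfl fun i _ => ?_
      -- The Takeuchi condition for Δ(p) at the scalar φ(q₁), followed by right multiplication of
      -- the second leg by q₂.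
      have h2 := congrArg (H.outerMulRight 1 i.2) (H.comul_takeuchi p (φ i.1))
      rw [AeRing.outerMulRight_comp, AeRing.outerMulRight_comp] at h2
      rw [hcomul, AeRing.outerMulRight_comp, rightEv_tmul, rightDualAct_apply, one_mul]
      simpa using h2
    | ha Y Z h1 h2 => simp only [map_add, h1, h2]
  refine h.1 ?_
  rw [← key, leftGalois_leftTrans, leftGalois_leftTrans, hD, H.comul_one]
  rfl

/-! ### `S^*` as a morphism of augmented rings -/

/-- The product in U_* evaluates S^*(φ') at t(S^*(φ)(u₂)) u₁ = u₊ t(φ(u₋)), whose translation is u₊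
⊗ s(φ(u₋₁)) u₋₂. Applying φ' to the second leg gives (φ φ')(u₋). -/
theorem sStarUpLin_mul (h : H.IsLeftHopf) (φ φ' : H.RightDual) :
    sStarUpLin h (φ * φ') = sStarUpLin h φ * sStarUpLin h φ' := LeftDual.ext fun u => by
  rw [LeftDual.mul_apply, leftOp_sStarUpLin, sStarUpLin_apply, sStarUpLin_apply,
    leftTrans_leftHopfOp]
  generalize leftTrans h u = T
  induction T using BalTensor.induction with
  | h0 => simp
  | ht p q => rfl
  | ha Y Z h1 h2 => simp only [map_add, h1, h2]

/-- `u₊ u₋ = s(ε(u))`. -/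
theorem lift_mul_leftTrans (h : H.IsLeftHopf) (u : U) :
    BalTensor.lift (LinearMap.mul k U) (fun a x y => by simp [mul_assoc]) (leftTrans h u) =
      H.s (H.eps u) := by
  -- With φ = ε, `rightEvD` is u ⊗ v ↦ s(ε(u)) v, so on α_ℓ(p ⊗ q) = p₁ ⊗ p₂ q the counit axiom
  -- returns p q.
  have h1 : ∀ T : H.LeftGaloisTensor,
      BalTensor.lift (LinearMap.mul k U) (fun a x y => by simp [mul_assoc]) T =
        H.rightEvD 1 (H.leftGalois T) := by
    intro T
    induction T using BalTensor.induction with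
    | h0 => simp
    | ht p q =>
      rw [leftGalois_tmul, BalTensor.lift_tmul, LinearMap.mul_apply']
      conv_lhs => rw [← rightOp_one (H := H) p, rightOp_apply]
      generalize H.comul p = X
      induction X using BalTensor.induction with
      | h0 => simp
      | ht x y => simp [AeRing.outerMulRight_tmul, rightEv_tmul, mul_assoc]
      | ha Y Z h1 h2 => simp only [map_add, h1, h2, add_mul]
    | ha Y Z h1 h2 => simp only [map_add, h1, h2]
  rw [h1, leftGalois_leftTrans, rightEv_tmul, mul_one]
  rfl

/-- The nested counits in ε(u₊ t(ε(u₋ s(a)))) merge into ε(u₊ u₋ s(a)), and u₊ u₋ = s(ε(u)). -/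
theorem sStarUpLin_source (h : H.IsLeftHopf) (a : A) :
    sStarUpLin h (H.rightDualS a) = H.leftDualS a := LeftDual.ext fun u => by
  have h1 : ∀ T : H.LeftGaloisTensor, leftHopfEval (H.rightDualS a) T = H.eps
      (BalTensor.lift (LinearMap.mul k U) (fun a x y => by simp [mul_assoc]) T * H.s a) := by
    intro T
    induction T using BalTensor.induction with
    | h0 => simp
    | ht p q =>
      rw [leftHopfEval_tmul, rightDualS_apply, ← H.counit_mul_t, BalTensor.lift_tmul, ← mul_assoc]
      rfl
    | ha Y Z h1 h2 => simp only [map_add, h1, h2, add_mul]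
  rw [sStarUpLin_apply, h1, lift_mul_leftTrans, eps_s_mul, eps_s, leftDualS_apply]

/-- The case a = 1 of compatibility with sources, both source maps being unital. -/
theorem sStarUpLin_one (h : H.IsLeftHopf) : sStarUpLin h 1 = 1 := by
  have h1 := sStarUpLin_source h (1 : A)
  have h2 : H.rightDualS 1 = 1 := map_one H.rightDualAug.s
  have h3 : H.leftDualS 1 = 1 := map_one H.leftDualAug.s
  rwa [h2, h3] at h1

/-- As t reverses products, t(a ε(u₋)) = t(ε(u₋)) t(a). It remains that u₊ t(ε(u₋)) = u, which is
`leftOp_sStarUpLin` at φ = 1 combined with S^*(1) = 1. -/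
theorem sStarUpLin_target (h : H.IsLeftHopf) (a : A) :
    sStarUpLin h (H.rightDualT (op a)) = H.leftDualT (op a) := LeftDual.ext fun u => by
  have h1 : ∀ T : H.LeftGaloisTensor, leftHopfEval (H.rightDualT (op a)) T = H.eps
      (leftHopfOp 1 T * H.t (op a)) := by
    intro T
    induction T using BalTensor.induction with
    | h0 => simp
    | ht p q =>
      rw [leftHopfEval_tmul, leftHopfOp_tmul, rightDualT_apply, RightDual.one_apply, mul_assoc,
        ← map_mul]
      rfl
    | ha Y Z h1 h2 => simp only [map_add, h1, h2, add_mul]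
  rw [sStarUpLin_apply, h1, ← leftOp_sStarUpLin, sStarUpLin_one, leftOp_one, leftDualT_apply]

/-- `S^* : U^* → U_*` as a homomorphism of algebras. -/
noncomputable def sStarUpHom (h : H.IsLeftHopf) : H.RightDual →ₐ[k] H.LeftDual :=
  AlgHom.ofLinearMap (sStarUpLin h) (sStarUpLin_one h) (sStarUpLin_mul h)

theorem isAugAeRingHom_sStarUpHom (h : H.IsLeftHopf) :
    IsAugAeRingHom H.rightDualAug H.leftDualAug (sStarUpHom h) (AlgHom.id k A) where
  map_s := sStarUpLin_source h
  map_t := sStarUpLin_target h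
  map_counit φ := by
    change sStarUpLin h φ 1 = φ 1
    rw [sStarUpLin_apply, leftTrans_one, leftHopfEval_tmul, one_mul, eps_t]

/-! ### `S^*` and the module structures and coproducts -/

/-- Expanding the translation of m u as m₊ u₊ ⊗ u₋ m₋ and absorbing u₊ t(φ(u₋ m₋)) into its counit
leaves the value at m₋ of the acted functional. The absorption produces an s where the definition of
S^* has a t; under ε, right multiplication by either agrees. -/
theorem sStarUpLin_act (h : H.IsLeftHopf) (u : U) (φ : H.RightDual) :
    sStarUpLin h (hopfRightDualAct h u φ) = leftDualAct u (sStarUpLin h φ) :=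
  LeftDual.ext fun m => by
    rw [leftDualAct_apply, sStarUpLin_apply, sStarUpLin_apply, leftTrans_mul]
    generalize leftTrans h m = T
    induction T using BalTensor.induction with
    | h0 => simp
    | ht x y =>
      refine Eq.trans ?_ (leftHopfEval_sandwich φ x y _).symm
      rw [leftHopfEval_tmul, hopfRightDualAct_apply, ← eps_mul_s]
    | ha Y Z h1 h2 => simp only [map_add, h1, h2]

/-- The relation v₊ ⊗ v₋ t(a) = t(a) v₊ ⊗ v₋ carries the scalar to the front, where ε turns it into
right multiplication by a. -/
theorem sStarUpLin_act_t_mul (h : H.IsLeftHopf) (φ : H.RightDual) (a : A) (y v : U) :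
    sStarUpLin h (rightDualAct (H.t (op a) * y) φ) v = sStarUpLin h (rightDualAct y φ) v * a := by
  rw [sStarUpLin_apply, sStarUpLin_apply, rightDualAct_mul, ← leftHopfEval_sandwich_one,
    ← leftTrans_takeuchi, ← eps_leftHopfOp, leftHopfOp_sandwich, rightDualAct_one, eps_t_mul,
    eps_leftHopfOp]

/-- This is the relation ψ(u v) = ψ⁽²⁾(u s(ψ⁽¹⁾(v))) for ψ = S^*(φ), with the legs obtained by
applying S^* to those of the coproduct ∑ eᵢ·φ ⊗ fᵢ of φ. For u₊ ⊗ u₋ = x ⊗ y, both sides become ε(x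
s(c)) with c = S^*(y·φ)(v), once y is expanded in the dual basis. -/
theorem sStarUpLin_sum (h : H.IsLeftHopf) {n : ℕ} {e : Fin n → U} {f : Fin n → H.RightDual}
    (hef : ∀ u, ∑ i, H.t (op (f i u)) * e i = u) (φ : H.RightDual) (u v : U) :
    ∑ i, sStarUpLin h (f i) (u * H.s (sStarUpLin h (rightDualAct (e i) φ) v)) =
      sStarUpLin h φ (u * v) := by
  simp only [sStarUpLin_apply _ (f _), sStarUpLin_apply _ φ, leftTrans_mul]
  generalize leftTrans h u = T
  induction T using BalTensor.induction with
  | h0 => simp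
  | ht x y =>
    have h1 : ∀ (φ : H.RightDual) (v : U), leftHopfEval φ (leftTransMul h v (BalTensor.tmul _ _ x y)) =
        H.eps (x * H.s (sStarUpLin h (rightDualAct y φ) v)) :=
      fun φ v => leftHopfEval_sandwich φ x y _
    -- Left A-linearity reduces this to the value at 1. It is applied with y·fᵢ in place of φ, so
    -- that the factor on the right is fᵢ(y).
    have h2 : ∀ φ a, sStarUpLin h φ (H.s a) = a * φ 1 := fun φ a => by
      have h3 := (isAugAeRingHom_sStarUpHom h).map_counit φ
      rw [← mul_one (H.s a), LeftDual.map_s]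
      exact congrArg (a * ·) h3
    simp only [h1, h2, rightDualAct_apply, one_mul]
    rw [← map_sum, ← Finset.mul_sum]
    -- The expansion y = ∑ t(fᵢ(y)) eᵢ; after S^* each t(fᵢ(y)) becomes a right factor fᵢ(y).
    have h4 : rightDualAct y φ = ∑ i, rightDualAct (H.t (op (f i y)) * e i) φ :=
      RightDual.ext fun u => by
        rw [map_sum, LinearMap.sum_apply, rightDualAct_apply]
        conv_lhs => rw [← hef y, Finset.mul_sum, map_sum]
        rfl
    rw [h4, map_sum (sStarUpLin h), map_sum LeftDual.lin, LinearMap.sum_apply]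
    simp only [sStarUpLin_act_t_mul, map_sum]
  | ha Y Z h1 h2 => simp only [map_add, Finset.sum_add_distrib, h1, h2]

/-- Finite projectivity of ▷U makes the pairings `leftTheta` of the first leg with elements v
jointly injective on U_* ⊗_A U_*. The dual basis of U_◁ supplies the coproduct of U^*, and the
paired identity evaluated at u is `sStarUpLin_sum`. -/
theorem isRightBialgebroidHom_sStarUpHom (h : H.IsLeftHopf) (h₁ : H.LeftFGP) (h₂ : H.RightFGP) :
    IsRightBialgebroidHom (H.rightDualBialgebroid h₂) (H.leftDualBialgebroid h₁) (sStarUpHom h)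
      (AlgHom.id k A) where
  toIsAugAeRingHom := isAugAeRingHom_sStarUpHom h
  map_comul φ := leftTheta_ext h₁ _ fun v => by
    refine (leftTheta_comul h₁ v (sStarUpLin h φ)).trans (LeftDual.ext fun u => ?_)
    obtain ⟨n, e, f, hef, hc⟩ := exists_rightDualComul h₂
    change _ = LeftDual.lin (leftTheta H.leftDualAug.inner v
      ((isAugAeRingHom_sStarUpHom h).tensorMap (rightDualComul h₂ φ))) u
    rw [hc, map_sum, map_sum, map_sum, LinearMap.sum_apply, leftDualAct_apply,
      ← sStarUpLin_sum h hef]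
    exact Finset.sum_congr rfl fun i _ => (leftDual_inner_l _ _ u).symm

end LeftHopf
/-! The map `S_*` of a right Hopf algebroid. -/

section RightHopf

/-! ### Linearity of the right translation map and of the evaluation ε(x s(ψ(y))) -/

theorem rightGalois_sandwich_t (a : A) (T : H.RightGaloisTensor) :
    H.rightGalois (rightSandwich (H.t (op a)) 1 T) =
      (H.outer.tensor H.outer).r (op a) (H.rightGalois T) := by
  induction T using BalTensor.induction with
  | h0 => simp
  | ht p q =>
    rw [rightSandwich_tmul, rightGalois_tmul, rightGalois_tmul, comul_t_mul, outerMulRight_r,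
      mul_one]
  | ha Y Z h1 h2 => simp only [map_add, h1, h2]

theorem rightGalois_sandwich_s (a : A) (T : H.RightGaloisTensor) :
    H.rightGalois (rightSandwich (H.s a) 1 T) =
      (H.outer.tensor H.outer).l a (H.rightGalois T) := by
  induction T using BalTensor.induction with
  | h0 => simp
  | ht p q =>
    rw [rightSandwich_tmul, rightGalois_tmul, rightGalois_tmul, comul_s_mul, outerMulRight_l,
      mul_one]
  | ha Y Z h1 h2 => simp only [map_add, h1, h2]

/-- The translation map is α_r⁻¹(1 ⊗ u), so the linearity visible on it is that of the second leg,
by t(a). This makes S_*(ψ) an element of the right dual. -/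
theorem rightTrans_t_mul (h : H.IsRightHopf) (a : A) (u : U) :
    rightTrans h (H.t (op a) * u) = rightSandwich (H.t (op a)) 1 (rightTrans h u) := by
  refine h.1 ?_
  rw [rightGalois_sandwich_t, rightGalois_rightTrans, rightGalois_rightTrans]
  rfl

/-- Here w = p s(ψ(q y)) is absorbed by the other counit axiom, ε(x w) = ε(x t(ε(w))). -/
theorem rightHopfEval_sandwich (ψ : H.LeftDual) (x y : U) (T : H.RightGaloisTensor) :
    rightHopfEval ψ (rightSandwich x y T) =
      H.eps (x * H.t (op (rightHopfEval (leftDualAct y ψ) T))) := by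
  induction T using BalTensor.induction with
  | h0 => simp
  | ht p q =>
    rw [rightSandwich_tmul, rightHopfEval_tmul, rightHopfEval_tmul, mul_assoc, H.counit_mul_t]
    rfl
  | ha Y Z h1 h2 => simp only [map_add, h1, h2, mul_add, op_add]

theorem rightHopfEval_sandwich_t (ψ : H.LeftDual) (a : A) (T : H.RightGaloisTensor) :
    rightHopfEval ψ (rightSandwich (H.t (op a)) 1 T) = rightHopfEval ψ T * a := by
  rw [rightHopfEval_sandwich, ← map_mul, ← op_mul, eps_t, leftDualAct_one]

/-- The map `S_* : U_* → U^*` as a linear map. -/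
noncomputable def sStarDownLin (h : H.IsRightHopf) : H.LeftDual →ₗ[k] H.RightDual where
  toFun ψ := RightDual.mk
    { toFun := sStarDown h ψ
      map_add' := fun u v => by rw [sStarDown, rightTrans_add, map_add]; rfl
      map_smul' := fun c u => by
        rw [sStarDown, rightTrans, Bimod.tmul, BalTensor.tmul_smul, map_smul, map_smul]; rfl }
    (fun a u => by
      change rightHopfEval ψ (rightTrans h (H.t (op a) * u)) = rightHopfEval ψ (rightTrans h u) * a
      rw [rightTrans_t_mul, rightHopfEval_sandwich_t])
  map_add' ψ ψ' := RightDual.ext fun u => rightHopfEval_add ψ ψ' _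
  map_smul' c ψ := RightDual.ext fun u => rightHopfEval_smul c ψ _

theorem sStarDownLin_apply (h : H.IsRightHopf) (ψ : H.LeftDual) (u : U) :
    sStarDownLin h ψ u = rightHopfEval ψ (rightTrans h u) := rfl

/-- For `ψ` in the left dual, the map `x ⊗ y ↦ x s(ψ(y))`. -/
def rightHopfOp (ψ : H.LeftDual) : H.RightGaloisTensor →ₗ[k] U :=
  BalTensor.lift ((LinearMap.mul k U).compl₂ (H.s.toLinearMap ∘ₗ LeftDual.lin ψ))
    (fun a x y => by simp [mul_assoc])

theorem rightHopfOp_tmul (ψ : H.LeftDual) (x y : U) :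
    rightHopfOp ψ (BalTensor.tmul _ _ x y) = x * H.s (ψ y) := rfl

theorem eps_rightHopfOp (ψ : H.LeftDual) (T : H.RightGaloisTensor) :
    H.eps (rightHopfOp ψ T) = rightHopfEval ψ T := by
  induction T using BalTensor.induction with
  | h0 => simp
  | ht p q => rfl
  | ha Y Z h1 h2 => simp only [map_add, h1, h2]

/-! ### The inverse of the right Galois map -/

/-- The map `u ⊗ v ↦ v₍₊₎ ⊗ v₍₋₎ u`. -/
noncomputable def rightGaloisInv (h : H.IsRightHopf) :
    H.outer.Tensor H.outer →ₗ[k] H.RightGaloisTensor :=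
  (LinearEquiv.ofBijective H.rightGalois h).symm.toLinearMap

theorem rightGaloisInv_rightGalois (h : H.IsRightHopf) (T : H.RightGaloisTensor) :
    rightGaloisInv h (H.rightGalois T) = T :=
  (LinearEquiv.ofBijective H.rightGalois h).symm_apply_apply T

theorem rightGalois_rightGaloisInv (h : H.IsRightHopf) (X : H.outer.Tensor H.outer) :
    H.rightGalois (rightGaloisInv h X) = X :=
  (LinearEquiv.ofBijective H.rightGalois h).apply_symm_apply X

theorem rightGaloisInv_comul (h : H.IsRightHopf) (p q : U) :
    rightGaloisInv h (H.outerMulRight q 1 (H.comul p)) = BalTensor.tmul _ _ p q := by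
  rw [← rightGalois_tmul, rightGaloisInv_rightGalois]

theorem rightGaloisInv_tmul_one (h : H.IsRightHopf) (u : U) :
    rightGaloisInv h (H.outer.tmul H.outer 1 u) = rightTrans h u := rfl

theorem rightGalois_sandwich_one (y : U) (T : H.RightGaloisTensor) :
    H.rightGalois (rightSandwich 1 y T) = H.outerMulRight y 1 (H.rightGalois T) := by
  induction T using BalTensor.induction with
  | h0 => simp
  | ht p q =>
    rw [rightSandwich_tmul, rightGalois_tmul, rightGalois_tmul, AeRing.outerMulRight_comp]
    simp
  | ha Y Z h1 h2 => simp only [map_add, h1, h2]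

theorem rightGaloisInv_outerMulRight (h : H.IsRightHopf) (y : U) (X : H.outer.Tensor H.outer) :
    rightGaloisInv h (H.outerMulRight y 1 X) = rightSandwich 1 y (rightGaloisInv h X) := by
  refine h.1 ?_
  rw [rightGalois_sandwich_one, rightGalois_rightGaloisInv, rightGalois_rightGaloisInv]

/-- The first leg u enters only by right multiplication on the second Galois factor, because α_r is
right U-linear in that factor. -/
theorem rightGaloisInv_tmul (h : H.IsRightHopf) (u v : U) :
    rightGaloisInv h (H.outer.tmul H.outer u v) = rightSandwich 1 u (rightTrans h v) := by
  rw [← rightGaloisInv_tmul_one, ← rightGaloisInv_outerMulRight]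
  simp

theorem rightGaloisInv_r (h : H.IsRightHopf) (a : A) (X : H.outer.Tensor H.outer) :
    rightGaloisInv h ((H.outer.tensor H.outer).r (op a) X) =
      rightSandwich (H.t (op a)) 1 (rightGaloisInv h X) := by
  refine h.1 ?_
  rw [rightGalois_sandwich_t, rightGalois_rightGaloisInv, rightGalois_rightGaloisInv]

theorem rightGaloisInv_l (h : H.IsRightHopf) (a : A) (X : H.outer.Tensor H.outer) :
    rightGaloisInv h ((H.outer.tensor H.outer).l a X) =
      rightSandwich (H.s a) 1 (rightGaloisInv h X) := by
  refine h.1 ?_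
  rw [rightGalois_sandwich_s, rightGalois_rightGaloisInv, rightGalois_rightGaloisInv]

theorem rightHopfEval_sandwich_one (ψ : H.LeftDual) (y : U) (T : H.RightGaloisTensor) :
    rightHopfEval ψ (rightSandwich 1 y T) = rightHopfEval (leftDualAct y ψ) T := by
  rw [rightHopfEval_sandwich, one_mul, eps_t]

theorem rightHopfOp_sandwich (ψ : H.LeftDual) (x y : U) (T : H.RightGaloisTensor) :
    rightHopfOp ψ (rightSandwich x y T) = x * rightHopfOp (leftDualAct y ψ) T := by
  induction T using BalTensor.induction with
  | h0 => simp
  | ht p q => rw [rightSandwich_tmul, rightHopfOp_tmul, rightHopfOp_tmul, mul_assoc]; rfl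
  | ha Y Z h1 h2 => simp only [map_add, h1, h2, mul_add]

/-- For a right `A`-linear map `g`, the map `u ⊗ (v ⊗ w) ↦ s(g(u ⊗ v)) w`. -/
def rightEvAssoc (g : H.outer.Tensor H.outer →ₗ[k] A)
    (hg : ∀ a X, g ((H.outer.tensor H.outer).r (op a) X) = g X * a) :
    H.outer.Tensor (H.outer.tensor H.outer) →ₗ[k] U :=
  BalTensor.lift
    { toFun := fun u => H.rightEv H.outer (g ∘ₗ BalTensor.mk _ _ u)
        (fun a v => hg a (H.outer.tmul H.outer u v))
      map_add' := fun u u' => BalTensor.hom_ext fun v w => by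
        change H.s (g (H.outer.tmul H.outer (u + u') v)) * w =
          H.s (g (H.outer.tmul H.outer u v)) * w + H.s (g (H.outer.tmul H.outer u' v)) * w
        simp [BalTensor.add_tmul, add_mul]
      map_smul' := fun c u => BalTensor.hom_ext fun v w => by
        change H.s (g (H.outer.tmul H.outer (c • u) v)) * w =
          c • (H.s (g (H.outer.tmul H.outer u v)) * w)
        simp [BalTensor.smul_tmul] }
    (fun a u X => by
      induction X using BalTensor.induction with
      | h0 => simp
      | ht v w =>
        change H.s (g (H.outer.tmul H.outer (H.outer.r (op a) u) v)) * w =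
          H.s (g (H.outer.tmul H.outer u (H.outer.l a v))) * w
        rw [Bimod.tmul, Bimod.tmul, BalTensor.tmul_balanced (ρ := fun a : A => H.outer.r (op a))]
      | ha X Y h1 h2 => simp only [map_add, h1, h2])

theorem rightEvAssoc_tmul (g : H.outer.Tensor H.outer →ₗ[k] A)
    (hg : ∀ a X, g ((H.outer.tensor H.outer).r (op a) X) = g X * a) (u v w : U) :
    rightEvAssoc g hg (H.outer.tmul (H.outer.tensor H.outer) u (H.outer.tmul H.outer v w)) =
      H.s (g (H.outer.tmul H.outer u v)) * w := rfl

/-- Evaluates g on a whole block in the first two legs, as is needed when that block is a coproduct.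
-/
theorem rightEvAssoc_assoc (g : H.outer.Tensor H.outer →ₗ[k] A)
    (hg : ∀ a X, g ((H.outer.tensor H.outer).r (op a) X) = g X * a)
    (X : H.outer.Tensor H.outer) (w : U) :
    rightEvAssoc g hg
      (Bimod.assoc H.outer H.outer H.outer ((H.outer.tensor H.outer).tmul H.outer X w)) =
      H.s (g X) * w := by
  induction X using BalTensor.induction with
  | h0 => simp
  | ht u v => rfl
  | ha X Y h1 h2 =>
    simp only [Bimod.tmul, BalTensor.add_tmul, map_add, add_mul] at h1 h2 ⊢
    rw [h1, h2]

/-- `s(S_*(ψ)(u₁)) u₂ = u₍₊₎ s(ψ(u₍₋₎))`. -/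
theorem rightOp_sStarDownLin (h : H.IsRightHopf) (ψ : H.LeftDual) (u : U) :
    H.rightOp (sStarDownLin h ψ) u = rightHopfOp ψ (rightTrans h u) := by
  have hg : ∀ (ψ : H.LeftDual) (a : A) (X : H.outer.Tensor H.outer),
      (rightHopfEval ψ ∘ₗ rightGaloisInv h) ((H.outer.tensor H.outer).r (op a) X) =
        (rightHopfEval ψ ∘ₗ rightGaloisInv h) X * a := fun ψ a X => by
    rw [LinearMap.comp_apply, rightGaloisInv_r, rightHopfEval_sandwich_t]; rfl
  -- K ψ sends u ⊗ v to s(ε(v₁₍₊₎ s(ψ(v₁₍₋₎ u)))) v₂. At u = 1 it is the left-hand side of the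
  -- claim, and K ψ ∘ α_r will be x ⊗ y ↦ x s(ψ(y)).
  let K : H.LeftDual → H.outer.Tensor H.outer →ₗ[k] U := fun ψ =>
    rightEvAssoc _ (hg ψ) ∘ₗ
      BalTensor.map (ρ' := fun a => H.outer.r (op a)) (l' := fun a => (H.outer.tensor H.outer).l a)
        id LinearMap.id H.coring.comul (fun _ _ => rfl) (fun a c => H.coring.comul_l a c)
  have hK : ∀ ψ u v, K ψ (H.outer.tmul H.outer u v) =
      H.rightOp (sStarDownLin h (leftDualAct u ψ)) v := by
    intro ψ u v
    change rightEvAssoc _ (hg ψ) (H.outer.tmul (H.outer.tensor H.outer) u (H.comul v)) = _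
    rw [rightOp_apply]
    generalize H.comul v = Y
    induction Y using BalTensor.induction with
    | h0 => simp
    | ht x y =>
      rw [rightEvAssoc_tmul, rightEv_tmul, LinearMap.comp_apply, rightGaloisInv_tmul,
        rightHopfEval_sandwich_one]
      rfl
    | ha Y Z h1 h2 =>
      simp only [Bimod.tmul, BalTensor.tmul_add, map_add] at h1 h2 ⊢
      rw [h1, h2]
  have hmul : ∀ (ψ : H.LeftDual) (q : U) (X : H.outer.Tensor H.outer),
      K ψ (H.outerMulRight q 1 X) = K (leftDualAct q ψ) X := by
    intro ψ q X
    induction X using BalTensor.induction with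
    | h0 => simp
    | ht x y => rw [AeRing.outerMulRight_tmul, hK, hK, mul_one, leftDualAct_mul]
    | ha Y Z h1 h2 => simp only [map_add, h1, h2]
  -- Coassociativity is read from p₁ ⊗ Δ(p₂) to Δ(p₁) ⊗ p₂, and α_r⁻¹(Δ(p₁)) = p₁ ⊗ 1. The remaining
  -- s(ε(p₁ s(ψ(1)))) p₂ is p s(ψ(1)) by `rightOp_rightDualS`.
  have hcomul : ∀ (ψ : H.LeftDual) (p : U), K ψ (H.comul p) = p * H.s (ψ 1) := by
    intro ψ p
    refine (congrArg (rightEvAssoc _ (hg ψ)) (H.coring.coassoc p)).symm.trans ?_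
    rw [← rightOp_rightDualS, rightOp_apply]
    change rightEvAssoc _ (hg ψ) (Bimod.assoc _ _ _ (BalTensor.map _ _ _ _ _ (H.comul p))) = _
    generalize H.comul p = X
    induction X using BalTensor.induction with
    | h0 => simp
    | ht x y =>
      refine (rightEvAssoc_assoc _ _ (H.comul x) y).trans ?_
      have h1 := rightGaloisInv_comul h x 1
      rw [outerMulRight_one_one] at h1
      rw [LinearMap.comp_apply, h1, rightEv_tmul]
      rfl
    | ha Y Z h1 h2 => simp only [map_add, h1, h2]
  have hT : ∀ T : H.RightGaloisTensor, K ψ (H.rightGalois T) = rightHopfOp ψ T := by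
    intro T
    induction T using BalTensor.induction with
    | h0 => simp
    | ht p q =>
      rw [rightGalois_tmul, hmul, hcomul, rightHopfOp_tmul, leftDualAct_apply, one_mul]
    | ha Y Z h1 h2 => simp only [map_add, h1, h2]
  have h1 := hT (rightTrans h u)
  rw [rightGalois_rightTrans, hK] at h1
  rw [← h1, leftDualAct_one]

/-- Left A-linearity makes it possible to apply this map to the last two legs of a triple tensor
product over A. -/
theorem rightHopfOp_rightGaloisInv_l (h : H.IsRightHopf) (ψ : H.LeftDual) (a : A)
    (X : H.outer.Tensor H.outer) :
    (rightHopfOp ψ ∘ₗ rightGaloisInv h) ((H.outer.tensor H.outer).l a X) =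
      H.s a * (rightHopfOp ψ ∘ₗ rightGaloisInv h) X := by
  rw [LinearMap.comp_apply, rightGaloisInv_l, rightHopfOp_sandwich, leftDualAct_one]
  rfl

/-- The map `x ⊗ y ↦ x ⊗ t(ψ(y₂)) y₁`. -/
def rightGaloisLeftOp (ψ : H.LeftDual) : H.RightGaloisTensor →ₗ[k] H.RightGaloisTensor :=
  BalTensor.map id LinearMap.id (H.leftOp ψ) (fun _ _ => rfl) (fun a v => H.leftOp_s_mul ψ a v)

theorem rightGaloisLeftOp_tmul (ψ : H.LeftDual) (x y : U) :
    rightGaloisLeftOp ψ (BalTensor.tmul _ _ x y) = BalTensor.tmul _ _ x (H.leftOp ψ y) := rfl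

/-- `u₍₊₎ ⊗ t(ψ(u₍₋₎₂)) u₍₋₎₁` is the translation of `u₍₊₎ s(ψ(u₍₋₎))`. -/
theorem rightTrans_rightHopfOp (h : H.IsRightHopf) (ψ : H.LeftDual) (u : U) :
    rightTrans h (rightHopfOp ψ (rightTrans h u)) = rightGaloisLeftOp ψ (rightTrans h u) := by
  -- N ψ sends u ⊗ v ⊗ w to u ⊗ w₍₊₎ s(ψ(w₍₋₎ v)), and D below is Δ ⊗ id, reassociated.
  let N : H.LeftDual → H.outer.Tensor (H.outer.tensor H.outer) →ₗ[k] H.outer.Tensor H.outer :=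
    fun ψ => BalTensor.map (l' := fun a => H.outer.l a) id LinearMap.id
      (rightHopfOp ψ ∘ₗ rightGaloisInv h) (fun _ _ => rfl) (rightHopfOp_rightGaloisInv_l h ψ)
  have hNt : ∀ ψ u v w, N ψ (H.outer.tmul (H.outer.tensor H.outer) u (H.outer.tmul H.outer v w)) =
      H.outer.tmul H.outer u (rightHopfOp ψ (rightGaloisInv h (H.outer.tmul H.outer v w))) :=
    fun _ _ _ _ => rfl
  let D : H.outer.Tensor H.outer →ₗ[k] H.outer.Tensor (H.outer.tensor H.outer) :=
    Bimod.assoc H.outer H.outer H.outer ∘ₗ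
      BalTensor.map (ρ' := fun a => (H.outer.tensor H.outer).r (op a)) (l' := fun a => H.outer.l a)
        id H.coring.comul LinearMap.id (fun a c => H.coring.comul_r (op a) c) (fun _ _ => rfl)
  have hD : ∀ u v, D (H.outer.tmul H.outer u v) = Bimod.assoc H.outer H.outer H.outer
      ((H.outer.tensor H.outer).tmul H.outer (H.comul u) v) := fun _ _ => rfl
  have hN : ∀ (ψ : H.LeftDual) (w z z' : U) (Y : H.outer.Tensor H.outer),
      N ψ (Bimod.assoc H.outer H.outer H.outer
        ((H.outer.tensor H.outer).tmul H.outer (H.outerMulRight z z' Y) w)) =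
      H.outerMulRight z 1 (N (leftDualAct z' ψ) (Bimod.assoc H.outer H.outer H.outer
        ((H.outer.tensor H.outer).tmul H.outer Y w))) := by
    intro ψ w z z' Y
    induction Y using BalTensor.induction with
    | h0 => simp
    | ht x y =>
      rw [AeRing.outerMulRight_tmul, Bimod.assoc_tmul, Bimod.assoc_tmul, hNt, hNt,
        AeRing.outerMulRight_tmul, mul_one, rightGaloisInv_tmul, rightGaloisInv_tmul,
        rightHopfOp_sandwich, rightHopfOp_sandwich, leftDualAct_mul]
    | ha Y Z h1 h2 => simp only [Bimod.tmul, BalTensor.add_tmul, map_add] at h1 h2 ⊢; rw [h1, h2]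
  -- Coassociativity places Δ(p₂) in the last two legs, where α_r⁻¹ returns p₂ ⊗ 1.
  have hcomul : ∀ (ψ : H.LeftDual) (p : U), N ψ (D (H.comul p)) =
      H.outerMulRight 1 (H.s (ψ 1)) (H.comul p) := by
    intro ψ p
    refine (congrArg (N ψ) (H.coring.coassoc p)).trans ?_
    change N ψ (BalTensor.map _ _ _ _ _ (H.comul p)) = _
    generalize H.comul p = X
    induction X using BalTensor.induction with
    | h0 => simp
    | ht x y =>
      have h1 := rightGaloisInv_comul h y 1
      rw [outerMulRight_one_one] at h1
      change H.outer.tmul H.outer x (rightHopfOp ψ (rightGaloisInv h (H.comul y))) = _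
      rw [h1, rightHopfOp_tmul, AeRing.outerMulRight_tmul, mul_one]
    | ha Y Z h1 h2 => simp only [map_add, h1, h2]
  -- On p ⊗ q, D gives p₁ q₁ ⊗ p₂ q₂ ⊗ p₃, and N ψ reduces this to p₁ q₁ ⊗ p₂ s(ψ(q₂)). The Takeuchi
  -- condition moves the scalar to p₁ t(ψ(q₂)) q₁ ⊗ p₂, the image under α_r of p ⊗ t(ψ(q₂)) q₁.
  have key : ∀ T : H.RightGaloisTensor, N ψ (D (H.rightGalois T)) =
      H.rightGalois (rightGaloisLeftOp ψ T) := by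
    intro T
    induction T using BalTensor.induction with
    | h0 => simp
    | ht p q =>
      rw [rightGaloisLeftOp_tmul, rightGalois_tmul, rightGalois_tmul, leftOp_apply]
      obtain ⟨S, hS⟩ := exists_finset_outer_tmul (H := H) (H.comul q)
      have h1 : ∀ X, N ψ (D (H.outerMulRight q 1 X)) =
          ∑ i ∈ S, H.outerMulRight i.1 1 (N (leftDualAct i.2 ψ) (D X)) := by
        intro X
        induction X using BalTensor.induction with
        | h0 => simp
        | ht x y =>
          rw [AeRing.outerMulRight_tmul, hD, hD, mul_one, H.comul_mul]
          change N ψ (Bimod.assoc H.outer H.outer H.outer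
            ((H.outer.tensor H.outer).tmul H.outer
              (H.leftTakeuchiMul (H.comul x) _ (H.comul q)) y)) = _
          rw [hS, map_sum, Bimod.tmul, BalTensor.sum_tmul, map_sum, map_sum]
          exact Finset.sum_congr rfl fun i _ => hN ψ y i.1 i.2 (H.comul x)
        | ha Y Z h1 h2 => simp only [map_add, h1, h2, Finset.sum_add_distrib]
      rw [h1, hS, map_sum, map_sum, LinearMap.sum_apply, LinearMap.sum_apply]
      refine Finset.sum_congr rfl fun i _ => ?_
      have h2 := congrArg (H.outerMulRight i.1 1) (H.comul_takeuchi p (ψ i.2))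
      rw [AeRing.outerMulRight_comp, AeRing.outerMulRight_comp] at h2
      rw [hcomul, AeRing.outerMulRight_comp, leftEv_tmul, leftDualAct_apply, one_mul]
      simpa using h2.symm
    | ha Y Z h1 h2 => simp only [map_add, h1, h2]
  refine h.1 ?_
  rw [← key, rightGalois_rightTrans, rightGalois_rightTrans, hD, H.comul_one]
  rfl

/-! ### `S_*` as a morphism of augmented rings -/

/-- The product in U^* evaluates S_*(ψ') at u₍₊₎ s(ψ(u₍₋₎)). The translation of this element has
second leg t(ψ(u₍₋₎₂)) u₍₋₎₁, on which ψ' takes the value (ψ ψ')(u₍₋₎). -/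
theorem sStarDownLin_mul (h : H.IsRightHopf) (ψ ψ' : H.LeftDual) :
    sStarDownLin h (ψ * ψ') = sStarDownLin h ψ * sStarDownLin h ψ' := RightDual.ext fun u => by
  rw [RightDual.mul_apply, rightOp_sStarDownLin, sStarDownLin_apply, sStarDownLin_apply,
    rightTrans_rightHopfOp]
  generalize rightTrans h u = T
  induction T using BalTensor.induction with
  | h0 => simp
  | ht p q => rfl
  | ha Y Z h1 h2 => simp only [map_add, h1, h2]

/-- `u₍₊₎ u₍₋₎ = t(ε(u))`. -/
theorem lift_mul_rightTrans (h : H.IsRightHopf) (u : U) :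
    BalTensor.lift (LinearMap.mul k U) (fun a x y => by simp [mul_assoc]) (rightTrans h u) =
      H.t (op (H.eps u)) := by
  have h1 : ∀ T : H.RightGaloisTensor,
      BalTensor.lift (LinearMap.mul k U) (fun a x y => by simp [mul_assoc]) T =
        H.leftEvD 1 (H.rightGalois T) := by
    intro T
    induction T using BalTensor.induction with
    | h0 => simp
    | ht p q =>
      rw [rightGalois_tmul, BalTensor.lift_tmul, LinearMap.mul_apply']
      conv_lhs => rw [← leftOp_one (H := H) p, leftOp_apply]
      generalize H.comul p = X
      induction X using BalTensor.induction with
      | h0 => simp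
      | ht x y => simp [AeRing.outerMulRight_tmul, leftEv_tmul, mul_assoc]
      | ha Y Z h1 h2 => simp only [map_add, h1, h2, add_mul]
    | ha Y Z h1 h2 => simp only [map_add, h1, h2]
  rw [h1, rightGalois_rightTrans, leftEv_tmul, mul_one]
  rfl

/-- Targets are the direct case here: the nested counits merge into ε(u₍₊₎ u₍₋₎ t(a)), and u₍₊₎ u₍₋₎
= t(ε(u)). The unit is the case a = 1. -/
theorem sStarDownLin_target (h : H.IsRightHopf) (a : A) :
    sStarDownLin h (H.leftDualT (op a)) = H.rightDualT (op a) := RightDual.ext fun u => by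
  have h1 : ∀ T : H.RightGaloisTensor, rightHopfEval (H.leftDualT (op a)) T = H.eps
      (BalTensor.lift (LinearMap.mul k U) (fun a x y => by simp [mul_assoc]) T * H.t (op a)) := by
    intro T
    induction T using BalTensor.induction with
    | h0 => simp
    | ht p q =>
      rw [rightHopfEval_tmul, leftDualT_apply, ← H.counit_mul_s, BalTensor.lift_tmul, ← mul_assoc]
      rfl
    | ha Y Z h1 h2 => simp only [map_add, h1, h2, add_mul]
  rw [sStarDownLin_apply, h1, lift_mul_rightTrans, eps_t_mul, eps_t, rightDualT_apply, unop_op]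

theorem sStarDownLin_one (h : H.IsRightHopf) : sStarDownLin h 1 = 1 := by
  have h1 := sStarDownLin_target h (1 : A)
  have h2 : H.leftDualT (op 1) = 1 := map_one H.leftDualAug.t
  have h3 : H.rightDualT (op 1) = 1 := map_one H.rightDualAug.t
  rwa [h2, h3] at h1

/-- Pulling s(a) out reduces the claim to u₍₊₎ s(ε(u₍₋₎)) = u, that is, to `rightOp_sStarDownLin` at
ψ = 1 together with S_*(1) = 1. -/
theorem sStarDownLin_source (h : H.IsRightHopf) (a : A) :
    sStarDownLin h (H.leftDualS a) = H.rightDualS a := RightDual.ext fun u => by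
  have h1 : ∀ T : H.RightGaloisTensor, rightHopfEval (H.leftDualS a) T = H.eps
      (rightHopfOp 1 T * H.s a) := by
    intro T
    induction T using BalTensor.induction with
    | h0 => simp
    | ht p q =>
      rw [rightHopfEval_tmul, rightHopfOp_tmul, leftDualS_apply, LeftDual.one_apply, mul_assoc,
        ← map_mul]
    | ha Y Z h1 h2 => simp only [map_add, h1, h2, add_mul]
  rw [sStarDownLin_apply, h1, ← rightOp_sStarDownLin, sStarDownLin_one, rightOp_one,
    rightDualS_apply]

/-- `S_* : U_* → U^*` as a homomorphism of algebras. -/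
noncomputable def sStarDownHom (h : H.IsRightHopf) : H.LeftDual →ₐ[k] H.RightDual :=
  AlgHom.ofLinearMap (sStarDownLin h) (sStarDownLin_one h) (sStarDownLin_mul h)

theorem isAugAeRingHom_sStarDownHom (h : H.IsRightHopf) :
    IsAugAeRingHom H.leftDualAug H.rightDualAug (sStarDownHom h) (AlgHom.id k A) where
  map_s := sStarDownLin_source h
  map_t := sStarDownLin_target h
  map_counit ψ := by
    change sStarDownLin h ψ 1 = ψ 1
    rw [sStarDownLin_apply, rightTrans_one, rightHopfEval_tmul, one_mul, eps_s]

/-! ### `S_*` and the module structures and coproducts -/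

theorem sStarDownLin_act (h : H.IsRightHopf) (u : U) (ψ : H.LeftDual) :
    sStarDownLin h (hopfLeftDualAct h u ψ) = rightDualAct u (sStarDownLin h ψ) :=
  RightDual.ext fun m => by
    rw [rightDualAct_apply, sStarDownLin_apply, sStarDownLin_apply, rightTrans_mul]
    generalize rightTrans h m = T
    induction T using BalTensor.induction with
    | h0 => simp
    | ht x y =>
      refine Eq.trans ?_ (rightHopfEval_sandwich ψ x y _).symm
      rw [rightHopfEval_tmul, hopfLeftDualAct_apply, ← eps_mul_s]
    | ha Y Z h1 h2 => simp only [map_add, h1, h2]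

/-- The relation v₍₊₎ ⊗ v₍₋₎ s(a) = s(a) v₍₊₎ ⊗ v₍₋₎ brings s(a) to the front of the argument of ε.
-/
theorem sStarDownLin_act_s_mul (h : H.IsRightHopf) (ψ : H.LeftDual) (a : A) (y v : U) :
    sStarDownLin h (leftDualAct (H.s a * y) ψ) v = a * sStarDownLin h (leftDualAct y ψ) v := by
  rw [sStarDownLin_apply, sStarDownLin_apply, leftDualAct_mul, ← rightHopfEval_sandwich_one,
    ← rightTrans_takeuchi, ← eps_rightHopfOp, rightHopfOp_sandwich, leftDualAct_one, eps_s_mul,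
    eps_rightHopfOp]

/-- This is the relation φ(u v) = φ⁽¹⁾(u t(φ⁽²⁾(v))) for φ = S_*(ψ), with the legs S_*(fᵢ) and
S_*(eᵢ·ψ) coming from the coproduct ∑ fᵢ ⊗ eᵢ·ψ of ψ. The sum collapses through y = ∑ s(fᵢ(y)) eᵢ.
-/
theorem sStarDownLin_sum (h : H.IsRightHopf) {n : ℕ} {e : Fin n → U} {f : Fin n → H.LeftDual}
    (hef : ∀ u, ∑ i, H.s (f i u) * e i = u) (ψ : H.LeftDual) (u v : U) :
    ∑ i, sStarDownLin h (f i) (u * H.t (op (sStarDownLin h (leftDualAct (e i) ψ) v))) =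
      sStarDownLin h ψ (u * v) := by
  simp only [sStarDownLin_apply _ (f _), sStarDownLin_apply _ ψ, rightTrans_mul]
  generalize rightTrans h u = T
  induction T using BalTensor.induction with
  | h0 => simp
  | ht x y =>
    have h1 : ∀ (ψ : H.LeftDual) (v : U), rightHopfEval ψ (rightTransMul h v (BalTensor.tmul _ _ x y)) =
        H.eps (x * H.t (op (sStarDownLin h (leftDualAct y ψ) v))) :=
      fun ψ v => rightHopfEval_sandwich ψ x y _
    have h2 : ∀ ψ a, sStarDownLin h ψ (H.t (op a)) = ψ 1 * a := fun ψ a => by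
      have h3 := (isAugAeRingHom_sStarDownHom h).map_counit ψ
      rw [← mul_one (H.t (op a)), RightDual.map_t]
      exact congrArg (· * a) h3
    simp only [h1, h2, leftDualAct_apply, one_mul]
    rw [← map_sum, ← Finset.mul_sum, ← map_sum H.t, ← Finset.op_sum]
    have h4 : leftDualAct y ψ = ∑ i, leftDualAct (H.s (f i y) * e i) ψ :=
      LeftDual.ext fun u => by
        rw [map_sum, LinearMap.sum_apply, leftDualAct_apply]
        conv_lhs => rw [← hef y, Finset.mul_sum, map_sum]
        rfl
    rw [h4, map_sum (sStarDownLin h), map_sum RightDual.lin, LinearMap.sum_apply]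
    simp only [sStarDownLin_act_s_mul]
  | ha Y Z h1 h2 => simp only [map_add, Finset.sum_add_distrib, h1, h2]

/-- The projectivity conditions exchange roles: U_◁ makes the pairings of the second leg jointly
injective on U^* ⊗_A U^*, and ▷U supplies the dual basis for the coproduct of U_*. -/
theorem isRightBialgebroidHom_sStarDownHom (h : H.IsRightHopf) (h₁ : H.RightFGP) (h₂ : H.LeftFGP) :
    IsRightBialgebroidHom (H.leftDualBialgebroid h₂) (H.rightDualBialgebroid h₁) (sStarDownHom h)
      (AlgHom.id k A) where
  toIsAugAeRingHom := isAugAeRingHom_sStarDownHom h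
  map_comul ψ := rightTheta_ext h₁ _ fun v => by
    refine (rightTheta_comul h₁ v (sStarDownLin h ψ)).trans (RightDual.ext fun u => ?_)
    obtain ⟨n, e, f, hef, hc⟩ := exists_leftDualComul h₂
    change _ = RightDual.lin (rightTheta H.rightDualAug.inner v
      ((isAugAeRingHom_sStarDownHom h).tensorMap (leftDualComul h₂ ψ))) u
    rw [hc, map_sum, map_sum, map_sum, LinearMap.sum_apply, rightDualAct_apply,
      ← sStarDownLin_sum h hef]
    exact Finset.sum_congr rfl fun i _ => (rightDual_inner_r _ _ u).symm

end RightHopf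
end LeftBialgebroid
end HopfAlgd

/-! ### Assembly of the two halves -/

theorem mainTheorem1 {k A U : Type*} [CommRing k] [Ring A] [Algebra k A] [Ring U] [Algebra k U]
    (H : HopfAlgd.LeftBialgebroid k A U) :
    (∀ hL : H.IsLeftHopf, ∃ F : H.RightDual →ₐ[k] H.LeftDual,
      (∀ (φ : H.RightDual) (u : U), F φ u = HopfAlgd.LeftBialgebroid.sStarUp hL φ u) ∧
      HopfAlgd.IsAugAeRingHom H.rightDualAug H.leftDualAug F (AlgHom.id k A) ∧
      (∀ (h₁ : H.LeftFGP) (h₂ : H.RightFGP),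
        HopfAlgd.IsRightBialgebroidHom (H.rightDualBialgebroid h₂) (H.leftDualBialgebroid h₁) F
          (AlgHom.id k A)) ∧
      (letI : Module U H.RightDual := HopfAlgd.LeftBialgebroid.hopfRightDualModule hL
       letI : Module U H.LeftDual := H.mulLeftDualModule
       ∀ (u : U) (φ : H.RightDual), F (u • φ) = u • F φ)) ∧
    (∀ hR : H.IsRightHopf, ∃ F : H.LeftDual →ₐ[k] H.RightDual,
      (∀ (ψ : H.LeftDual) (u : U), F ψ u = HopfAlgd.LeftBialgebroid.sStarDown hR ψ u) ∧
      HopfAlgd.IsAugAeRingHom H.leftDualAug H.rightDualAug F (AlgHom.id k A) ∧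
      (∀ (h₁ : H.LeftFGP) (h₂ : H.RightFGP),
        HopfAlgd.IsRightBialgebroidHom (H.leftDualBialgebroid h₁) (H.rightDualBialgebroid h₂) F
          (AlgHom.id k A)) ∧
      (letI : Module U H.LeftDual := HopfAlgd.LeftBialgebroid.hopfLeftDualModule hR
       letI : Module U H.RightDual := H.mulRightDualModule
       ∀ (u : U) (ψ : H.LeftDual), F (u • ψ) = u • F ψ)) := by
  -- The defining formulas hold by `rfl`, and the scalar multiplications of the local module
  -- structures unfold to the actions in `sStarUpLin_act` and `sStarDownLin_act`.
  refine ⟨fun hL => ⟨HopfAlgd.LeftBialgebroid.sStarUpHom hL, fun _ _ => rfl,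
    HopfAlgd.LeftBialgebroid.isAugAeRingHom_sStarUpHom hL,
    HopfAlgd.LeftBialgebroid.isRightBialgebroidHom_sStarUpHom hL,
    HopfAlgd.LeftBialgebroid.sStarUpLin_act hL⟩, fun hR =>
    ⟨HopfAlgd.LeftBialgebroid.sStarDownHom hR, fun _ _ => rfl,
    HopfAlgd.LeftBialgebroid.isAugAeRingHom_sStarDownHom hR,
    fun h₁ h₂ => HopfAlgd.LeftBialgebroid.isRightBialgebroidHom_sStarDownHom hR h₂ h₁,
    HopfAlgd.LeftBialgebroid.sStarDownLin_act hR⟩⟩
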